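/- Let $q$ be a prime power. For a finite poset $P$ let $\widetilde\chi(P)=\sum_{s}(-1)^{|s|-1}$, the sum over all chains $s$ of $P$ including the empty one, and for a finite group $G$ acting on $P$ by poset automorphisms let $$\widetilde\chi_r(P,G)=\frac1{|G|}\sum_{X\in\mathrm{Hom}(\mathbf Z^r,G)}\widetilde\chi\bigl(C_P(X(\mathbf Z^r))\bigr),$$ where $C_P(A)$ is the subposet of elements of $P$ fixed by $A$. Let $\mathrm{GU}_n(q)$ be the group of linear automorphisms of $\mathbf F_{q^2}^n$ that preserve the nondegenerate Hermitian form $\langle u,v\rangle=c\sum_{i=1}^n(-1)^{i+1}u_iv_{n+1-i}^q$, where $c\in\mathbf F_{q^2}^\times$ satisfies $c^{q-1}=(-1)^{n+1}$. Let $L_n^-(q)^*$ be the poset of nonzero totally isotropic subspaces of $\mathbf F_{q^2}^n$, and put $\widetilde\chi_r(\mathrm{GU}_n(q))=\widetilde\chi_r(L_n^-(q)^*,\mathrm{GU}_n(q))$. Let $\widetilde\chi_r(\mathrm{GL}_n(q))$ be the $r$th equivariant reduced Euler characteristic of $\mathrm{GL}_n(q)$ acting on the poset of nonzero proper subspaces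 of $\mathbf F_q^n$. For a polynomial $f=a_0\prod_i(x-\alpha_i)\in\mathbf F_{q^2}[x]$ with $f(0)\neq0$ (the $\alpha_i$ in a splitting field), the dual polynomial is $\bar f=a_0\prod_i(x-\alpha_i^{-q})\in\mathbf F_{q^2}[x]$, and $f$ is self-dual if $f=\bar f$. Let $n>1$ and $r\ge1$. Then $$\widetilde\chi_{r+1}(\mathrm{GU}_n(q))=\sum_{[g]}\widetilde\chi_r\bigl(C_{L_n^-(q)^*}(g),\,C_{\mathrm{GU}_n(q)}(g)\bigr),$$ where the sum runs over the conjugacy classes $[g]$ of $\mathrm{GU}_n(q)$ of elements of order prime to $q$. Moreover, for every $g\in\mathrm{GU}_n(q)$ of order prime to $q$, the characteristic polynomial of $g$ has the form $$\prod_i r_i^{m_i^-}\cdot\prod_j(s_j\bar s_j)^{m_j^+}$$ with positive exponents, where the $r_i$ are distinct self-dual monic irreducible polynomials, the $s_j$ are monic irreducible polynomials that are not self-dual, all with nonzero constant term, and the pairs $\{s_j,\bar s_j\}$ are distinct; and for every such factorization, with $d_i^-=\deg r_i$ and $d_j^+=\deg s_j$, one has $\sum_i m_i^-d_i^-+\sum_j2m_j^+d_j^+=n$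 and $$-\widetilde\chi_r\bigl(C_{L_n^-(q)^*}(g),\,C_{\mathrm{GU}_n(q)}(g)\bigr)=\prod_i\bigl(-\widetilde\chi_r(\mathrm{GU}_{m_i^-}(q^{d_i^-}))\bigr)\cdot\prod_j\widetilde\chi_r(\mathrm{GL}_{m_j^+}(q^{2d_j^+})).$$ -/

import Mathlib

open Polynomial
open scoped Pointwise

noncomputable section

namespace UnitaryEuler

/-- The reduced Euler characteristic of a finite subposet `P` of `Q`: the sum of `(-1)^(|s|-1)`
over all chains `s` in `P`, the empty chain included (so `∅` has reduced Euler
characteristic `-1`). -/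
def redEuler {Q : Type*} [PartialOrder Q] (P : Set Q) : ℤ :=
  ∑ᶠ (s : Finset Q) (_ : (s : Set Q) ⊆ P ∧ IsChain (· ≤ ·) (s : Set Q)), (-1) ^ (s.card + 1)

/-- The `r`th equivariant reduced Euler characteristic of the `H`-poset `P`, where `P` is a finite
subposet of the `Γ`-poset `Q` that is stable under the finite subgroup `H` of `Γ`. -/
def eqEuler {Γ Q : Type*} [Group Γ] [PartialOrder Q] [MulAction Γ Q]
    (r : ℕ) (H : Subgroup Γ) (P : Set Q) : ℚ :=
  (1 / (Nat.card H : ℚ)) *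
    ∑ᶠ X : Multiplicative (Fin r → ℤ) →* H,
      (redEuler {x : Q | x ∈ P ∧ ∀ h ∈ X.range, (h : Γ) • x = x} : ℚ)

/-- The sum in `eqEuler` is over a finite set if the group is finite. -/
instance finite_hom (r : ℕ) (G : Type*) [Group G] [Finite G] :
    Finite (Multiplicative (Fin r → ℤ) →* G) := by
  refine Finite.of_injective
    (fun X (i : Fin r) => X (Multiplicative.ofAdd (Pi.single i 1))) ?_
  intro X Y h
  refine MonoidHom.ext fun v => ?_
  refine Pi.single_induction (M := fun _ : Fin r => ℤ)
    (fun w => X (Multiplicative.ofAdd w) = Y (Multiplicative.ofAdd w)) (Multiplicative.toAdd v)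
    ?_ ?_ ?_
  · rw [ofAdd_zero, map_one, map_one]
  · intro f g hf hg
    rw [ofAdd_add, map_mul, map_mul, hf, hg]
  · intro i m
    have hm : (Pi.single i m : Fin r → ℤ) = m • Pi.single i 1 := by
      rw [← Pi.single_smul, smul_eq_mul, mul_one]
    rw [hm, ofAdd_zsmul, map_zpow, map_zpow]
    exact congrArg (· ^ m) (congrFun h i)

section Form

variable (K : Type*) [Field K] (q n : ℕ)

/-- A scalar `c ≠ 0` with `c ^ (q - 1) = (-1) ^ (n + 1)`; it exists in a field with `q ^ 2`
elements. -/
def hermConst : K := Classical.epsilon fun c : K => c ≠ 0 ∧ c ^ (q - 1) = (-1) ^ (n + 1)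

theorem hermConst_spec [Finite K] {p k : ℕ} [CharP K p] (hp : p.Prime) (hk : 0 < k)
    (hq : q = p ^ k) (hK : Nat.card K = q ^ 2) :
    hermConst K q n ≠ 0 ∧ hermConst K q n ^ (q - 1) = (-1) ^ (n + 1) := by
  apply Classical.epsilon_spec (p := fun c : K => c ≠ 0 ∧ c ^ (q - 1) = (-1) ^ (n + 1))
  have hq1 : 1 < q := hq ▸ Nat.one_lt_pow hk.ne' hp.one_lt
  rcases Nat.even_or_odd n with hn | hn
  · have : Fintype K := Fintype.ofFinite K
    have : Fact p.Prime := ⟨hp⟩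
    have hcard : Fintype.card K = q ^ 2 := by rw [← Nat.card_eq_fintype_card, hK]
    obtain ⟨a, ha⟩ : ∃ a : K, a ^ q ≠ a := by
      by_contra! hall
      have hne : (X ^ q - X : K[X]) ≠ 0 := FiniteField.X_pow_card_sub_X_ne_zero K hq1
      have h1 : Fintype.card K ≤ (X ^ q - X : K[X]).natDegree :=
        Polynomial.card_le_degree_of_subset_roots (p := X ^ q - X) (Z := Finset.univ) (by
          intro x _
          rw [Polynomial.mem_roots hne]
          simp [hall x])
      rw [FiniteField.X_pow_card_sub_X_natDegree_eq K hq1, hcard] at h1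
      nlinarith
    have hc : a ^ q - a ≠ 0 := sub_ne_zero.mpr ha
    refine ⟨a ^ q - a, hc, ?_⟩
    have h2 : (a ^ q - a) ^ q = -(a ^ q - a) := by
      have h3 : (a ^ q - a) ^ q = (a ^ q) ^ q - a ^ q := by
        rw [hq]; exact sub_pow_char_pow ..
      rw [h3, ← pow_mul, ← pow_two, ← hcard, FiniteField.pow_card]; ring
    have h4 : (a ^ q - a) ^ (q - 1) * (a ^ q - a) = -1 * (a ^ q - a) := by
      rw [← pow_succ, Nat.sub_add_cancel hq1.le, h2]; ring
    rw [mul_right_cancel₀ hc h4, hn.add_one.neg_one_pow]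
  · exact ⟨1, one_ne_zero, by rw [one_pow, hn.add_one.neg_one_pow]⟩

/-- The Hermitian form `⟨u, v⟩ = c ∑ i, (-1)^(i+1) u_i v_{n+1-i}^q` (`i = 1, …, n`) on `K ^ n`,
where `K` has `q ^ 2` elements; the indices in the code start at `0`. -/
def hermForm (u v : Fin n → K) : K :=
  hermConst K q n * ∑ i : Fin n, (-1) ^ (i : ℕ) * u i * v (Fin.rev i) ^ q

/-- The group of all linear automorphisms of `K ^ n` that preserve the Hermitian form. -/
def unitaryGroup : Subgroup ((Fin n → K) ≃ₗ[K] (Fin n → K)) where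
  carrier := {g | ∀ u v, hermForm K q n (g u) (g v) = hermForm K q n u v}
  mul_mem' {g h} hg hh u v := by
    rw [LinearEquiv.mul_apply, LinearEquiv.mul_apply, hg, hh]
  one_mem' _ _ := rfl
  inv_mem' {g} hg u v := by
    rw [← hg]
    exact congrArg₂ _ (g.apply_symm_apply u) (g.apply_symm_apply v)

/-- The poset of nonzero totally isotropic subspaces of `K ^ n`, ordered by inclusion. -/
def isotropicPoset : Set (Submodule K (Fin n → K)) :=
  {U | U ≠ ⊥ ∧ ∀ u ∈ U, ∀ v ∈ U, hermForm K q n u v = 0}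

/-- The poset of nonzero proper subspaces of `K ^ n`, ordered by inclusion. -/
def properPoset : Set (Submodule K (Fin n → K)) := {U | U ≠ ⊥ ∧ U ≠ ⊤}

end Form

section Galois

variable (p : ℕ) [Fact p.Prime] (k : ℕ)

/-- `GU n (p ^ k)`, acting on `𝔽 ^ n` with `𝔽` the field with `(p ^ k) ^ 2` elements. -/
abbrev GU (n : ℕ) :
    Subgroup ((Fin n → GaloisField p (2 * k)) ≃ₗ[GaloisField p (2 * k)]
      (Fin n → GaloisField p (2 * k))) :=
  unitaryGroup (GaloisField p (2 * k)) (p ^ k) n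

/-- The `r`th equivariant reduced Euler characteristic of `GU n (p ^ k)` acting on the nonzero
totally isotropic subspaces. -/
def chiGU (n r : ℕ) : ℚ :=
  eqEuler r (GU p k n) (isotropicPoset (GaloisField p (2 * k)) (p ^ k) n)

/-- The `r`th equivariant reduced Euler characteristic of `GL n (p ^ k)` acting on the nonzero
proper subspaces. -/
def chiGL (n r : ℕ) : ℚ :=
  eqEuler r
    (⊤ : Subgroup ((Fin n → GaloisField p k) ≃ₗ[GaloisField p k] (Fin n → GaloisField p k)))
    (properPoset (GaloisField p k) n)

/-- The `r`th equivariant reduced Euler characteristic of the centralizer of `g` in `GU n (p ^ k)`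
acting on the `g`-invariant nonzero totally isotropic subspaces. -/
def chiCentralizer (n r : ℕ) (g : GU p k n) : ℚ :=
  eqEuler r (GU p k n ⊓ Subgroup.centralizer {g.1})
    {U | U ∈ isotropicPoset (GaloisField p (2 * k)) (p ^ k) n ∧ g.1 • U = U}

end Galois

section Dual

variable {K : Type*} [Field K] (q : ℕ)

/-- `f'` is the dual of `f`: if `f = a₀ ∏ (X - αᵢ)` over the splitting field of `f`,
then `f' = a₀ ∏ (X - αᵢ ^ (-q))`. -/
def IsDual (f f' : K[X]) : Prop :=
  f'.map (algebraMap K f.SplittingField) =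
    C (algebraMap K f.SplittingField f.leadingCoeff) *
      ((f.aroots f.SplittingField).map fun α => X - C (α⁻¹ ^ q)).prod

/-- `f = ∏ i, ρ i ^ a i * ∏ j, (s j * s' j) ^ b j` is the factorization of `f` into irreducibles,
with the `ρ i` the distinct self-dual monic irreducible factors and the `{s j, s' j}` the distinct
pairs of a monic irreducible factor that is not self-dual and its dual. -/
structure IsDualFactorization (f : K[X]) {I J : ℕ} (ρ : Fin I → K[X]) (a : Fin I → ℕ)
    (s s' : Fin J → K[X]) (b : Fin J → ℕ) : Prop where
  monic_self : ∀ i, (ρ i).Monic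
  irreducible_self : ∀ i, Irreducible (ρ i)
  coeff_zero_self : ∀ i, (ρ i).coeff 0 ≠ 0
  dual_self : ∀ i, IsDual q (ρ i) (ρ i)
  injective_self : Function.Injective ρ
  pos_self : ∀ i, 0 < a i
  monic_pair : ∀ j, (s j).Monic
  irreducible_pair : ∀ j, Irreducible (s j)
  coeff_zero_pair : ∀ j, (s j).coeff 0 ≠ 0
  dual_pair : ∀ j, IsDual q (s j) (s' j)
  ne_pair : ∀ j, s j ≠ s' j
  distinct_pair : ∀ j j', j ≠ j' → s j ≠ s j' ∧ s j ≠ s' j'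
  pos_pair : ∀ j, 0 < b j
  eq_prod : f = (∏ i, ρ i ^ a i) * ∏ j, (s j * s' j) ^ b j

end Dual

end UnitaryEuler

end

/-
A commuting `(r + 1)`-tuple is an element `g` together with a commuting `r`-tuple in its
centralizer, which expresses `χ_{r+1}` as a sum over the conjugacy classes. If `p` divides the order
of `g`, let `u ≠ 1` be its `p`-part and `N = u - 1`: the fixed isotropic subspaces contract
conically by means of the nonzero isotropic space `ker N ⊓ range N`, and `g` contributes `0`.

If the order of `g` is prime to `p`, the space is the orthogonal sum of the kernels of the self-dual
factors `ρ i` and `s j * s' j` of the characteristic polynomial. For a poset with a least element,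
the negated reduced Euler characteristic of the complement of that element is the sum of its Möbius
function, hence multiplicative over products. On the kernel of `ρ i` the form descends from a
Hermitian form over the extension generated by a root, because the degree of `ρ i` is odd; this
gives the factors `GU`. The kernel of `s j * s' j` is a hyperbolic sum of two totally isotropic
spaces `W` and `W'`, whose invariant isotropic subspaces are the intervals in the poset of invariant
subspaces of `W`; this gives the factors `GL`.
-/

open Polynomial
open scoped Pointwise

noncomputable section

namespace UnitaryEuler

section Poset

variable {Q R : Type*} [PartialOrder Q] [PartialOrder R]

open scoped Classical in
theorem redEuler_eq_sum [Fintype Q] (P : Set Q) :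
    redEuler P = ∑ s ∈ Finset.univ.filter fun s : Finset Q =>
      (s : Set Q) ⊆ P ∧ IsChain (· ≤ ·) (s : Set Q), (-1) ^ (s.card + 1) :=
  finsum_cond_eq_sum_of_cond_iff (fun s : Finset Q => (-1 : ℤ) ^ (s.card + 1)) (by simp)

theorem redEuler_image (f : Q ↪o R) (P : Set Q) : redEuler (f '' P) = redEuler P := by
  refine (finsum_mem_eq_of_bijOn
    (s := {s : Finset Q | (s : Set Q) ⊆ P ∧ IsChain (· ≤ ·) (s : Set Q)})
    (t := {s : Finset R | (s : Set R) ⊆ f '' P ∧ IsChain (· ≤ ·) (s : Set R)})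
    (Finset.map f.toEmbedding) ⟨?_, (Finset.map_injective _).injOn, ?_⟩
    fun s _ => by rw [Finset.card_map]).symm
  · rintro s ⟨hsP, hs⟩
    exact ⟨by simpa using Set.image_mono hsP, by simpa using hs.image f⟩
  · rintro t ⟨htP, ht⟩
    classical
    obtain ⟨s, hsP, rfl⟩ := Finset.subset_set_image_iff.1 htP
    rw [Finset.coe_image] at ht
    exact ⟨s, ⟨hsP, IsChain.image_relEmbedding_iff.1 ht⟩, Finset.map_eq_image _ _⟩

theorem exists_insert_eq_of_isChain [DecidableEq Q] {t : Finset Q}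
    (ht : IsChain (· ≤ ·) (t : Set Q)) (hne : t.Nonempty) :
    ∃ m s, insert m s = t ∧ ∀ x ∈ s, x < m := by
  obtain ⟨m, hm⟩ := t.exists_maximal hne
  refine ⟨m, t.erase m, Finset.insert_erase hm.1, fun x hx => ?_⟩
  obtain ⟨hxm, hxt⟩ := Finset.mem_erase.1 hx
  exact ((ht.total hxt hm.1).resolve_right fun h => hxm (hm.eq_of_le hxt h).symm).lt_of_ne hxm

theorem eq_and_eq_of_insert_eq_insert [DecidableEq Q] {m m' : Q} {s s' : Finset Q}
    (hs : ∀ x ∈ s, x < m) (hs' : ∀ x ∈ s', x < m') (h : insert m s = insert m' s') :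
    m = m' ∧ s = s' := by
  obtain rfl : m = m' := by
    have h1 : m ∈ insert m' s' := h ▸ Finset.mem_insert_self m s
    have h2 : m' ∈ insert m s := h ▸ Finset.mem_insert_self m' s'
    rcases Finset.mem_insert.1 h1 with h1 | h1
    · exact h1
    rcases Finset.mem_insert.1 h2 with h2 | h2
    · exact h2.symm
    exact absurd (hs m' h2) (hs' m h1).not_gt
  refine ⟨rfl, ?_⟩
  rw [← Finset.erase_insert fun hm => lt_irrefl m (hs m hm), h,
    Finset.erase_insert fun hm => lt_irrefl m (hs' m hm)]

open scoped Classical in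
/-- A nonempty chain is given by its greatest element `m` and a chain in `P ∩ Iio m`. -/
theorem redEuler_eq_neg_one_sub [Fintype Q] (P : Set Q) :
    redEuler P = -1 - ∑ m with m ∈ P, redEuler (P ∩ Set.Iio m) := by
  have hempty : ∅ ∈ Finset.univ.filter fun s : Finset Q =>
      (s : Set Q) ⊆ P ∧ IsChain (· ≤ ·) (s : Set Q) := by simp
  simp_rw [redEuler_eq_sum]
  rw [← Finset.add_sum_erase _ _ hempty, Finset.card_empty, zero_add, pow_one, sub_eq_add_neg,
    Finset.sum_sigma', ← Finset.sum_neg_distrib]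
  congr 1
  symm
  refine Finset.sum_bij (fun x _ => insert x.1 x.2) ?_ ?_ ?_ ?_
  · rintro ⟨m, s⟩ h
    simp only [Finset.mem_sigma, Finset.mem_filter_univ, Set.subset_inter_iff] at h
    obtain ⟨hm, ⟨hsP, hsm⟩, hs⟩ := h
    simp only [Finset.mem_erase, Finset.insert_ne_empty, ne_eq, not_false_eq_true, true_and,
      Finset.mem_filter_univ, Finset.coe_insert]
    exact ⟨Set.insert_subset hm hsP, hs.insert fun b hb _ => Or.inr (hsm hb).le⟩
  · rintro ⟨m, s⟩ h ⟨m', s'⟩ h' heq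
    simp only [Finset.mem_sigma, Finset.mem_filter_univ, Set.subset_inter_iff] at h h'
    obtain ⟨-, ⟨-, hsm⟩, -⟩ := h
    obtain ⟨-, ⟨-, hsm'⟩, -⟩ := h'
    dsimp only at heq
    obtain ⟨rfl, rfl⟩ := eq_and_eq_of_insert_eq_insert hsm hsm' heq
    rfl
  · intro t ht
    simp only [Finset.mem_erase, Finset.mem_filter_univ] at ht
    obtain ⟨hne, htP, ht⟩ := ht
    obtain ⟨m, s, rfl, hsm⟩ := exists_insert_eq_of_isChain ht (Finset.nonempty_iff_ne_empty.2 hne)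
    rw [Finset.coe_insert] at htP ht
    obtain ⟨hm, hsP⟩ := Set.insert_subset_iff.1 htP
    exact ⟨⟨m, s⟩, by simpa using ⟨hm, ⟨hsP, hsm⟩, ht.mono (Set.subset_insert _ _)⟩, rfl⟩
  · rintro ⟨m, s⟩ h
    simp only [Finset.mem_sigma, Finset.mem_filter_univ, Set.subset_inter_iff] at h
    rw [Finset.card_insert_of_notMem fun hms => lt_irrefl m (h.2.1.2 hms), pow_succ _ (_ + 1)]
    ring

end Poset

section Moebius

variable {L L' : Type*} [PartialOrder L] [PartialOrder L']

open scoped Classical in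
/-- The Möbius function `μ(⊥, x)` of a finite poset with least element, in the form given by
Philip Hall's theorem. -/
def muBot [OrderBot L] (x : L) : ℤ := if x = ⊥ then 1 else redEuler (Set.Ioo ⊥ x)

theorem redEuler_ne_bot [OrderBot L] [Fintype L] :
    redEuler {x : L | x ≠ ⊥} = -∑ x : L, muBot x := by
  classical
  rw [redEuler_eq_neg_one_sub, ← Finset.add_sum_erase _ _ (Finset.mem_univ ⊥), muBot, if_pos rfl,
    neg_add, sub_eq_add_neg]
  congr 2
  refine Finset.sum_congr (by ext; simp) fun x hx => ?_
  rw [muBot, if_neg (Finset.ne_of_mem_erase hx)]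
  congr 1
  ext y
  simp [bot_lt_iff_ne_bot]

open scoped Classical in
theorem sum_le_muBot [OrderBot L] [Fintype L] (x : L) :
    ∑ y with y ≤ x, muBot y = if x = ⊥ then 1 else 0 := by
  split_ifs with hx
  · simp only [hx, le_bot_iff]
    rw [Finset.sum_eq_single_of_mem ⊥ (by simp) (by simp), muBot, if_pos rfl]
  have hfilter : (Finset.univ.filter fun y : L => y ≤ x) =
      insert ⊥ (insert x (Finset.univ.filter fun y : L => y ∈ Set.Ioo ⊥ x)) := by
    ext y
    simp only [Finset.mem_filter_univ, Finset.mem_insert, Set.mem_Ioo]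
    grind [bot_le, bot_lt_iff_ne_bot, le_iff_lt_or_eq]
  have hx' : muBot x = -1 - ∑ y with y ∈ Set.Ioo ⊥ x, muBot y := by
    rw [muBot, if_neg hx, redEuler_eq_neg_one_sub]
    congr 1
    refine Finset.sum_congr (by simp) fun y hy => ?_
    rw [Finset.mem_filter_univ] at hy
    rw [muBot, if_neg hy.1.ne']
    congr 1
    ext z
    simpa [and_assoc] using fun _ hz => hz.trans hy.2
  rw [hfilter, Finset.sum_insert (by simp [Ne.symm hx]), Finset.sum_insert (by simp), hx', muBot,
    if_pos rfl]
  ring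

open scoped Classical in
theorem eq_of_sum_le_eq [Fintype L] {f g : L → ℤ}
    (h : ∀ x, ∑ y with y ≤ x, f y = ∑ y with y ≤ x, g y) : f = g := by
  funext x
  induction x using WellFoundedLT.induction with
  | _ x ih =>
    have hfilter : (Finset.univ.filter fun y : L => y ≤ x) =
        insert x (Finset.univ.filter (· < x)) := by
      ext y
      simp [le_iff_lt_or_eq, or_comm]
    have hx := h x
    rw [hfilter, Finset.sum_insert (by simp), Finset.sum_insert (by simp)] at hx
    rw [Finset.sum_congr rfl fun y hy => ih y (Finset.mem_filter.1 hy).2] at hx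
    exact add_right_cancel hx

section GaloisConnection

variable [OrderBot L'] {l : L' → L} {u : L → L'}

open scoped Classical in
theorem sum_le_sum_fiber_muBot [Fintype L] [Fintype L'] (hlu : GaloisConnection l u) (x : L) :
    ∑ y with y ≤ x, ∑ t with l t = y, muBot t = if u x = ⊥ then 1 else 0 := by
  rw [← sum_le_muBot]
  refine (Finset.sum_fiberwise_eq_sum_filter _ _ l _).trans ?_
  simp [hlu _ _]

theorem redEuler_ne_bot_eq_of_galoisConnection [OrderBot L] [Finite L] [Finite L']
    (hlu : GaloisConnection l u) (hu : ∀ x, u x = ⊥ ↔ x = ⊥) :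
    redEuler {t : L' | t ≠ ⊥} = redEuler {x : L | x ≠ ⊥} := by
  classical
  have := Fintype.ofFinite L
  have := Fintype.ofFinite L'
  have hfiber : (fun y => ∑ t with l t = y, muBot t) = muBot := eq_of_sum_le_eq fun x => by
    simp only [sum_le_sum_fiber_muBot hlu, sum_le_muBot, hu]
  rw [redEuler_ne_bot, redEuler_ne_bot, ← Finset.sum_fiberwise _ l, ← hfiber]

theorem redEuler_ne_bot_eq_zero_of_galoisConnection [Finite L] [Finite L']
    (hlu : GaloisConnection l u) (hu : ∀ x, u x ≠ ⊥) : redEuler {t : L' | t ≠ ⊥} = 0 := by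
  classical
  have := Fintype.ofFinite L
  have := Fintype.ofFinite L'
  have hfiber : (fun y => ∑ t with l t = y, muBot t) = 0 := eq_of_sum_le_eq fun x => by
    simp [sum_le_sum_fiber_muBot hlu, hu]
  rw [redEuler_ne_bot, ← Finset.sum_fiberwise _ l, hfiber]
  simp

end GaloisConnection

theorem muBot_pi {ι : Type*} [Fintype ι] {L : ι → Type*} [∀ i, PartialOrder (L i)]
    [∀ i, OrderBot (L i)] [∀ i, Finite (L i)] (x : ∀ i, L i) : muBot x = ∏ i, muBot (x i) := by
  classical
  have := fun i => Fintype.ofFinite (L i)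
  refine congrFun (g := fun x => ∏ i, muBot (x i)) (eq_of_sum_le_eq fun x => ?_) x
  rw [sum_le_muBot]
  have hpi : (Finset.univ.filter fun y : ∀ i, L i => y ≤ x) =
      Fintype.piFinset fun i => Finset.univ.filter (· ≤ x i) := by
    ext y
    simp [Pi.le_def]
  rw [hpi, ← Finset.prod_univ_sum, Finset.prod_congr rfl fun i _ => sum_le_muBot (x i),
    Finset.prod_ite_zero]
  simp [funext_iff]

theorem neg_redEuler_pi {ι : Type*} [Fintype ι] {L : ι → Type*} [∀ i, PartialOrder (L i)]
    [∀ i, OrderBot (L i)] [∀ i, Finite (L i)] :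
    -redEuler {x : ∀ i, L i | x ≠ ⊥} = ∏ i, -redEuler {x : L i | x ≠ ⊥} := by
  classical
  have := fun i => Fintype.ofFinite (L i)
  simp_rw [redEuler_ne_bot, neg_neg, Finset.prod_univ_sum, Fintype.piFinset_univ, muBot_pi]

open scoped Classical in
theorem sum_ge_muBot_toDual [OrderTop L] [Fintype L] (x : L) :
    ∑ y with x ≤ y, muBot (OrderDual.toDual y) = if x = ⊤ then 1 else 0 :=
  sum_le_muBot (OrderDual.toDual x)

theorem redEuler_preimage_ofDual (P : Set L) : redEuler (OrderDual.ofDual ⁻¹' P) = redEuler P := by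
  refine finsum_congr fun s : Finset L => finsum_congr_Prop ?_ fun _ => rfl
  exact propext (and_congr_right' ⟨IsChain.symm, IsChain.symm⟩)

section Interval

variable [BoundedOrder L]

instance finite_nonemptyInterval [Finite L] : Finite (NonemptyInterval L) :=
  Finite.of_injective _ NonemptyInterval.toProd_injective

/-- The intervals `[x, y]` are ordered by reverse inclusion here, so `⊥` is `[⊥, ⊤]`. -/
theorem muBot_interval [Finite L] (I : (NonemptyInterval L)ᵒᵈ) :
    muBot I = muBot (OrderDual.ofDual I).fst *
      muBot (OrderDual.toDual (OrderDual.ofDual I).snd) := by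
  classical
  have := Fintype.ofFinite L
  have := Fintype.ofFinite (NonemptyInterval L)ᵒᵈ
  refine congrFun (g := fun I => muBot (OrderDual.ofDual I).fst *
      muBot (OrderDual.toDual (OrderDual.ofDual I).snd)) (eq_of_sum_le_eq fun I => ?_) I
  obtain ⟨⟨⟨x, y⟩, hxy⟩, rfl⟩ := OrderDual.toDual.surjective I
  have hbot : OrderDual.toDual (⟨(x, y), hxy⟩ : NonemptyInterval L) = ⊥ ↔ x = ⊥ ∧ y = ⊤ := by
    rw [OrderDual.toDual_eq_bot, NonemptyInterval.ext_iff]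
    exact Prod.ext_iff
  rw [sum_le_muBot]
  simp only [hbot]
  rw [← one_mul 1, ← ite_zero_mul_ite_zero, ← sum_le_muBot, ← sum_ge_muBot_toDual,
    Finset.sum_mul_sum, ← Finset.sum_product']
  symm
  refine Finset.sum_bij (fun J _ => (OrderDual.ofDual J).toProd) ?_ ?_ ?_ fun _ _ => rfl
  · intro J hJ
    simp only [Finset.mem_product, Finset.mem_filter_univ] at hJ ⊢
    exact hJ
  · exact fun J _ J' _ h => NonemptyInterval.toProd_injective h
  · rintro ⟨a, b⟩ hab
    simp only [Finset.mem_product, Finset.mem_filter_univ] at hab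
    refine ⟨OrderDual.toDual ⟨(a, b), hab.1.trans (hxy.trans hab.2)⟩, ?_, rfl⟩
    simp only [Finset.mem_filter_univ]
    exact hab

theorem neg_redEuler_interval [Nontrivial L] [Finite L] :
    -redEuler {I : (NonemptyInterval L)ᵒᵈ | I ≠ ⊥} = redEuler {x : L | x ≠ ⊥ ∧ x ≠ ⊤} := by
  classical
  have := Fintype.ofFinite L
  have := Fintype.ofFinite (NonemptyInterval L)ᵒᵈ
  have hsum : ∑ I : (NonemptyInterval L)ᵒᵈ, muBot I =
      ∑ b : L, (∑ a with a ≤ b, muBot a) * muBot (OrderDual.toDual b) := by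
    simp_rw [Finset.sum_mul, Finset.sum_sigma']
    refine Finset.sum_bij (fun I _ => ⟨(OrderDual.ofDual I).snd, (OrderDual.ofDual I).fst⟩)
      ?_ ?_ ?_ fun I _ => muBot_interval I
    · intro I _
      simpa using (OrderDual.ofDual I).fst_le_snd
    · intro I _ J _ h
      obtain ⟨h₂, h₁⟩ := Sigma.mk.inj h
      exact NonemptyInterval.toProd_injective (Prod.ext (eq_of_heq h₁) h₂)
    · rintro ⟨b, a⟩ hab
      exact ⟨OrderDual.toDual ⟨(a, b), by simpa using hab⟩, Finset.mem_univ _, rfl⟩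
  have hne : OrderDual.toDual (⊥ : L) ≠ ⊥ := fun h => bot_ne_top (OrderDual.toDual.injective h)
  rw [redEuler_ne_bot, neg_neg, hsum]
  simp_rw [sum_le_muBot, ite_mul, one_mul, zero_mul]
  rw [Finset.sum_ite_eq', if_pos (Finset.mem_univ _), muBot,
    if_neg hne, ← redEuler_preimage_ofDual]
  congr 1
  ext x
  exact and_comm.trans (and_congr bot_lt_iff_ne_bot lt_top_iff_ne_top)

end Interval

end Moebius

section FixedIn

variable {Γ Γ' Q Q' : Type*} [Group Γ] [Group Γ'] [MulAction Γ Q] [MulAction Γ' Q']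

/-- The subposet `C_P(A)` of the elements of `P` fixed by a subgroup `A` of `H`. -/
def fixedIn {H : Subgroup Γ} (A : Subgroup H) (P : Set Q) : Set Q :=
  {x | x ∈ P ∧ ∀ h ∈ A, (h : Γ) • x = x}

theorem image_fixedIn {H : Subgroup Γ} {H' : Subgroup Γ'} (P : Set Q) (e : H ≃* H') (f : Q → Q')
    (h : ∀ (g : H), ∀ x ∈ P, (g : Γ) • x = x ↔ (e g : Γ') • f x = f x) (A : Subgroup H) :
    f '' fixedIn A P = fixedIn (A.map e.toMonoidHom) (f '' P) := by
  ext y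
  constructor
  · rintro ⟨x, ⟨hx, hA⟩, rfl⟩
    refine ⟨⟨x, hx, rfl⟩, ?_⟩
    rintro _ ⟨g, hg, rfl⟩
    exact (h g x hx).1 (hA g hg)
  · rintro ⟨⟨x, hx, rfl⟩, hA⟩
    exact ⟨x, ⟨hx, fun g hg => (h g x hx).2 (hA _ ⟨g, hg, rfl⟩)⟩, rfl⟩

theorem image_pi_fixedIn {ι N : Type*} [Group N] {G R : ι → Type*} [∀ i, Group (G i)]
    [∀ i, MulAction (G i) (R i)] [∀ i, Bot (R i)] [Bot Q] {H : Subgroup Γ}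
    {K : ∀ i, Subgroup (G i)} {P : Set Q} {S : ∀ i, Set (R i)} (e : (∀ i, K i) ≃* H)
    (f : (∀ i, R i) ↪ Q) (hf : f ⊥ = ⊥) (hP : f '' Set.univ.pi S = P)
    (h : ∀ g x, (e g : Γ) • f x = f x ↔ ∀ i, (g i : G i) • x i = x i) (X : ∀ i, N →* K i) :
    f '' {x | x ∈ Set.univ.pi (fun i => fixedIn (X i).range (S i)) ∧ x ≠ ⊥} =
      fixedIn (e.toMonoidHom.comp (MonoidHom.pi X)).range {x | x ∈ P ∧ x ≠ ⊥} := by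
  subst hP
  ext y
  constructor
  · rintro ⟨x, ⟨hx, hne⟩, rfl⟩
    refine ⟨⟨⟨x, fun i _ => (hx i trivial).1, rfl⟩, fun h0 => hne (f.injective (h0.trans hf.symm))⟩,
      ?_⟩
    rintro _ ⟨z, rfl⟩
    exact (h _ _).2 fun i => (hx i trivial).2 _ ⟨z, rfl⟩
  · rintro ⟨⟨⟨x, hx, rfl⟩, hne⟩, hfix⟩
    refine ⟨x, ⟨fun i _ => ⟨hx i trivial, ?_⟩, fun h0 => hne (h0 ▸ hf)⟩, rfl⟩
    rintro _ ⟨z, rfl⟩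
    exact (h _ _).1 (hfix _ ⟨z, rfl⟩) i

end FixedIn

section EqEuler

variable {Γ Γ' Q Q' : Type*} [Group Γ] [Group Γ'] [PartialOrder Q] [PartialOrder Q']
  [MulAction Γ Q] [MulAction Γ' Q']

theorem eqEuler_eq (r : ℕ) (H : Subgroup Γ) (P : Set Q) :
    eqEuler r H P = 1 / (Nat.card H : ℚ) *
      ∑ᶠ X : Multiplicative (Fin r → ℤ) →* H, (redEuler (fixedIn X.range P) : ℚ) :=
  rfl

theorem eqEuler_eq_mul (r : ℕ) {H : Subgroup Γ} {P : Set Q} {H' : Subgroup Γ'} {P' : Set Q'}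
    (e : H ≃* H') (c : ℤ)
    (h : ∀ A, redEuler (fixedIn A P) = c * redEuler (fixedIn (A.map e.toMonoidHom) P')) :
    eqEuler r H P = c * eqEuler r H' P' := by
  rw [eqEuler_eq, eqEuler_eq, Nat.card_congr e.toEquiv, mul_left_comm]
  congr 1
  rw [mul_finsum]
  let E : (Multiplicative (Fin r → ℤ) →* H) ≃ (Multiplicative (Fin r → ℤ) →* H') :=
    e.monoidHomCongrRightEquiv
  exact finsum_eq_of_bijective E E.bijective fun X => by
    rw [h, Int.cast_mul, ← MonoidHom.range_comp]
    rfl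

theorem eqEuler_congr (r : ℕ) {H : Subgroup Γ} {P : Set Q} {H' : Subgroup Γ'} {P' : Set Q'}
    (e : H ≃* H') (f : Q ↪o Q') (hP : f '' P = P')
    (h : ∀ (g : H), ∀ x ∈ P, (g : Γ) • x = x ↔ (e g : Γ') • f x = f x) :
    eqEuler r H P = eqEuler r H' P' := by
  have key := eqEuler_eq_mul r (P := P) (P' := P') e 1 fun A => by
    rw [one_mul, ← hP, ← image_fixedIn P e f h, redEuler_image]
  rwa [Int.cast_one, one_mul] at key

theorem neg_redEuler_pi_mem {ι : Type*} [Fintype ι] {L : ι → Type*} [∀ i, PartialOrder (L i)]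
    [∀ i, OrderBot (L i)] [∀ i, Finite (L i)] (P : ∀ i, Set (L i)) (hP : ∀ i, ⊥ ∈ P i) :
    -redEuler {x : ∀ i, L i | x ∈ Set.univ.pi P ∧ x ≠ ⊥} =
      ∏ i, -redEuler {x : L i | x ∈ P i ∧ x ≠ ⊥} := by
  let _ : ∀ i, OrderBot (P i) := fun i => Subtype.orderBot (hP i)
  let F : (∀ i, P i) ↪o ∀ i, L i :=
    OrderEmbedding.ofMapLEIff (fun x i => x i) fun _ _ => Iff.rfl
  have hF : F '' {x | x ≠ ⊥} = {x : ∀ i, L i | x ∈ Set.univ.pi P ∧ x ≠ ⊥} := by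
    ext y
    constructor
    · rintro ⟨x, hx, rfl⟩
      exact ⟨fun i _ => (x i).2, fun h => hx (F.injective h)⟩
    · rintro ⟨hy, hne⟩
      exact ⟨fun i => ⟨y i, hy i trivial⟩, fun h => hne (congrArg F h), rfl⟩
  have hsub : ∀ i, OrderEmbedding.subtype (· ∈ P i) '' {x : P i | x ≠ ⊥} =
      {x | x ∈ P i ∧ x ≠ ⊥} := by
    intro i
    ext y
    constructor
    · rintro ⟨x, hx, rfl⟩
      exact ⟨x.2, fun h => hx (Subtype.ext h)⟩
    · rintro ⟨hy, hne⟩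
      exact ⟨⟨y, hy⟩, fun h => hne (congrArg Subtype.val h), rfl⟩
  rw [← hF, redEuler_image, neg_redEuler_pi]
  exact Finset.prod_congr rfl fun i _ => by rw [← hsub, redEuler_image]

theorem neg_eqEuler_eq_prod {ι : Type*} [Fintype ι] {G R : ι → Type*} [∀ i, Group (G i)]
    [∀ i, PartialOrder (R i)] [∀ i, OrderBot (R i)] [∀ i, MulAction (G i) (R i)] [OrderBot Q]
    [∀ i, Finite (R i)] (r : ℕ) {H : Subgroup Γ} {K : ∀ i, Subgroup (G i)} [∀ i, Finite (K i)]
    {P : Set Q} {S : ∀ i, Set (R i)} (hS : ∀ i, ⊥ ∈ S i)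
    (hbot : ∀ i (g : K i), (g : G i) • (⊥ : R i) = ⊥)
    (e : (∀ i, K i) ≃* H) (f : (∀ i, R i) ↪o Q) (hf : f ⊥ = ⊥) (hP : f '' Set.univ.pi S = P)
    (h : ∀ g x, (e g : Γ) • f x = f x ↔ ∀ i, (g i : G i) • x i = x i) :
    -eqEuler r H {x | x ∈ P ∧ x ≠ ⊥} = ∏ i, -eqEuler r (K i) {x | x ∈ S i ∧ x ≠ ⊥} := by
  classical
  have := fun i => Fintype.ofFinite (Multiplicative (Fin r → ℤ) →* K i)
  have hpi : Function.Bijective fun X : ∀ i, Multiplicative (Fin r → ℤ) →* K i =>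
      MonoidHom.pi X :=
    ⟨fun X Y hXY => funext fun i => MonoidHom.ext fun z => congrFun (DFunLike.congr_fun hXY z) i,
      fun Y => ⟨fun i => (Pi.evalMonoidHom _ i).comp Y, rfl⟩⟩
  have hsum : ∑ᶠ X : Multiplicative (Fin r → ℤ) →* H,
      (-redEuler (fixedIn X.range {x | x ∈ P ∧ x ≠ ⊥}) : ℚ) =
      ∏ i, ∑ X : Multiplicative (Fin r → ℤ) →* K i,
        (-redEuler (fixedIn X.range {x | x ∈ S i ∧ x ≠ ⊥}) : ℚ) := by
    rw [Finset.prod_univ_sum, Fintype.piFinset_univ, ← finsum_eq_sum_of_fintype]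
    refine (finsum_eq_of_bijective (fun X => e.toMonoidHom.comp (MonoidHom.pi X))
      (e.monoidHomCongrRightEquiv.bijective.comp hpi) fun X => ?_).symm
    have hfix := neg_redEuler_pi_mem (fun i => fixedIn (X i).range (S i))
      fun i => ⟨hS i, fun g _ => hbot i g⟩
    rw [← redEuler_image f, ← f.coe_toEmbedding, image_pi_fixedIn e f.toEmbedding hf hP h] at hfix
    rw [← Int.cast_neg, hfix, Int.cast_prod]
    refine Finset.prod_congr rfl fun i _ => ?_
    rw [Int.cast_neg, show fixedIn (X i).range {x | x ∈ S i ∧ x ≠ ⊥} =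
      {x | x ∈ fixedIn (X i).range (S i) ∧ x ≠ ⊥} from Set.ext fun x => and_right_comm]
  simp only [eqEuler_eq, ← mul_neg, ← finsum_neg_distrib, hsum]
  simp only [finsum_eq_sum_of_fintype, Finset.prod_mul_distrib]
  rw [← Nat.card_congr e.toEquiv, Nat.card_pi, Nat.cast_prod, Finset.prod_div_distrib,
    Finset.prod_const_one]

end EqEuler

section Recursion

variable {Γ Q : Type*} [Group Γ] [MulAction Γ Q]

theorem one_div_card_mul_sum_card_centralizer_mul {G : Type*} [Group G] [Fintype G]
    [Fintype (ConjClasses G)] (F : G → ℚ) (hF : ∀ g h, IsConj g h → F g = F h)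
    (rep : ConjClasses G → G) (hrep : ∀ c, ConjClasses.mk (rep c) = c) :
    1 / (Nat.card G : ℚ) * ∑ g, (Nat.card (Subgroup.centralizer {g}) : ℚ) * F g =
      ∑ c, F (rep c) := by
  classical
  have hG : (Nat.card G : ℚ) ≠ 0 := Nat.cast_ne_zero.2 Nat.card_pos.ne'
  have hcard (g : G) : Nat.card (ConjClasses.mk g).carrier * Nat.card (Subgroup.centralizer {g}) =
      Nat.card G := by
    rw [Subgroup.nat_card_centralizer_nat_card_stabilizer, ← ConjAct.orbit_eq_carrier_conjClasses,
      ← Nat.card_prod, Nat.card_congr (MulAction.orbitProdStabilizerEquivGroup (ConjAct G) g)]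
    rfl
  rw [one_div_mul_eq_div, div_eq_iff hG, Finset.sum_mul,
    ← Finset.sum_fiberwise Finset.univ (ConjClasses.mk (α := G))]
  refine Finset.sum_congr rfl fun c _ => ?_
  have hconj (g : G) (hg : g ∈ Finset.univ.filter fun g => ConjClasses.mk g = c) :
      (Nat.card (Subgroup.centralizer {g}) : ℚ) * F g =
        Nat.card (Subgroup.centralizer {rep c}) * F (rep c) := by
    have hgc : ConjClasses.mk g = ConjClasses.mk (rep c) := by
      rw [hrep, (Finset.mem_filter.1 hg).2]
    rw [hF _ _ (ConjClasses.mk_eq_mk_iff_isConj.1 hgc)]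
    congr 2
    refine Nat.eq_of_mul_eq_mul_left (pos_of_ne_zero fun h0 => (Nat.card_pos (α := G)).ne' ?_)
      ((hcard g).trans (hgc ▸ hcard (rep c)).symm)
    rw [← hcard g, h0, zero_mul]
  rw [Finset.sum_congr rfl hconj, Finset.sum_const, nsmul_eq_mul, ← hcard (rep c), hrep]
  have hfib : (Finset.univ.filter fun g => ConjClasses.mk g = c).card = Nat.card c.carrier := by
    rw [← Nat.subtype_card _ fun g => (Finset.mem_filter_univ g).trans
      ConjClasses.mem_carrier_iff_mk_eq.symm]
  rw [hfib]
  push_cast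
  ring

/-- Splitting off the first coordinate of `ℤ ^ (r + 1)`. -/
def consMulEquiv (r : ℕ) : Multiplicative (Fin (r + 1) → ℤ) ≃*
    Multiplicative ℤ × Multiplicative (Fin r → ℤ) :=
  (Fin.consLinearEquiv ℤ fun _ => ℤ).symm.toAddEquiv.toMultiplicative.trans
    (MulEquiv.prodMultiplicative ℤ (Fin r → ℤ))

/-- The homomorphism `ℤ ^ (r + 1) → H` given by the image `g` of the first basis vector and a
homomorphism from `ℤ ^ r` to the centralizer of `g`. -/
def consHom {r : ℕ} {H : Subgroup Γ} (g : H)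
    (Y : Multiplicative (Fin r → ℤ) →* ↥(H ⊓ Subgroup.centralizer {(g : Γ)})) :
    Multiplicative (Fin (r + 1) → ℤ) →* H :=
  ((zpowersHom H g).noncommCoprod ((Subgroup.inclusion inf_le_left).comp Y) fun m v =>
    Commute.zpow_left (Subtype.ext (Subgroup.mem_centralizer_singleton_iff.1 (Y v).2.2).symm)
      m.toAdd).comp (consMulEquiv r).toMonoidHom

theorem consHom_symm_apply {r : ℕ} {H : Subgroup Γ} (g : H)
    (Y : Multiplicative (Fin r → ℤ) →* ↥(H ⊓ Subgroup.centralizer {(g : Γ)}))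
    (z : Multiplicative ℤ × Multiplicative (Fin r → ℤ)) :
    (consHom g Y ((consMulEquiv r).symm z) : Γ) = (g : Γ) ^ z.1.toAdd * (Y z.2 : Γ) := by
  simp only [consHom, MonoidHom.comp_apply, MulEquiv.toMonoidHom_eq_coe, MonoidHom.coe_coe,
    MulEquiv.apply_symm_apply]
  rfl

theorem consHom_bijective (r : ℕ) (H : Subgroup Γ) :
    Function.Bijective (fun z : Σ g : H,
      Multiplicative (Fin r → ℤ) →* ↥(H ⊓ Subgroup.centralizer {(g : Γ)}) => consHom z.1 z.2) := by
  constructor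
  · rintro ⟨g, Y⟩ ⟨g', Y'⟩ h
    have happ (z : Multiplicative ℤ × Multiplicative (Fin r → ℤ)) :
        (g : Γ) ^ z.1.toAdd * (Y z.2 : Γ) = (g' : Γ) ^ z.1.toAdd * (Y' z.2 : Γ) := by
      rw [← consHom_symm_apply, ← consHom_symm_apply]
      exact congrArg Subtype.val (DFunLike.congr_fun h _)
    obtain rfl : g = g' := Subtype.ext <| by
      simpa using happ (Multiplicative.ofAdd 1, 1)
    obtain rfl : Y = Y' := MonoidHom.ext fun v => Subtype.ext <| by
      simpa using happ (1, v)
    rfl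
  · intro X
    let f := X.comp (consMulEquiv r).symm.toMonoidHom
    let g : H := f (Multiplicative.ofAdd 1, 1)
    have hcomm (v : Multiplicative (Fin r → ℤ)) : (f (1, v) : Γ) * g = g * f (1, v) :=
      congrArg Subtype.val ((Commute.all (1, v) (Multiplicative.ofAdd (1 : ℤ), 1)).map f)
    let Y := ((H.subtype.comp f).comp (MonoidHom.inr _ _)).codRestrict
      (H ⊓ Subgroup.centralizer {(g : Γ)})
      fun v => ⟨(f (1, v)).2, Subgroup.mem_centralizer_singleton_iff.2 (hcomm v)⟩
    refine ⟨⟨g, Y⟩, MonoidHom.ext fun z => Subtype.ext ?_⟩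
    obtain ⟨⟨m, v⟩, rfl⟩ := (consMulEquiv r).symm.surjective z
    calc (consHom g Y ((consMulEquiv r).symm (m, v)) : Γ)
        = (g : Γ) ^ m.toAdd * (f (1, v) : Γ) := consHom_symm_apply g Y _
      _ = (f ((Multiplicative.ofAdd 1, 1) ^ m.toAdd * (1, v)) : Γ) := by
        rw [map_mul, map_zpow]; rfl
      _ = (f (m, v) : Γ) := by
        congr 3
        simp [← ofAdd_zsmul]

theorem fixedIn_range_consHom {r : ℕ} {H : Subgroup Γ} (g : H)
    (Y : Multiplicative (Fin r → ℤ) →* ↥(H ⊓ Subgroup.centralizer {(g : Γ)})) (P : Set Q) :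
    fixedIn (consHom g Y).range P = fixedIn Y.range {x | x ∈ P ∧ (g : Γ) • x = x} := by
  ext x
  constructor
  · rintro ⟨hx, hfix⟩
    have hz (z : Multiplicative ℤ × Multiplicative (Fin r → ℤ)) :
        ((g : Γ) ^ z.1.toAdd * (Y z.2 : Γ)) • x = x := by
      rw [← consHom_symm_apply]
      exact hfix _ ⟨_, rfl⟩
    refine ⟨⟨hx, by simpa using hz (Multiplicative.ofAdd 1, 1)⟩, ?_⟩
    rintro _ ⟨v, rfl⟩
    simpa using hz (1, v)
  · rintro ⟨⟨hx, hg⟩, hfix⟩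
    refine ⟨hx, ?_⟩
    rintro _ ⟨z, rfl⟩
    obtain ⟨z, rfl⟩ := (consMulEquiv r).symm.surjective z
    rw [consHom_symm_apply, mul_smul, hfix _ ⟨_, rfl⟩]
    exact Subgroup.zpow_mem (MulAction.stabilizer Γ x) hg _

theorem map_conj_inf_centralizer (H : Subgroup Γ) (g : Γ) {h : Γ} (hh : h ∈ H) :
    (H ⊓ Subgroup.centralizer {g}).map (MulAut.conj h).toMonoidHom =
      H ⊓ Subgroup.centralizer {h * g * h⁻¹} := by
  rw [Subgroup.map_inf _ _ _ (MulAut.conj h).injective]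
  congr 1
  · exact Subgroup.conj_smul_eq_self_of_mem hh
  · ext x
    rw [Subgroup.mem_map_equiv, Subgroup.mem_centralizer_singleton_iff,
      Subgroup.mem_centralizer_singleton_iff, ← (MulAut.conj h).injective.eq_iff]
    simp [mul_assoc]

theorem smul_fixed_eq {P : Set Q} (g : Γ) {h : Γ} (hP : h • P = P) :
    h • {x | x ∈ P ∧ g • x = x} = {x | x ∈ P ∧ (h * g * h⁻¹) • x = x} := by
  ext x
  rw [Set.mem_smul_set_iff_inv_smul_mem]
  refine and_congr (by rw [← Set.mem_smul_set_iff_inv_smul_mem, hP]) ?_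
  rw [mul_smul, mul_smul, smul_eq_iff_eq_inv_smul h]

variable [PartialOrder Q]

theorem eqEuler_succ (r : ℕ) (H : Subgroup Γ) [Finite H] (P : Set Q) :
    eqEuler (r + 1) H P = (1 / (Nat.card H : ℚ)) * ∑ᶠ g : H,
      (Nat.card ↥(H ⊓ Subgroup.centralizer {(g : Γ)}) : ℚ) *
        eqEuler r (H ⊓ Subgroup.centralizer {(g : Γ)}) {x | x ∈ P ∧ (g : Γ) • x = x} := by
  have (g : H) : Finite ↥(H ⊓ Subgroup.centralizer {(g : Γ)}) :=
    Finite.of_injective _ (Subgroup.inclusion_injective (inf_le_left : _ ≤ H))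
  have := Fintype.ofFinite H
  have (g : H) := Fintype.ofFinite
    (Multiplicative (Fin r → ℤ) →* ↥(H ⊓ Subgroup.centralizer {(g : Γ)}))
  rw [eqEuler_eq, ← finsum_eq_of_bijective _ (consHom_bijective r H) fun _ => rfl,
    finsum_eq_sum_of_fintype, finsum_eq_sum_of_fintype, Fintype.sum_sigma]
  congr 1
  refine Finset.sum_congr rfl fun g _ => ?_
  rw [eqEuler_eq, ← mul_assoc, mul_one_div_cancel (Nat.cast_ne_zero.2 Nat.card_pos.ne'), one_mul,
    finsum_eq_sum_of_fintype]
  exact Finset.sum_congr rfl fun Y _ => by rw [fixedIn_range_consHom]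

theorem eqEuler_conj [CovariantClass Γ Q HSMul.hSMul LE.le] (r : ℕ) (K : Subgroup Γ) (P : Set Q)
    (h : Γ) : eqEuler r (K.map (MulAut.conj h).toMonoidHom) (h • P) = eqEuler r K P := by
  let f : Q ↪o Q := OrderEmbedding.ofMapLEIff (h • ·) fun x y =>
    ⟨fun hxy => by simpa using smul_mono_right h⁻¹ hxy, fun hxy => smul_mono_right h hxy⟩
  refine (eqEuler_congr r (K.equivMapOfInjective _ (MulAut.conj h).injective) f rfl
    fun g x _ => ?_).symm
  change _ ↔ (h * g * h⁻¹) • h • x = h • x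
  rw [smul_smul, inv_mul_cancel_right, mul_smul, smul_left_cancel_iff]

theorem eqEuler_succ_eq_finsum_conjClasses [CovariantClass Γ Q HSMul.hSMul LE.le] (r : ℕ)
    (H : Subgroup Γ) [Finite H] (P : Set Q) (hP : ∀ h ∈ H, h • P = P)
    (rep : ConjClasses H → H) (hrep : ∀ c, ConjClasses.mk (rep c) = c) :
    eqEuler (r + 1) H P = ∑ᶠ c : ConjClasses H,
      eqEuler r (H ⊓ Subgroup.centralizer {(rep c : Γ)}) {x | x ∈ P ∧ (rep c : Γ) • x = x} := by
  have := Fintype.ofFinite H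
  have := Fintype.ofFinite (ConjClasses H)
  have hcard (g : H) : Nat.card ↥(H ⊓ Subgroup.centralizer {(g : Γ)}) =
      Nat.card (Subgroup.centralizer {g}) :=
    Nat.card_congr
      { toFun x := ⟨⟨x, x.2.1⟩, Subgroup.mem_centralizer_singleton_iff.2 <|
          Subtype.ext (Subgroup.mem_centralizer_singleton_iff.1 x.2.2)⟩
        invFun y := ⟨y, y.1.2, Subgroup.mem_centralizer_singleton_iff.2 <|
          congrArg Subtype.val (Subgroup.mem_centralizer_singleton_iff.1 y.2)⟩ }
  have hconj (g g' : H) (hgg' : IsConj g g') :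
      eqEuler r (H ⊓ Subgroup.centralizer {(g : Γ)}) {x | x ∈ P ∧ (g : Γ) • x = x} =
        eqEuler r (H ⊓ Subgroup.centralizer {(g' : Γ)}) {x | x ∈ P ∧ (g' : Γ) • x = x} := by
    obtain ⟨h, rfl⟩ := isConj_iff.1 hgg'
    rw [Subgroup.coe_mul, Subgroup.coe_mul, InvMemClass.coe_inv, ← smul_fixed_eq _ (hP h h.2),
      ← map_conj_inf_centralizer H g h.2, eqEuler_conj]
  rw [eqEuler_succ, finsum_eq_sum_of_fintype, finsum_eq_sum_of_fintype,
    ← one_div_card_mul_sum_card_centralizer_mul _ hconj rep hrep]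
  simp_rw [hcard]

end Recursion

section Vanishing

theorem redEuler_eq_zero_of_inf_of_sup {L : Type*} [Lattice L] [OrderBot L] [Finite L] {S : Set L}
    (hbot : ⊥ ∈ S) {w c : L} (hc : c ≠ ⊥) (hcw : c ≤ w) (hinf : ∀ x ∈ S, x ⊓ w ∈ S)
    (hinf_bot : ∀ x ∈ S, x ⊓ w = ⊥ → x = ⊥) (hsup : ∀ x ∈ S, x ≤ w → x ⊔ c ∈ S) :
    redEuler {x | x ∈ S ∧ x ≠ ⊥} = 0 := by
  let T := {x | x ∈ S ∧ x ≤ w}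
  let _ : OrderBot S := Subtype.orderBot hbot
  let _ : OrderBot T := Subtype.orderBot (⟨hbot, bot_le⟩ : (⊥ : L) ∈ T)
  have hST : redEuler {t : T | t ≠ ⊥} = redEuler {x : S | x ≠ ⊥} := by
    refine redEuler_ne_bot_eq_of_galoisConnection (l := fun t : T => (⟨t, t.2.1⟩ : S))
      (u := fun x : S => (⟨x ⊓ w, hinf x x.2, inf_le_right⟩ : T))
      (fun t x => ⟨fun h => le_inf h t.2.2, fun h => (le_inf_iff.1 h).1⟩) fun x => ?_
    refine ⟨fun h => Subtype.ext (hinf_bot x x.2 (congrArg Subtype.val h)), ?_⟩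
    rintro rfl
    exact Subtype.ext (bot_inf_eq w)
  have hT : redEuler {t : T | t ≠ ⊥} = 0 := by
    refine redEuler_ne_bot_eq_zero_of_galoisConnection
      (l := fun t : T =>
        (⟨t ⊔ c, ⟨hsup t t.2.1 t.2.2, sup_le t.2.2 hcw⟩, le_sup_right⟩ : {x | x ∈ T ∧ c ≤ x}))
      (u := fun y => (⟨y, y.2.1⟩ : T))
      (fun t y => ⟨fun h => (sup_le_iff.1 h).1, fun h => sup_le h y.2.2⟩) fun y h => ?_
    exact hc (le_bot_iff.1 (y.2.2.trans (congrArg Subtype.val h).le))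
  rw [← hT, hST, ← redEuler_image (OrderEmbedding.subtype (· ∈ S))]
  congr 1
  ext x
  exact ⟨fun h => ⟨⟨x, h.1⟩, fun h0 => h.2 (congrArg Subtype.val h0), rfl⟩, by
    rintro ⟨y, hy, rfl⟩
    exact ⟨y.2, fun h0 => hy (Subtype.ext h0)⟩⟩

end Vanishing

section Isotropic

variable {K V : Type*} [Field K] [AddCommGroup V] [Module K V]

instance finite_linearEquiv [Finite V] : Finite (V ≃ₗ[K] V) :=
  Finite.of_injective (fun φ => (φ : V → V)) DFunLike.coe_injective

instance finite_submodule [Finite V] : Finite (Submodule K V) :=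
  Finite.of_injective _ SetLike.coe_injective

theorem smul_eq_self_iff [FiniteDimensional K V] {φ : V ≃ₗ[K] V} {U : Submodule K V} :
    φ • U = U ↔ ∀ x ∈ U, φ x ∈ U :=
  ⟨fun h _ hx => h ▸ Submodule.mem_map_of_mem hx, fun h => Submodule.eq_of_le_of_finrank_eq
    (Submodule.map_le_iff_le_comap.2 h) (LinearEquiv.finrank_map_eq φ U)⟩

variable {σ : K →+* K}

/-- The group of the linear automorphisms that preserve the form `B`. -/
def isometryGroup (B : V →ₗ[K] V →ₛₗ[σ] K) : Subgroup (V ≃ₗ[K] V) where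
  carrier := {g | ∀ u v, B (g u) (g v) = B u v}
  mul_mem' {g h} hg hh u v := by
    rw [LinearEquiv.mul_apply, LinearEquiv.mul_apply, hg, hh]
  one_mem' _ _ := rfl
  inv_mem' {g} hg u v := by
    rw [← hg]
    exact congrArg₂ (fun x y => B x y) (g.apply_symm_apply u) (g.apply_symm_apply v)

/-- A subspace is totally isotropic if the form vanishes on it identically. -/
def IsIsotropic (B : V →ₗ[K] V →ₛₗ[σ] K) (U : Submodule K V) : Prop :=
  ∀ u ∈ U, ∀ v ∈ U, B u v = 0

/-- The poset of the nonzero totally isotropic subspaces. -/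
def isotropicSubspaces (B : V →ₗ[K] V →ₛₗ[σ] K) : Set (Submodule K V) :=
  {U | U ≠ ⊥ ∧ IsIsotropic B U}

variable {B : V →ₗ[K] V →ₛₗ[σ] K}

theorem isIsotropic_bot : IsIsotropic B ⊥ := fun u hu v _ => by
  rw [(Submodule.mem_bot K).1 hu, map_zero, LinearMap.zero_apply]

theorem IsIsotropic.mono {U U' : Submodule K V} (hU' : IsIsotropic B U') (h : U ≤ U') :
    IsIsotropic B U :=
  fun u hu v hv => hU' u (h hu) v (h hv)

theorem IsIsotropic.sup (hB : B.IsRefl) {U U' : Submodule K V} (hU : IsIsotropic B U)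
    (hU' : IsIsotropic B U') (h : ∀ u ∈ U, ∀ v ∈ U', B u v = 0) : IsIsotropic B (U ⊔ U') := by
  intro x hx y hy
  obtain ⟨a, ha, b, hb, rfl⟩ := Submodule.mem_sup.1 hx
  obtain ⟨a', ha', b', hb', rfl⟩ := Submodule.mem_sup.1 hy
  simp only [map_add, LinearMap.add_apply, hU a ha a' ha', h a ha b' hb', hB _ _ (h a' ha' b hb),
    hU' b hb b' hb', add_zero]

theorem IsIsotropic.smul {g : V ≃ₗ[K] V} (hg : g ∈ isometryGroup B) {U : Submodule K V}
    (hU : IsIsotropic B U) : IsIsotropic B (g • U) := by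
  rintro _ ⟨x, hx, rfl⟩ _ ⟨y, hy, rfl⟩
  exact (hg x y).trans (hU x hx y hy)

theorem smul_isotropicSubspaces {g : V ≃ₗ[K] V} (hg : g ∈ isometryGroup B) :
    g • isotropicSubspaces B = isotropicSubspaces B := by
  ext U
  rw [Set.mem_smul_set_iff_inv_smul_mem]
  refine and_congr (not_congr (by rw [inv_smul_eq_iff, Submodule.smul_bot'])) ⟨fun h => ?_, fun h =>
    h.smul (inv_mem hg)⟩
  simpa using h.smul hg

section Unipotent

theorem eq_bot_of_inf_ker_eq_bot {N : Module.End K V} (hN : IsNilpotent N) {U : Submodule K V}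
    (hU : ∀ x ∈ U, N x ∈ U) (h : U ⊓ LinearMap.ker N = ⊥) : U = ⊥ := by
  obtain ⟨m, hm⟩ := hN
  have hpow (j : ℕ) : ∀ x ∈ U, (N ^ j) x = 0 → x = 0 := by
    induction j with
    | zero => exact fun x _ hx => hx
    | succ j ih =>
      intro x hx h0
      rw [pow_succ, Module.End.mul_apply] at h0
      exact (Submodule.mem_bot K).1 (h.le ⟨hx, ih _ (hU x hx) h0⟩)
  exact eq_bot_iff.2 fun x hx => hpow m x hx (by rw [hm, LinearMap.zero_apply])

theorem apply_eq_zero_of_mem_ker_of_mem_range {u : V ≃ₗ[K] V} (hu : u ∈ isometryGroup B) {x y : V}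
    (hx : x ∈ LinearMap.ker (u.toLinearMap - 1)) (hy : y ∈ LinearMap.range (u.toLinearMap - 1)) :
    B x y = 0 := by
  obtain ⟨z, rfl⟩ := hy
  have hux : u x = x := sub_eq_zero.1 hx
  calc B x ((u.toLinearMap - 1) z) = B x (u z) - B x z := map_sub _ _ _
    _ = B (u x) (u z) - B x z := by rw [hux]
    _ = 0 := by rw [hu, sub_self]

/-- With `N = u - 1`, the space `ker N ⊓ range N` is a nonzero invariant subspace that is
orthogonal to `ker N`, and the invariant isotropic subspaces `U` contract along
`U ≥ U ⊓ ker N ≤ U ⊓ ker N ⊔ (ker N ⊓ range N)`. -/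
theorem redEuler_isotropic_eq_zero_of_unipotent [Finite V] (hB : B.IsRefl) {u : V ≃ₗ[K] V}
    (hu : u ∈ isometryGroup B) (hu1 : u ≠ 1) (hnil : IsNilpotent (u.toLinearMap - 1))
    {Φ : Set (V ≃ₗ[K] V)} (huΦ : u ∈ Subgroup.closure Φ) (hΦ : ∀ φ ∈ Φ, Commute φ u) :
    redEuler {U | U ∈ {U | IsIsotropic B U ∧ ∀ φ ∈ Φ, φ • U = U} ∧ U ≠ ⊥} = 0 := by
  set N : Module.End K V := u.toLinearMap - 1 with hN
  have hcomm {φ : V ≃ₗ[K] V} (hφ : φ ∈ Φ) (x : V) : N (φ x) = φ (N x) := by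
    rw [hN, LinearMap.sub_apply, LinearMap.sub_apply, map_sub]
    exact congrArg (· - φ x) (DFunLike.congr_fun (hΦ φ hφ) x).symm
  have hkerΦ {φ : V ≃ₗ[K] V} (hφ : φ ∈ Φ) {x : V} (hx : x ∈ LinearMap.ker N) :
      φ x ∈ LinearMap.ker N := by
    rw [LinearMap.mem_ker, hcomm hφ, LinearMap.mem_ker.1 hx, map_zero]
  have hfix (φ : V ≃ₗ[K] V) (hφ : φ ∈ Φ) :
      φ • (LinearMap.ker N ⊓ LinearMap.range N) = LinearMap.ker N ⊓ LinearMap.range N := by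
    refine smul_eq_self_iff.2 ?_
    rintro _ ⟨hx, y, rfl⟩
    exact ⟨hkerΦ hφ hx, φ y, hcomm hφ y⟩
  have horth (x : V) (hx : x ∈ LinearMap.ker N) (y : V)
      (hy : y ∈ LinearMap.ker N ⊓ LinearMap.range N) : B x y = 0 :=
    apply_eq_zero_of_mem_ker_of_mem_range hu hx hy.2
  refine redEuler_eq_zero_of_inf_of_sup (w := LinearMap.ker N)
    (c := LinearMap.ker N ⊓ LinearMap.range N)
    ⟨isIsotropic_bot, fun φ _ => Submodule.smul_bot' φ⟩ ?_ inf_le_left ?_ ?_ ?_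
  · intro h0
    refine hu1 (LinearEquiv.ext fun x => sub_eq_zero.1 ((Submodule.mem_bot K).1 ?_))
    rw [← eq_bot_of_inf_ker_eq_bot hnil (fun x _ => LinearMap.mem_range_self N x)
      (inf_comm (LinearMap.ker N) _ ▸ h0)]
    exact LinearMap.mem_range_self N x
  · rintro U ⟨hU, hUΦ⟩
    exact ⟨hU.mono inf_le_left, fun φ hφ => smul_eq_self_iff.2 fun x hx =>
      ⟨smul_eq_self_iff.1 (hUΦ φ hφ) x hx.1, hkerΦ hφ hx.2⟩⟩
  · rintro U ⟨-, hUΦ⟩ h0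
    have huU : u • U = U := (Subgroup.closure_le (MulAction.stabilizer _ U)).2 hUΦ huΦ
    exact eq_bot_of_inf_ker_eq_bot hnil
      (fun x hx => U.sub_mem (smul_eq_self_iff.1 huU x hx) hx) h0
  · rintro U ⟨hU, hUΦ⟩ hUN
    refine ⟨hU.sup hB (fun x hx => horth x hx.1) fun x hx => horth x (hUN hx), fun φ hφ => ?_⟩
    rw [Submodule.smul_sup', hUΦ φ hφ, hfix φ hφ]

theorem isNilpotent_sub_one_of_pow_eq_one (p : ℕ) [Fact p.Prime] [CharP K p] {u : V ≃ₗ[K] V}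
    (hu : u ^ p = 1) : IsNilpotent (u.toLinearMap - 1 : Module.End K V) := by
  refine ⟨p, ?_⟩
  have hup : (u.toLinearMap : Module.End K V) ^ p = 1 := by
    rw [← map_one (LinearEquiv.automorphismGroup.toLinearMapMonoidHom (R := K) (M := V)), ← hu,
      map_pow]
    rfl
  simpa [hup] using congrArg (aeval (u.toLinearMap : Module.End K V))
    (sub_pow_char (p := p) (X : K[X]) 1)

theorem eqEuler_centralizer_eq_zero [Finite V] (hB : B.IsRefl) {p : ℕ} [Fact p.Prime] [CharP K p]
    (r : ℕ) {g : V ≃ₗ[K] V} (hg : g ∈ isometryGroup B) (hpg : p ∣ orderOf g) :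
    eqEuler r (isometryGroup B ⊓ Subgroup.centralizer {g})
      {U | U ∈ isotropicSubspaces B ∧ g • U = U} = 0 := by
  set u := g ^ (orderOf g / p) with hu
  have hup : orderOf u = p := orderOf_pow_orderOf_div (orderOf_pos g).ne' hpg
  have hu1 : u ≠ 1 := fun h => (Fact.out : p.Prime).one_lt.ne (by rw [← hup, h, orderOf_one])
  rw [eqEuler_eq, finsum_eq_zero_of_forall_eq_zero, mul_zero]
  intro X
  let Φ : Set (V ≃ₗ[K] V) := insert g
    (Subtype.val '' (X.range : Set ↥(isometryGroup B ⊓ Subgroup.centralizer {g})))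
  have huΦ : u ∈ Subgroup.closure Φ :=
    Subgroup.pow_mem _ (Subgroup.subset_closure (Set.mem_insert _ _)) _
  have hΦ : ∀ φ ∈ Φ, Commute φ u := by
    rintro _ (rfl | ⟨φ, -, rfl⟩)
    · exact Commute.self_pow _ _
    · exact Commute.pow_right (Subgroup.mem_centralizer_singleton_iff.1 φ.2.2) _
  rw [Int.cast_eq_zero, ← redEuler_isotropic_eq_zero_of_unipotent hB (pow_mem hg _) hu1
    (isNilpotent_sub_one_of_pow_eq_one p (orderOf_dvd_iff_pow_eq_one.1 hup.dvd)) huΦ hΦ]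
  congr 1
  ext U
  constructor
  · rintro ⟨⟨⟨hne, hU⟩, hgU⟩, hX⟩
    refine ⟨⟨hU, ?_⟩, hne⟩
    rintro _ (rfl | ⟨φ, hφ, rfl⟩)
    · exact hgU
    · exact hX φ hφ
  · rintro ⟨⟨hU, hΦU⟩, hne⟩
    exact ⟨⟨⟨hne, hU⟩, hΦU _ (Set.mem_insert _ _)⟩,
      fun φ hφ => hΦU _ (Set.mem_insert_of_mem _ ⟨φ, hφ, rfl⟩)⟩

theorem eqEuler_isotropicSubspaces_succ [Finite V] (hB : B.IsRefl) {p k : ℕ} [Fact p.Prime]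
    [CharP K p] (hk : k ≠ 0) (r : ℕ) (rep : ConjClasses (isometryGroup B) → isometryGroup B)
    (hrep : ∀ c, ConjClasses.mk (rep c) = c) :
    eqEuler (r + 1) (isometryGroup B) (isotropicSubspaces B) =
      ∑ᶠ (c : ConjClasses (isometryGroup B)) (_ : Nat.Coprime (p ^ k) (orderOf (rep c))),
        eqEuler r (isometryGroup B ⊓ Subgroup.centralizer {(rep c : V ≃ₗ[K] V)})
          {U | U ∈ isotropicSubspaces B ∧ (rep c : V ≃ₗ[K] V) • U = U} := by
  rw [eqEuler_succ_eq_finsum_conjClasses r _ _ (fun h => smul_isotropicSubspaces) rep hrep]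
  refine finsum_congr fun c => ?_
  by_cases hc : Nat.Coprime (p ^ k) (orderOf (rep c))
  · rw [finsum_eq_if, if_pos hc]
  · rw [finsum_eq_if, if_neg hc]
    rw [Nat.coprime_pow_left_iff (Nat.pos_of_ne_zero hk),
      (Fact.out : p.Prime).coprime_iff_not_dvd, not_not, ← Subgroup.orderOf_coe] at hc
    exact eqEuler_centralizer_eq_zero hB r (rep c).2 hc

end Unipotent

end Isotropic

section Hermitian

variable {K V : Type*} [Field K] [AddCommGroup V] [Module K V] {σ : K →+* K}

/-- The sesquilinear form `B` is Hermitian with respect to the field endomorphism `σ`. -/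
def IsHermitian (B : V →ₗ[K] V →ₛₗ[σ] K) : Prop :=
  ∀ u v, σ (B u v) = B v u

variable {B : V →ₗ[K] V →ₛₗ[σ] K}

theorem IsHermitian.isRefl (hB : IsHermitian B) : B.IsRefl := fun u v h => by
  rw [← hB, h, map_zero]

theorem IsHermitian.domRestrict₁₂ (hB : IsHermitian B) (W : Submodule K V) :
    IsHermitian (B.domRestrict₁₂ W W) :=
  fun u v => hB u v

end Hermitian

section Standard

variable (K : Type*) [Field K] (p k : ℕ) [Fact p.Prime] [CharP K p] (n : ℕ)

/-- The Hermitian form `hermForm` as a sesquilinear map. -/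
def hermSesq : (Fin n → K) →ₗ[K] (Fin n → K) →ₛₗ[iterateFrobenius K p k] K :=
  LinearMap.mk₂'ₛₗ _ _ (hermForm K (p ^ k) n)
    (fun u u' v => by
      simp only [hermForm, Pi.add_apply, mul_add, add_mul, Finset.sum_add_distrib])
    (fun c u v => by
      simp only [hermForm, Pi.smul_apply, smul_eq_mul, RingHom.id_apply, Finset.mul_sum]
      exact Finset.sum_congr rfl fun i _ => by ring)
    (fun u v v' => by
      simp only [hermForm, Pi.add_apply, add_pow_char_pow, mul_add, Finset.sum_add_distrib])
    (fun c u v => by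
      simp only [hermForm, Pi.smul_apply, smul_eq_mul, iterateFrobenius_def, Finset.mul_sum,
        mul_pow]
      exact Finset.sum_congr rfl fun i _ => by ring)

variable {K p k}

theorem iterateFrobenius_involutive [Finite K] (hK : Nat.card K = (p ^ k) ^ 2) :
    Function.Involutive (iterateFrobenius K p k) := fun x => by
  have := Fintype.ofFinite K
  rw [iterateFrobenius_def, iterateFrobenius_def, ← pow_mul, ← pow_two, ← hK,
    Nat.card_eq_fintype_card, FiniteField.pow_card]

theorem iterateFrobenius_hermConst [Finite K] (hk : 0 < k) (hK : Nat.card K = (p ^ k) ^ 2) :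
    iterateFrobenius K p k (hermConst K (p ^ k) n) = (-1) ^ (n + 1) * hermConst K (p ^ k) n := by
  rw [iterateFrobenius_def, ← (hermConst_spec K (p ^ k) n Fact.out hk rfl hK).2, ← pow_succ,
    Nat.sub_add_cancel (Nat.one_le_pow _ _ (Fact.out : p.Prime).pos)]

theorem neg_one_pow_rev {n : ℕ} (i : Fin n) :
    (-1 : K) ^ (i.rev : ℕ) = (-1) ^ (n + 1) * (-1) ^ (i : ℕ) := by
  rw [← pow_add, Fin.val_rev, neg_one_pow_congr]
  grind

theorem isHermitian_hermSesq [Finite K] (hk : 0 < k) (hK : Nat.card K = (p ^ k) ^ 2) :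
    IsHermitian (hermSesq K p k n) := fun u v => by
  change iterateFrobenius K p k (hermConst K (p ^ k) n * ∑ i, _) = hermConst K (p ^ k) n * ∑ i, _
  simp only [map_mul, map_sum, map_pow, map_neg, map_one, ← iterateFrobenius_def,
    iterateFrobenius_involutive hK _, iterateFrobenius_hermConst n hk hK]
  rw [← Equiv.sum_comp Fin.revPerm, mul_comm (_ ^ _), mul_assoc, Finset.mul_sum]
  congr 1
  refine Finset.sum_congr rfl fun i _ => ?_
  rw [Fin.revPerm_apply, Fin.rev_rev, neg_one_pow_rev]
  linear_combination (-1) ^ (i : ℕ) * v i * iterateFrobenius K p k (u i.rev) *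
    (Even.neg_one_pow ⟨n + 1, rfl⟩ : (-1 : K) ^ (n + 1 + (n + 1)) = 1)

theorem separatingLeft_hermSesq [Finite K] (hk : 0 < k) (hK : Nat.card K = (p ^ k) ^ 2) :
    (hermSesq K p k n).SeparatingLeft := fun u hu => by
  have hc := (hermConst_spec K (p ^ k) n Fact.out hk rfl hK).1
  funext i
  have hi : hermForm K (p ^ k) n u (Pi.single i.rev 1) = 0 := hu _
  rw [hermForm, Finset.sum_eq_single_of_mem i (Finset.mem_univ i)] at hi
  · simpa [hc] using hi
  · intro j _ hj
    rw [Pi.single_eq_of_ne fun h => hj (Fin.rev_injective h),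
      zero_pow (pow_pos (Fact.out : p.Prime).pos k).ne', mul_zero]

end Standard

section Classification

variable {F : Type*} [Field F]

section

variable {V : Type*} [AddCommGroup V] [Module F V] {σ : F →+* F} {B : V →ₗ[F] V →ₛₗ[σ] F}

theorem IsHermitian.exists_self_ne_zero (hB : IsHermitian B) (hnd : B.SeparatingLeft)
    (hσ : ∃ t, t + σ t ≠ 0) [Nontrivial V] : ∃ v, B v v ≠ 0 := by
  by_contra! hall
  obtain ⟨t, ht⟩ := hσ
  obtain ⟨u, hu⟩ := exists_ne (0 : V)
  obtain ⟨v, hv⟩ : ∃ v, B u v ≠ 0 := by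
    by_contra! h0
    exact hu (hnd u h0)
  have ht0 := hall ((t / B u v) • u + v)
  rw [map_add, map_add, LinearMap.add_apply, LinearMap.add_apply, hall, hall, zero_add, add_zero,
    ← hB ((t / B u v) • u) v, map_smul, LinearMap.smul_apply, smul_eq_mul, div_mul_cancel₀ _ hv,
    add_comm] at ht0
  exact ht ht0

theorem separatingLeft_domRestrict_ker_flip (hnd : B.SeparatingLeft) {v : V} (hv : B v v = 1) :
    (B.domRestrict₁₂ (LinearMap.ker (B.flip v)) (LinearMap.ker (B.flip v))).SeparatingLeft := by
  rintro ⟨w, hw⟩ hwx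
  refine Subtype.ext (hnd w fun x => ?_)
  have hx : x - B x v • v ∈ LinearMap.ker (B.flip v) := by
    rw [LinearMap.mem_ker, LinearMap.flip_apply, map_sub, map_smul, LinearMap.sub_apply,
      LinearMap.smul_apply, hv, smul_eq_mul, mul_one, sub_self]
  have hwv : B w v = 0 := hw
  have h : B w (x - B x v • v) = 0 := hwx ⟨_, hx⟩
  rwa [map_sub, map_smulₛₗ, hwv, smul_zero, sub_zero] at h

theorem finrank_ker_flip_add_one [FiniteDimensional F V] {v : V} (hv : B v v = 1) :
    Module.finrank F (LinearMap.ker (B.flip v)) + 1 = Module.finrank F V := by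
  have hrange : LinearMap.range (B.flip v) = ⊤ := LinearMap.range_eq_top.2 fun c =>
    ⟨c • v, by rw [LinearMap.flip_apply, map_smul, LinearMap.smul_apply, hv, smul_eq_mul, mul_one]⟩
  rw [← LinearMap.finrank_range_add_finrank_ker (B.flip v), hrange, finrank_top,
    Module.finrank_self, add_comm]

end

variable [Finite F] {q : ℕ}

theorem exists_add_pow_ne_zero (hq : 1 < q) (hF : Nat.card F = q ^ 2) : ∃ t : F, t + t ^ q ≠ 0 := by
  have := Fintype.ofFinite F
  by_contra! hall
  have hdeg : (X ^ q + X : F[X]).natDegree = q := by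
    rw [natDegree_add_eq_left_of_natDegree_lt] <;> simp [hq]
  have hne : (X ^ q + X : F[X]) ≠ 0 := fun h => by
    rw [h, natDegree_zero] at hdeg
    omega
  have hcard : Fintype.card F ≤ (X ^ q + X : F[X]).natDegree :=
    card_le_degree_of_subset_roots (Z := Finset.univ) fun x _ => by
      rw [mem_roots hne]
      simp [add_comm _ x, hall x]
  rw [hdeg, ← Nat.card_eq_fintype_card, hF] at hcard
  nlinarith

theorem exists_pow_succ_eq (hq : 1 < q) (hF : Nat.card F = q ^ 2) {a : F} (ha : a ≠ 0)
    (haq : a ^ q = a) : ∃ c : F, c ^ (q + 1) = a := by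
  obtain ⟨ζ, hζ⟩ := IsCyclic.exists_generator (α := Fˣ)
  obtain ⟨m, hm : ζ ^ m = Units.mk0 a ha⟩ := mem_powers_iff_mem_zpowers.2 (hζ (Units.mk0 a ha))
  have hord : orderOf ζ = (q - 1) * (q + 1) := by
    rw [orderOf_eq_card_of_forall_mem_zpowers hζ, Nat.card_units, hF, mul_comm, ← one_pow 2,
      Nat.sq_sub_sq, one_pow]
  have hdvd : (q - 1) * (q + 1) ∣ (q - 1) * m := by
    rw [← hord, orderOf_dvd_iff_pow_eq_one, mul_comm, pow_mul, hm, Units.ext_iff]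
    refine mul_right_cancel₀ ha ?_
    rw [Units.val_pow_eq_pow_val, Units.val_mk0, ← pow_succ, Nat.sub_add_cancel hq.le, haq,
      Units.val_one, one_mul]
  obtain ⟨s, rfl⟩ := Nat.dvd_of_mul_dvd_mul_left (by omega) hdvd
  exact ⟨(ζ : F) ^ s, by rw [← pow_mul, mul_comm, ← Units.val_pow_eq_pow_val, hm, Units.val_mk0]⟩

variable {V : Type*} [AddCommGroup V] [Module F V] {σ : F →+* F} {B : V →ₗ[F] V →ₛₗ[σ] F}

theorem IsHermitian.exists_self_eq_one (hB : IsHermitian B) (hnd : B.SeparatingLeft) (hq : 1 < q)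
    (hF : Nat.card F = q ^ 2) (hσ : ∀ x, σ x = x ^ q) [Nontrivial V] : ∃ v, B v v = 1 := by
  obtain ⟨v, hv⟩ := hB.exists_self_ne_zero hnd
    (by simpa only [hσ] using exists_add_pow_ne_zero hq hF)
  obtain ⟨c, hc⟩ := exists_pow_succ_eq hq hF (inv_ne_zero hv) (by rw [inv_pow, ← hσ, hB])
  refine ⟨c • v, ?_⟩
  rw [LinearMap.map_smulₛₗ, map_smul, LinearMap.smul_apply, hσ, smul_eq_mul, smul_eq_mul,
    ← mul_assoc, ← pow_succ, hc, inv_mul_cancel₀ hv]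

theorem IsHermitian.exists_orthonormal [FiniteDimensional F V] (hB : IsHermitian B)
    (hnd : B.SeparatingLeft) (hq : 1 < q) (hF : Nat.card F = q ^ 2) (hσ : ∀ x, σ x = x ^ q) :
    ∃ e : Fin (Module.finrank F V) → V, ∀ i j, B (e i) (e j) = if i = j then 1 else 0 := by
  generalize hn : Module.finrank F V = n
  induction n generalizing V with
  | zero => exact ⟨Fin.elim0, fun i => i.elim0⟩
  | succ n ih =>
    have : Nontrivial V := Module.nontrivial_of_finrank_pos (R := F) (by omega)
    obtain ⟨v, hv⟩ := hB.exists_self_eq_one hnd hq hF hσ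
    obtain ⟨e, he⟩ := ih (hB.domRestrict₁₂ _) (separatingLeft_domRestrict_ker_flip hnd hv)
      (by have := finrank_ker_flip_add_one hv; omega)
    have hev : ∀ i, B (e i) v = 0 := fun i => (e i).2
    refine ⟨Fin.cons v fun i => (e i : V), Fin.cases (Fin.cases ?_ fun j => ?_) fun i =>
      Fin.cases ?_ fun j => ?_⟩
    · simpa using hv
    · simpa [(Fin.succ_ne_zero j).symm] using hB.isRefl _ _ (hev j)
    · simpa using hev i
    · simpa using! he i j

theorem IsHermitian.exists_orthonormal_basis [FiniteDimensional F V] (hB : IsHermitian B)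
    (hnd : B.SeparatingLeft) (hq : 1 < q) (hF : Nat.card F = q ^ 2) (hσ : ∀ x, σ x = x ^ q) :
    ∃ b : Module.Basis (Fin (Module.finrank F V)) F V,
      ∀ i j, B (b i) (b j) = if i = j then 1 else 0 := by
  obtain ⟨e, he⟩ := hB.exists_orthonormal hnd hq hF hσ
  have hli : LinearIndependent F e := LinearMap.linearIndependent_of_isOrthoᵢ (B := B)
    (fun i j hij => (he i j).trans (if_neg hij))
    (fun i => by rw [he, if_pos rfl]; exact one_ne_zero)
  exact ⟨basisOfLinearIndependentOfCardEqFinrank' e hli (by simp), fun i j => by simp [he]⟩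

theorem IsHermitian.exists_isometry {V' : Type*} [AddCommGroup V'] [Module F V']
    {B' : V' →ₗ[F] V' →ₛₗ[σ] F} [FiniteDimensional F V] [FiniteDimensional F V']
    (hB : IsHermitian B) (hnd : B.SeparatingLeft) (hB' : IsHermitian B')
    (hnd' : B'.SeparatingLeft) (hq : 1 < q) (hF : Nat.card F = q ^ 2) (hσ : ∀ x, σ x = x ^ q)
    (hdim : Module.finrank F V = Module.finrank F V') :
    ∃ T : V ≃ₗ[F] V', ∀ u v, B' (T u) (T v) = B u v := by
  obtain ⟨b, hb⟩ := hB.exists_orthonormal_basis hnd hq hF hσ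
  obtain ⟨b', hb'⟩ := hB'.exists_orthonormal_basis hnd' hq hF hσ
  refine ⟨b.equiv b' (finCongr hdim), fun u v => ?_⟩
  rw [← b.sum_repr u, ← b.sum_repr v]
  simp only [map_sum, map_smul, LinearMap.map_smulₛₗ, LinearMap.sum_apply, LinearMap.smul_apply,
    Module.Basis.equiv_apply, hb, hb', EmbeddingLike.apply_eq_iff_eq]

end Classification

section Transport

variable {K V V' : Type*} [Field K] [AddCommGroup V] [Module K V] [AddCommGroup V'] [Module K V']

theorem eqEuler_congr_linearEquiv (r : ℕ) (T : V ≃ₗ[K] V') {H : Subgroup (V ≃ₗ[K] V)}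
    {P : Set (Submodule K V)} {H' : Subgroup (V' ≃ₗ[K] V')} {P' : Set (Submodule K V')}
    (hH : ∀ φ, φ ∈ H ↔ T.symm ≪≫ₗ φ ≪≫ₗ T ∈ H')
    (hP : ∀ U, U ∈ P ↔ U.map (T : V →ₗ[K] V') ∈ P') : eqEuler r H P = eqEuler r H' P' := by
  let c : (V ≃ₗ[K] V) ≃* (V' ≃ₗ[K] V') :=
    { toFun := fun φ => T.symm ≪≫ₗ φ ≪≫ₗ T
      invFun := fun ψ => T ≪≫ₗ ψ ≪≫ₗ T.symm
      left_inv := fun φ => by ext; simp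
      right_inv := fun ψ => by ext; simp
      map_mul' := fun φ ψ => by ext; simp }
  have hmap : H.map c.toMonoidHom = H' := by
    ext ψ
    rw [Subgroup.mem_map_equiv, hH]
    exact iff_of_eq (congrArg (· ∈ H') (c.apply_symm_apply ψ))
  refine eqEuler_congr r ((c.subgroupMap H).trans (MulEquiv.subgroupCongr hmap))
    (Submodule.orderIsoMapComap T).toOrderEmbedding ?_ fun φ U _ => ?_
  · ext U'
    constructor
    · rintro ⟨U, hU, rfl⟩
      exact (hP U).1 hU
    · intro hU'
      obtain ⟨U, rfl⟩ := (Submodule.orderIsoMapComap T).surjective U'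
      exact ⟨U, (hP U).2 hU', rfl⟩
  · have hc : (c φ : V' →ₗ[K] V') ∘ₗ (T : V →ₗ[K] V') =
        (T : V →ₗ[K] V') ∘ₗ ((φ : V ≃ₗ[K] V) : V →ₗ[K] V) := by
      ext v
      simp [c]
    change U.map ((φ : V ≃ₗ[K] V) : V →ₗ[K] V) = U ↔
      (U.map (T : V →ₗ[K] V')).map (c φ : V' →ₗ[K] V') = U.map (T : V →ₗ[K] V')
    rw [← Submodule.map_comp, hc, Submodule.map_comp,
      (Submodule.map_injective_of_injective T.injective).eq_iff]

theorem map_aeval_apply (f : V →ₗ[K] V') {g : Module.End K V} {g' : Module.End K V'}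
    (h : ∀ v, f (g v) = g' (f v)) (P : K[X]) (v : V) : f (aeval g P v) = aeval g' P (f v) := by
  induction P using Polynomial.induction_on generalizing v with
  | C a => simp only [aeval_C, Module.algebraMap_end_apply, map_smul]
  | add P Q hP hQ => simp only [map_add, LinearMap.add_apply, hP, hQ]
  | monomial n a ih =>
    simp only [pow_succ, ← mul_assoc, map_mul _ _ X, aeval_X, Module.End.mul_apply, ih, h]

theorem mapsTo_ker_aeval (g : Module.End K V) (P : K[X]) :
    ∀ x ∈ LinearMap.ker (aeval g P), g x ∈ LinearMap.ker (aeval g P) := fun x hx => by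
  rw [LinearMap.mem_ker] at hx ⊢
  rw [← map_aeval_apply g (fun _ => rfl), hx, map_zero]

end Transport

section Isometries

variable {K V V' : Type*} [Field K] [AddCommGroup V] [Module K V] [AddCommGroup V'] [Module K V']
  {σ : K →+* K}

/-- The group of the automorphisms of `V` that commute with the endomorphism `g`. -/
def commutingEquivs (g : Module.End K V) : Subgroup (V ≃ₗ[K] V) where
  carrier := {φ | ∀ v, φ (g v) = g (φ v)}
  mul_mem' {φ ψ} hφ hψ v := by rw [LinearEquiv.mul_apply, LinearEquiv.mul_apply, hψ, hφ]
  one_mem' _ := rfl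
  inv_mem' {φ} hφ v := by
    apply φ.injective
    rw [hφ]
    exact (φ.apply_symm_apply (g v)).trans (congrArg g (φ.apply_symm_apply v).symm)

/-- The group of the isometries of `B` that commute with the endomorphism `g`. -/
def commutingIsometries (B : V →ₗ[K] V →ₛₗ[σ] K) (g : Module.End K V) :
    Subgroup (V ≃ₗ[K] V) :=
  isometryGroup B ⊓ commutingEquivs g

/-- The totally isotropic subspaces, including `⊥`, that the endomorphism `g` maps into
themselves. -/
def invariantIsotropic (B : V →ₗ[K] V →ₛₗ[σ] K) (g : Module.End K V) : Set (Submodule K V) :=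
  {U | IsIsotropic B U ∧ ∀ x ∈ U, g x ∈ U}

theorem bot_mem_invariantIsotropic (B : V →ₗ[K] V →ₛₗ[σ] K) (g : Module.End K V) :
    ⊥ ∈ invariantIsotropic B g :=
  ⟨isIsotropic_bot, fun x hx => by
    rw [Submodule.mem_bot] at hx ⊢
    rw [hx, map_zero]⟩

/-- The equivariant reduced Euler characteristic, with the sign changed, of the isometries that
commute with `g` acting on the nonzero `g`-invariant totally isotropic subspaces. -/
def isoEuler (r : ℕ) (B : V →ₗ[K] V →ₛₗ[σ] K) (g : Module.End K V) : ℚ :=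
  -eqEuler r (commutingIsometries B g) {U | U ∈ invariantIsotropic B g ∧ U ≠ ⊥}

theorem isoEuler_congr (r : ℕ) {B : V →ₗ[K] V →ₛₗ[σ] K} {B' : V' →ₗ[K] V' →ₛₗ[σ] K}
    {g : Module.End K V} {g' : Module.End K V'} (T : V ≃ₗ[K] V')
    (hT : ∀ u v, B' (T u) (T v) = B u v) (hg : ∀ v, T (g v) = g' (T v)) :
    isoEuler r B g = isoEuler r B' g' := by
  refine congrArg Neg.neg (eqEuler_congr_linearEquiv r T (fun φ => ?_) fun U => ?_)
  · change (∀ u v, B (φ u) (φ v) = B u v) ∧ (∀ v, φ (g v) = g (φ v)) ↔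
      (∀ u v, B' (T (φ (T.symm u))) (T (φ (T.symm v))) = B' u v) ∧
        ∀ v, T (φ (T.symm (g' v))) = g' (T (φ (T.symm v)))
    refine and_congr ?_ ?_ <;> simp [T.surjective.forall, hT, ← hg]
  · refine and_congr (and_congr ?_ ?_) (Submodule.map_eq_bot_iff (p := U) (e := T)).symm.not <;>
      simp [IsIsotropic, T.surjective.forall, hT, ← hg]

end Isometries

section Product

variable {K ι : Type*} {W : ι → Type*} [Field K] [∀ i, AddCommGroup (W i)] [∀ i, Module K (W i)]
  {σ : K →+* K}

theorem exists_piCongrRight_eq [DecidableEq ι] {φ : (∀ i, W i) ≃ₗ[K] ∀ i, W i}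
    (hφ : ∀ i x, φ (Pi.single i (x i)) = Pi.single i (φ x i)) :
    ∃ ψ : ∀ i, W i ≃ₗ[K] W i, LinearEquiv.piCongrRight ψ = φ := by
  let ψ : ∀ i, W i →ₗ[K] W i := fun i =>
    LinearMap.proj i ∘ₗ (φ : (∀ i, W i) →ₗ[K] ∀ i, W i) ∘ₗ LinearMap.single K W i
  have hψ : ∀ x i, ψ i (x i) = φ x i := fun x i =>
    (congrFun (hφ i x) i).trans (Pi.single_eq_same i _)
  have hinj : ∀ i, Function.Injective (ψ i) := fun i =>
    (injective_iff_map_eq_zero _).2 fun x hx => by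
      have h := hφ i (Pi.single i x)
      rw [Pi.single_eq_same, show φ (Pi.single i x) i = 0 from hx, Pi.single_zero,
        LinearEquiv.map_eq_zero_iff, Pi.single_eq_zero_iff] at h
      exact h
  have hsurj : ∀ i, Function.Surjective (ψ i) := fun i y =>
    ⟨φ.symm (Pi.single i y) i, by rw [hψ, φ.apply_symm_apply, Pi.single_eq_same]⟩
  exact ⟨fun i => LinearEquiv.ofBijective (ψ i) ⟨hinj i, hsurj i⟩,
    LinearEquiv.ext fun x => funext (hψ x)⟩

/-- `Submodule.pi` over all indices, as an order embedding. -/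
def piSubmodule : (∀ i, Submodule K (W i)) ↪o Submodule K (∀ i, W i) :=
  OrderEmbedding.ofMapLEIff (Submodule.pi Set.univ) fun p q => by
    classical
    refine ⟨fun h i x hx => ?_, fun h x hx i hi => h i (hx i hi)⟩
    simpa using h (Submodule.le_comap_single_pi p hx) i trivial

theorem piCongrRight_smul_piSubmodule [Finite ι] [∀ i, FiniteDimensional K (W i)]
    (ψ : ∀ i, W i ≃ₗ[K] W i) (U : ∀ i, Submodule K (W i)) :
    LinearEquiv.piCongrRight ψ • piSubmodule U = piSubmodule U ↔ ∀ i, ψ i • U i = U i := by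
  classical
  simp only [smul_eq_self_iff]
  refine ⟨fun h i x hx => ?_, fun h x hx i hi => h i _ (hx i hi)⟩
  simpa using h _ (Submodule.le_comap_single_pi U hx) i trivial

variable [Fintype ι]

/-- The orthogonal sum of a finite family of sesquilinear forms. -/
def piForm (B : ∀ i, W i →ₗ[K] W i →ₛₗ[σ] K) : (∀ i, W i) →ₗ[K] (∀ i, W i) →ₛₗ[σ] K :=
  ∑ i, (B i).compl₂ (LinearMap.proj i) ∘ₗ LinearMap.proj i

theorem piForm_apply (B : ∀ i, W i →ₗ[K] W i →ₛₗ[σ] K) (x y : ∀ i, W i) :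
    piForm B x y = ∑ i, B i (x i) (y i) := by
  simp [piForm]

theorem piForm_single [DecidableEq ι] (B : ∀ i, W i →ₗ[K] W i →ₛₗ[σ] K) (i : ι) (x y : W i) :
    piForm B (Pi.single i x) (Pi.single i y) = B i x y := by
  rw [piForm_apply, Finset.sum_eq_single_of_mem i (Finset.mem_univ i), Pi.single_eq_same,
    Pi.single_eq_same]
  intro j _ hj
  rw [Pi.single_eq_of_ne hj, map_zero, LinearMap.zero_apply]

variable {B : ∀ i, W i →ₗ[K] W i →ₛₗ[σ] K} {g : ∀ i, Module.End K (W i)} {E : ι → K[X]}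

theorem piCongrRight_mem_commutingIsometries {ψ : ∀ i, W i ≃ₗ[K] W i} :
    LinearEquiv.piCongrRight ψ ∈ commutingIsometries (piForm B) (LinearMap.piMap g) ↔
      ∀ i, ψ i ∈ commutingIsometries (B i) (g i) := by
  classical
  have hsingle : ∀ i x, LinearEquiv.piCongrRight ψ (Pi.single i x) = Pi.single i (ψ i x) :=
    fun i x => (Pi.single_op (fun i => ψ i) (fun i => map_zero (ψ i)) i x).symm
  refine ⟨fun h i => ⟨fun u v => ?_, fun v => ?_⟩, fun h => ⟨fun u v => ?_, fun v => ?_⟩⟩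
  · have := h.1 (Pi.single i u) (Pi.single i v)
    rwa [hsingle, hsingle, piForm_single, piForm_single] at this
  · simpa using congrFun (h.2 (Pi.single i v)) i
  · simp only [piForm_apply]
    exact Finset.sum_congr rfl fun i _ => (h i).1 _ _
  · exact funext fun i => (h i).2 _

variable [DecidableEq ι]

/-- The projections are polynomials in `LinearMap.piMap g`, so an isometry that commutes with
`LinearMap.piMap g` is diagonal. -/
theorem exists_commutingIsometriesPiEquiv (g : ∀ i, Module.End K (W i))
    (hE : ∀ i x, aeval (LinearMap.piMap g) (E i) x = Pi.single i (x i)) :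
    ∃ e : (∀ i, commutingIsometries (B i) (g i)) ≃*
      commutingIsometries (piForm B) (LinearMap.piMap g),
      ∀ ψ, (e ψ : (∀ i, W i) ≃ₗ[K] ∀ i, W i) = LinearEquiv.piCongrRight fun i => (ψ i).1 := by
  let e : (∀ i, commutingIsometries (B i) (g i)) →*
      commutingIsometries (piForm B) (LinearMap.piMap g) :=
    MonoidHom.mk' (fun ψ => ⟨LinearEquiv.piCongrRight fun i => (ψ i).1,
      piCongrRight_mem_commutingIsometries.2 fun i => (ψ i).2⟩) fun _ _ => rfl
  refine ⟨MulEquiv.ofBijective e ⟨fun ψ ψ' h => ?_, fun φ => ?_⟩, fun ψ => rfl⟩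
  · refine funext fun i => Subtype.ext (LinearEquiv.ext fun x => ?_)
    have hx : (ψ i).1 (Pi.single i x i) = (ψ' i).1 (Pi.single i x i) :=
      congrFun (LinearEquiv.congr_fun (congrArg Subtype.val h) (Pi.single i x)) i
    rwa [Pi.single_eq_same] at hx
  · obtain ⟨ψ, hψ⟩ := exists_piCongrRight_eq (φ := φ.1) fun i x => by
      rw [← hE, ← hE]
      exact map_aeval_apply (φ.1 : (∀ i, W i) →ₗ[K] ∀ i, W i) φ.2.2 (E i) x
    exact ⟨fun i => ⟨ψ i, piCongrRight_mem_commutingIsometries.1 (hψ ▸ φ.2) i⟩, Subtype.ext hψ⟩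

theorem image_piSubmodule_invariantIsotropic
    (hE : ∀ i x, aeval (LinearMap.piMap g) (E i) x = Pi.single i (x i)) :
    piSubmodule '' Set.univ.pi (fun i => invariantIsotropic (B i) (g i)) =
      invariantIsotropic (piForm B) (LinearMap.piMap g) := by
  ext U
  constructor
  · rintro ⟨p, hp, rfl⟩
    refine ⟨fun x hx y hy => ?_, fun x hx i hi => (hp i hi).2 _ (hx i hi)⟩
    rw [piForm_apply]
    exact Finset.sum_eq_zero fun i _ => (hp i trivial).1 _ (hx i trivial) _ (hy i trivial)
  · intro hU
    have hsingle : ∀ x ∈ U, ∀ i, Pi.single i (x i) ∈ U := fun x hx i => by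
      rw [← hE]
      exact aeval_apply_smul_mem_of_le_comap hx (E i) (LinearMap.piMap g) hU.2
    refine ⟨fun i => U.comap (LinearMap.single K W i), fun i _ => ⟨fun x hx y hy => ?_, ?_⟩, ?_⟩
    · rw [← piForm_single B]
      exact hU.1 _ hx _ hy
    · intro x hx
      simpa using hsingle _ (hU.2 _ hx) i
    · ext x
      refine ⟨fun hx => ?_, fun hx i _ => hsingle x hx i⟩
      rw [← Finset.univ_sum_single x]
      exact sum_mem fun i _ => hx i trivial

theorem isoEuler_piForm [∀ i, Finite (W i)] (r : ℕ) (B : ∀ i, W i →ₗ[K] W i →ₛₗ[σ] K)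
    (hE : ∀ i x, aeval (LinearMap.piMap g) (E i) x = Pi.single i (x i)) :
    isoEuler r (piForm B) (LinearMap.piMap g) = ∏ i, isoEuler r (B i) (g i) := by
  obtain ⟨e, he⟩ := exists_commutingIsometriesPiEquiv (B := B) g hE
  refine neg_eqEuler_eq_prod r (fun i => bot_mem_invariantIsotropic (B i) (g i))
    (fun i φ => Submodule.smul_bot' _) e piSubmodule (Submodule.pi_univ_bot)
    (image_piSubmodule_invariantIsotropic hE) fun ψ U => ?_
  rw [he, piCongrRight_smul_piSubmodule]

end Product

section Kernels

variable {K V ι : Type*} [Field K] [AddCommGroup V] [Module K V] [Fintype ι] {σ : K →+* K}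
  {t : ι → K[X]} {g : Module.End K V}

theorem exists_aeval_projections (ht : Pairwise (Function.onFun IsCoprime t))
    (h0 : aeval g (∏ i, t i) = 0) :
    ∃ E : ι → K[X], (∀ x, ∑ i, aeval g (E i) x = x) ∧
      (∀ i x, aeval g (E i) x ∈ LinearMap.ker (aeval g (t i))) ∧
      ∀ i j, i ≠ j → ∀ x ∈ LinearMap.ker (aeval g (t j)), aeval g (E i) x = 0 := by
  classical
  obtain hι | hι := isEmpty_or_nonempty ι
  · refine ⟨0, fun x => ?_, isEmptyElim, isEmptyElim⟩
    rw [Finset.univ_eq_empty, Finset.prod_empty, map_one] at h0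
    rw [Finset.univ_eq_empty, Finset.sum_empty]
    exact (LinearMap.congr_fun h0 x).symm
  obtain ⟨μ, hμ⟩ := exists_sum_eq_one_iff_pairwise_coprime'.2 ht
  refine ⟨fun i => μ i * ∏ j ∈ {i}ᶜ, t j, fun x => ?_, fun i x => ?_, fun i j hij x hx => ?_⟩
  · rw [← LinearMap.sum_apply, ← map_sum, hμ, map_one, Module.End.one_apply]
  · rw [LinearMap.mem_ker, ← Module.End.mul_apply, ← map_mul, mul_left_comm,
      ← Fintype.prod_eq_mul_prod_compl, map_mul, h0, mul_zero, LinearMap.zero_apply]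
  · obtain ⟨c, hc⟩ : t j ∣ ∏ l ∈ {i}ᶜ, t l := Finset.dvd_prod_of_mem t (by simpa using hij.symm)
    beta_reduce
    rw [hc, mul_left_comm, mul_comm, map_mul, Module.End.mul_apply, hx, map_zero]

theorem exists_equiv_pi_ker [DecidableEq ι] (ht : Pairwise (Function.onFun IsCoprime t))
    (h0 : aeval g (∏ i, t i) = 0) :
    ∃ (E : ι → K[X]) (T : V ≃ₗ[K] ∀ i, LinearMap.ker (aeval g (t i))),
      (∀ x i, (T x i : V) = aeval g (E i) x) ∧ (∀ x, ∑ i, (T x i : V) = x) ∧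
        ∀ i (x : LinearMap.ker (aeval g (t i))), T x = Pi.single i x := by
  obtain ⟨E, hsum, hmem, hzero⟩ := exists_aeval_projections ht h0
  have hself : ∀ i, ∀ x ∈ LinearMap.ker (aeval g (t i)), aeval g (E i) x = x := fun i x hx => by
    conv_rhs => rw [← hsum x]
    exact (Finset.sum_eq_single_of_mem i (Finset.mem_univ i) fun j _ hj => hzero j i hj x hx).symm
  let T : V →ₗ[K] ∀ i, LinearMap.ker (aeval g (t i)) :=
    LinearMap.pi fun i => (aeval g (E i)).codRestrict _ (hmem i)
  have hT : ∀ i (x : LinearMap.ker (aeval g (t i))), T x = Pi.single i x := fun i x => by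
    ext j
    obtain rfl | hij := eq_or_ne j i
    · rw [Pi.single_eq_same]
      exact hself j x x.2
    · rw [Pi.single_eq_of_ne hij]
      exact hzero j i hij x x.2
  refine ⟨E, LinearEquiv.ofBijective T ⟨fun x y h => ?_, fun y => ?_⟩, fun _ _ => rfl, hsum, hT⟩
  · rw [← hsum x, ← hsum y]
    exact Finset.sum_congr rfl fun i _ => congrArg Subtype.val (congrFun h i)
  · refine ⟨∑ i, (y i : V), ?_⟩
    rw [map_sum]
    exact (Finset.sum_congr rfl fun i _ => hT i (y i)).trans (Finset.univ_sum_single y)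

variable {B : V →ₗ[K] V →ₛₗ[σ] K}

theorem isoEuler_eq_prod [Finite V] (r : ℕ) (ht : Pairwise (Function.onFun IsCoprime t))
    (h0 : aeval g (∏ i, t i) = 0)
    (horth : ∀ i j, i ≠ j → ∀ x ∈ LinearMap.ker (aeval g (t i)),
      ∀ y ∈ LinearMap.ker (aeval g (t j)), B x y = 0) :
    isoEuler r B g = ∏ i, isoEuler r
      (B.domRestrict₁₂ (LinearMap.ker (aeval g (t i))) (LinearMap.ker (aeval g (t i))))
      (g.restrict (mapsTo_ker_aeval g (t i))) := by
  classical
  obtain ⟨E, T, hTE, hsum, hT⟩ := exists_equiv_pi_ker ht h0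
  have hTg : ∀ v, T (g v) =
      LinearMap.piMap (fun i => g.restrict (mapsTo_ker_aeval g (t i))) (T v) := fun v =>
    funext fun i => Subtype.ext (((hTE _ _).trans (map_aeval_apply g (fun _ => rfl) _ _).symm).trans
      (congrArg g (hTE v i).symm))
  rw [← isoEuler_piForm (E := E)]
  · refine isoEuler_congr r T (fun u v => ?_) hTg
    conv_rhs => rw [← hsum u, ← hsum v]
    simp only [map_sum, LinearMap.sum_apply, piForm_apply]
    refine Finset.sum_congr rfl fun i _ => ?_
    exact (Finset.sum_eq_single_of_mem i (Finset.mem_univ i) fun j _ hj =>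
      horth j i hj _ (T u j).2 _ (T v i).2).symm
  · intro i y
    obtain ⟨x, rfl⟩ := T.surjective y
    rw [← hT, hTE]
    exact (map_aeval_apply T.toLinearMap hTg (E i) x).symm

end Kernels

section Charpoly

variable {K V : Type*} [Field K] [AddCommGroup V] [Module K V]

theorem matrix_charpoly_dvd_pow {ι : Type*} [Fintype ι] [DecidableEq ι] {M : Matrix ι ι K}
    {P : K[X]} (hP : aeval M P = 0) : M.charpoly ∣ P ^ Fintype.card ι := by
  let M' : Matrix ι ι K[X] := (Algebra.ofId K K[X]).mapMatrix M
  have hM' : aeval M' (P.map (algebraMap K K[X])) = 0 := by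
    rw [aeval_map_algebraMap, aeval_algHom_apply, hP, map_zero]
  have hX : aeval M' (C X - X : K[X][X]) = M.charmatrix := by
    rw [map_sub, aeval_C, aeval_X]
    rfl
  obtain ⟨D, hD⟩ : (C X - X : K[X][X]) ∣ C P - P.map (algebraMap K K[X]) := by
    have h := X_sub_C_dvd_sub_C_eval (p := P.map (algebraMap K K[X])) (a := (X : K[X]))
    rwa [eval_map_algebraMap, aeval_X_left_apply, ← neg_dvd, ← dvd_neg, neg_sub, neg_sub] at h
  have h := congrArg (aeval M') hD
  rw [map_sub, hM', sub_zero, aeval_C, map_mul, hX] at h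
  have hdet := congrArg Matrix.det h
  rw [Matrix.det_mul, Algebra.algebraMap_eq_smul_one, Matrix.det_smul, Matrix.det_one,
    mul_one] at hdet
  exact ⟨_, hdet⟩

theorem charpoly_dvd_pow [FiniteDimensional K V] {g : Module.End K V} {P : K[X]}
    (hP : aeval g P = 0) : g.charpoly ∣ P ^ Module.finrank K V := by
  let b := Module.finBasis K V
  have hM : aeval (LinearMap.toMatrixAlgEquiv b g) P = 0 := by
    rw [aeval_algHom_apply (LinearMap.toMatrixAlgEquiv b), hP, map_zero]
  have h := matrix_charpoly_dvd_pow hM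
  rwa [Fintype.card_fin, show (LinearMap.toMatrixAlgEquiv b g).charpoly = g.charpoly from
    LinearMap.charpoly_toMatrix g b] at h

theorem isCompl_ker_aeval {g : Module.End K V} {t Q : K[X]} (htQ : IsCoprime t Q)
    (h0 : aeval g (t * Q) = 0) :
    IsCompl (LinearMap.ker (aeval g t)) (LinearMap.ker (aeval g Q)) :=
  ⟨disjoint_ker_aeval_of_isCoprime g htQ, codisjoint_iff.2 <| by
    rw [sup_ker_aeval_eq_ker_aeval_mul_of_coprime g htQ, h0, LinearMap.ker_zero]⟩

theorem aeval_restrict_ker (g : Module.End K V) (t : K[X]) :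
    aeval (g.restrict (mapsTo_ker_aeval g t)) t = 0 :=
  LinearMap.ext fun x => Subtype.ext <|
    (map_aeval_apply (Submodule.subtype _) (fun _ => rfl) t x).trans x.2

theorem charpoly_eq_mul_of_isCompl [FiniteDimensional K V] {g : Module.End K V}
    {W W' : Submodule K V} (h : IsCompl W W') (hW : ∀ x ∈ W, g x ∈ W) (hW' : ∀ x ∈ W', g x ∈ W') :
    g.charpoly = (g.restrict hW).charpoly * (g.restrict hW').charpoly := by
  let T := Submodule.prodEquivOfIsCompl W W' h
  rw [← LinearMap.charpoly_prodMap, ← LinearEquiv.charpoly_conj T]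
  congr 1
  ext x
  obtain ⟨y, rfl⟩ := T.surjective x
  simp [LinearEquiv.conj_apply, T]

theorem finrank_ker_aeval [FiniteDimensional K V] {g : Module.End K V} {t Q c : K[X]} {a : ℕ}
    (htm : t.Monic) (htQ : IsCoprime t Q) (h0 : aeval g (t * Q) = 0)
    (hg : g.charpoly = t ^ a * c) (htc : IsCoprime t c) :
    Module.finrank K (LinearMap.ker (aeval g t)) = a * t.natDegree := by
  set g₁ := g.restrict (mapsTo_ker_aeval g t)
  set g₂ := g.restrict (mapsTo_ker_aeval g Q)
  have hchar : t ^ a * c = g₁.charpoly * g₂.charpoly :=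
    hg.symm.trans (charpoly_eq_mul_of_isCompl (isCompl_ker_aeval htQ h0) _ _)
  have h₁ : g₁.charpoly ∣ t ^ _ := charpoly_dvd_pow (aeval_restrict_ker g t)
  have h₂ : g₂.charpoly ∣ Q ^ _ := charpoly_dvd_pow (aeval_restrict_ker g Q)
  have hdvd : t ^ a ∣ g₁.charpoly :=
    (htQ.pow.of_isCoprime_of_dvd_right h₂).dvd_of_dvd_mul_right (Dvd.intro c hchar)
  have hdvd' : g₁.charpoly ∣ t ^ a :=
    (htc.pow_left.of_isCoprime_of_dvd_left h₁).dvd_of_dvd_mul_right (Dvd.intro _ hchar.symm)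
  rw [← LinearMap.charpoly_natDegree g₁, eq_of_monic_of_associated (LinearMap.charpoly_monic g₁)
    (htm.pow a) (associated_of_dvd_dvd hdvd' hdvd), natDegree_pow]

theorem exists_isCoprime_aeval_mul_eq_zero {g : Module.End K V} {μ t : K[X]} (hμ : Squarefree μ)
    (hμg : aeval g μ = 0) (ht : Irreducible t) : ∃ Q, IsCoprime t Q ∧ aeval g (t * Q) = 0 := by
  by_cases htμ : t ∣ μ
  · obtain ⟨Q, rfl⟩ := htμ
    refine ⟨Q, ht.coprime_iff_not_dvd.2 fun htQ => ht.not_isUnit ?_, hμg⟩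
    exact hμ t (mul_dvd_mul_left t htQ)
  · exact ⟨μ, ht.coprime_iff_not_dvd.2 htμ, by rw [map_mul, hμg, mul_zero]⟩

end Charpoly

section Dual

variable {K L : Type*} [Field K] [Field L] {σ : K →+* K} {f : K[X]}

/-- The monic polynomial whose roots are the inverses of the images under `σ` of the roots
of `f`. This is the paper's dual polynomial when `f` is monic, `f.coeff 0 ≠ 0` and `σ` is the
Frobenius map `x ↦ x ^ q`. -/
def dualPoly (σ : K →+* K) (f : K[X]) : K[X] :=
  C (σ (f.coeff 0))⁻¹ * (f.map σ).reverse

theorem dualPoly_mul (σ : K →+* K) (f g : K[X]) :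
    dualPoly σ (f * g) = dualPoly σ f * dualPoly σ g := by
  simp only [dualPoly, Polynomial.map_mul, reverse_mul_of_domain, mul_coeff_zero, map_mul, mul_inv]
  ring

theorem dualPoly_one (σ : K →+* K) : dualPoly σ 1 = 1 := by
  rw [dualPoly, Polynomial.map_one, ← C_1, reverse_C, coeff_C_zero, map_one, inv_one, C_1, one_mul]

theorem reverse_map_ringHom (i : K →+* L) (f : K[X]) : (f.map i).reverse = f.reverse.map i := by
  rw [reverse, natDegree_map, reflect_map, reverse]

theorem map_dualPoly (i : K →+* L) {τ : L →+* L} (hi : ∀ x, i (σ x) = τ (i x)) (f : K[X]) :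
    (dualPoly σ f).map i = dualPoly τ (f.map i) := by
  simp only [dualPoly, Polynomial.map_mul, map_C, map_inv₀, hi, coeff_map, ← reverse_map_ringHom,
    map_map, show i.comp σ = τ.comp i from RingHom.ext hi]

theorem dualPoly_X_sub_C (σ : K →+* K) {a : K} (ha : a ≠ 0) :
    dualPoly σ (X - C a) = X - C (σ a)⁻¹ := by
  have h0 : σ a ≠ 0 := (_root_.map_ne_zero σ).2 ha
  have h1 : (X - C (σ a)).reverse = 1 - C (σ a) * X := by
    rw [reverse, natDegree_X_sub_C, reflect_sub, reflect_one_X, reflect_C, pow_one]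
  have h2 : C (σ a)⁻¹ * C (σ a) = 1 := by rw [← C_mul, inv_mul_cancel₀ h0, C_1]
  simp only [dualPoly, Polynomial.map_sub, map_X, map_C, h1, coeff_sub, coeff_X_zero,
    coeff_C_zero, zero_sub, map_neg, inv_neg]
  linear_combination X * h2

theorem dualPoly_multiset_prod (σ : K →+* K) (s : Multiset K[X]) :
    dualPoly σ s.prod = (s.map (dualPoly σ)).prod :=
  map_multiset_prod (⟨⟨dualPoly σ, dualPoly_one σ⟩, dualPoly_mul σ⟩ : K[X] →* K[X]) s

theorem natTrailingDegree_map_eq_zero (hf : f.coeff 0 ≠ 0) : (f.map σ).natTrailingDegree = 0 :=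
  natTrailingDegree_eq_zero.2 <| Or.inr <| by rwa [coeff_map, _root_.map_ne_zero]

theorem natDegree_dualPoly (hf : f.coeff 0 ≠ 0) : (dualPoly σ f).natDegree = f.natDegree := by
  rw [dualPoly, natDegree_C_mul (inv_ne_zero ((_root_.map_ne_zero σ).2 hf)), reverse_natDegree,
    natTrailingDegree_map_eq_zero hf, natDegree_map, Nat.sub_zero]

theorem dualPoly_monic (hf : f.coeff 0 ≠ 0) : (dualPoly σ f).Monic := by
  rw [dualPoly, Monic, leadingCoeff_mul, leadingCoeff_C, reverse_leadingCoeff, trailingCoeff,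
    natTrailingDegree_map_eq_zero hf, coeff_map, inv_mul_cancel₀ ((_root_.map_ne_zero σ).2 hf)]

theorem coeff_zero_dualPoly (hm : f.Monic) : (dualPoly σ f).coeff 0 = (σ (f.coeff 0))⁻¹ := by
  rw [dualPoly, mul_coeff_zero, coeff_C_zero, coeff_zero_reverse, (hm.map σ).leadingCoeff, mul_one]

theorem coeff_zero_dualPoly_ne_zero (hm : f.Monic) (hf : f.coeff 0 ≠ 0) :
    (dualPoly σ f).coeff 0 ≠ 0 := by
  rw [coeff_zero_dualPoly hm]
  exact inv_ne_zero ((_root_.map_ne_zero σ).2 hf)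

theorem reverse_reverse (hf : f.coeff 0 ≠ 0) : f.reverse.reverse = f := by
  have h : f.reverse.natDegree = f.natDegree := by
    rw [reverse_natDegree, natTrailingDegree_eq_zero.2 (Or.inr hf), Nat.sub_zero]
  rw [reverse, h, reverse, reflect_reflect]

theorem dualPoly_dualPoly (hσ : Function.Involutive σ) (hm : f.Monic) (hf : f.coeff 0 ≠ 0) :
    dualPoly σ (dualPoly σ f) = f := by
  have hσσ : σ.comp σ = RingHom.id K := RingHom.ext hσ
  have hmap : (dualPoly σ f).map σ = C (f.coeff 0)⁻¹ * f.reverse := by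
    rw [map_dualPoly (τ := σ) σ fun _ => rfl, dualPoly, map_map, hσσ, map_id, coeff_map, hσ]
  rw [dualPoly, hmap, coeff_zero_dualPoly hm, map_inv₀ σ, hσ, inv_inv, reverse_mul_of_domain,
    reverse_C, reverse_reverse hf, ← mul_assoc, ← C_mul, mul_inv_cancel₀ hf, C_1, one_mul]

theorem dualPoly_irreducible (hσ : Function.Involutive σ) (hm : f.Monic) (hf : f.coeff 0 ≠ 0)
    (hirr : Irreducible f) : Irreducible (dualPoly σ f) := by
  refine ⟨fun hu => ?_, fun a b hab => ?_⟩
  · have := natDegree_eq_zero_of_isUnit hu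
    rw [natDegree_dualPoly hf] at this
    exact hirr.natDegree_pos.ne' this
  · have hc := coeff_zero_dualPoly_ne_zero (σ := σ) hm hf
    have hfab := dualPoly_dualPoly hσ hm hf
    rw [hab, mul_coeff_zero] at hc
    rw [hab, dualPoly_mul] at hfab
    have hunit {c : K[X]} (hc0 : c.coeff 0 ≠ 0) (hu : IsUnit (dualPoly σ c)) : IsUnit c := by
      have hdeg := natDegree_eq_zero_of_isUnit hu
      rw [natDegree_dualPoly hc0] at hdeg
      rw [eq_C_of_natDegree_eq_zero hdeg]
      exact isUnit_C.2 (isUnit_iff_ne_zero.2 hc0)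
    exact (hirr.isUnit_or_isUnit hfab.symm).imp (hunit (left_ne_zero_of_mul hc))
      (hunit (right_ne_zero_of_mul hc))

theorem isDual_iff {p k : ℕ} [Fact p.Prime] [CharP K p] (hm : f.Monic) (hf : f.coeff 0 ≠ 0)
    {f' : K[X]} : IsDual (p ^ k) f f' ↔ f' = dualPoly (iterateFrobenius K p k) f := by
  set S := f.SplittingField
  have : CharP S p := charP_of_injective_algebraMap (algebraMap K S).injective p
  have hne : ∀ α ∈ f.aroots S, α ≠ 0 := by
    rintro α hα rfl
    have h0 := (mem_aroots.1 hα).2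
    rw [← coeff_zero_eq_aeval_zero', map_eq_zero] at h0
    exact hf h0
  have hmap : (dualPoly (iterateFrobenius K p k) f).map (algebraMap K S) =
      C (algebraMap K S f.leadingCoeff) *
        ((f.aroots S).map fun α => X - C (α⁻¹ ^ p ^ k)).prod := by
    rw [map_dualPoly (algebraMap K S) (τ := iterateFrobenius S p k) fun x => by
        simp only [iterateFrobenius_def, map_pow],
      (SplittingField.splits f).eq_prod_roots_of_monic (hm.map _),
      dualPoly_multiset_prod, Multiset.map_map, hm.leadingCoeff, map_one, C_1, one_mul]
    refine congrArg _ (Multiset.map_congr rfl fun α hα => ?_)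
    rw [Function.comp_apply, dualPoly_X_sub_C _ (hne α hα), iterateFrobenius_def, inv_pow]
  rw [IsDual, ← hmap]
  exact (Polynomial.map_injective _ (algebraMap K S).injective).eq_iff

end Dual

section Adjoint

variable {K V : Type*} [Field K] [AddCommGroup V] [Module K V] {σ : K →+* K}
  {B : V →ₗ[K] V →ₛₗ[σ] K} {g : Module.End K V} {f t : K[X]}

theorem pow_apply_of_isometry (hg : ∀ u v, B (g u) (g v) = B u v) (n : ℕ) (u v : V) :
    B ((g ^ n) u) ((g ^ n) v) = B u v := by
  induction n with
  | zero => rfl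
  | succ n ih => rw [pow_succ', Module.End.mul_apply, Module.End.mul_apply, hg, ih]

theorem aeval_reflect (hσ : Function.Involutive σ) (hg : ∀ u v, B (g u) (g v) = B u v) {N : ℕ}
    (hN : f.natDegree ≤ N) (u v : V) :
    B (aeval g f u) ((g ^ N) v) = B u (aeval g (reflect N (f.map σ)) v) := by
  refine Polynomial.induction_with_natDegree_le
    (fun f => B (aeval g f u) ((g ^ N) v) = B u (aeval g (reflect N (f.map σ)) v)) N
    (by simp) (fun n c _ hn => ?_) (fun f₁ f₂ _ _ h₁ h₂ => by simp [reflect_add, h₁, h₂]) f hN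
  obtain ⟨m, rfl⟩ := Nat.exists_eq_add_of_le hn
  rw [Polynomial.map_mul, map_C, Polynomial.map_pow, map_X, reflect_C_mul_X_pow, revAt_le hn,
    Nat.add_sub_cancel_left, pow_add, Module.End.mul_apply]
  simp [LinearMap.map_smulₛₗ, pow_apply_of_isometry hg, hσ c]

theorem aeval_dualPoly (hσ : Function.Involutive σ) (hg : ∀ u v, B (g u) (g v) = B u v)
    (hf : f.coeff 0 ≠ 0) (u v : V) :
    B (aeval g f u) ((g ^ f.natDegree) v) = f.coeff 0 * B u (aeval g (dualPoly σ f) v) := by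
  have hreflect : reflect f.natDegree (f.map σ) = C (σ (f.coeff 0)) * dualPoly σ f := by
    rw [dualPoly, ← mul_assoc, ← C_mul, mul_inv_cancel₀ ((_root_.map_ne_zero σ).2 hf), C_1,
      one_mul, reverse, natDegree_map]
  rw [aeval_reflect hσ hg le_rfl, hreflect, map_mul, aeval_C, Module.End.mul_apply,
    Module.algebraMap_end_apply, LinearMap.map_smulₛₗ, hσ, smul_eq_mul]

theorem orthogonal_ker_aeval (hσ : Function.Involutive σ) (hg : ∀ u v, B (g u) (g v) = B u v)
    (hf : f.coeff 0 ≠ 0) (hft : IsCoprime (dualPoly σ f) t) {x y : V}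
    (hx : x ∈ LinearMap.ker (aeval g f)) (hy : y ∈ LinearMap.ker (aeval g t)) : B x y = 0 := by
  obtain ⟨a, b, hab⟩ := hft
  have hay : aeval g (dualPoly σ f) (aeval g a y) = y := by
    have h := LinearMap.congr_fun (congrArg (aeval g) hab) y
    rwa [map_add, map_mul _ b, LinearMap.add_apply, Module.End.mul_apply, LinearMap.mem_ker.1 hy,
      map_zero, add_zero, mul_comm, map_mul, map_one] at h
  have h := aeval_dualPoly hσ hg hf x (aeval g a y)
  rw [hay, LinearMap.mem_ker.1 hx, map_zero, LinearMap.zero_apply] at h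
  exact (mul_eq_zero.1 h.symm).resolve_left hf

theorem injective_of_isometry (hnd : B.SeparatingLeft) (hg : ∀ u v, B (g u) (g v) = B u v) :
    Function.Injective g :=
  (injective_iff_map_eq_zero g).2 fun u hu => hnd u fun v => by
    rw [← hg, hu, map_zero, LinearMap.zero_apply]

variable [Finite K] [FiniteDimensional K V]

theorem bijective_flip (hB : B.IsRefl) (hnd : B.SeparatingLeft) : Function.Bijective B.flip := by
  have : Finite (Module.Dual K V) := Module.finite_of_finite K
  have hinj : Function.Injective B.flip := (injective_iff_map_eq_zero _).2 fun v hv =>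
    hnd v fun u => hB _ _ (LinearMap.congr_fun hv u)
  refine hinj.bijective_of_nat_card_le (le_of_eq ?_)
  rw [Module.natCard_eq_pow_finrank (K := K), Subspace.dual_finrank_eq,
    ← Module.natCard_eq_pow_finrank (K := K)]

theorem finrank_add_finrank_orthogonalBilin (hB : B.IsRefl) (hnd : B.SeparatingLeft)
    (U : Submodule K V) :
    Module.finrank K U + Module.finrank K (U.orthogonalBilin B) = Module.finrank K V := by
  have hcard : Nat.card (U.orthogonalBilin B) = Nat.card U.dualAnnihilator :=
    Nat.card_congr <| (Equiv.ofBijective _ (bijective_flip hB hnd)).subtypeEquiv fun v =>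
      (Submodule.mem_dualAnnihilator (W := U) (B.flip v)).symm
  rw [Module.natCard_eq_pow_finrank (K := K) (V := U.orthogonalBilin B),
    Module.natCard_eq_pow_finrank (K := K) (V := U.dualAnnihilator)] at hcard
  rw [Nat.pow_right_injective (Finite.one_lt_card (α := K)) hcard,
    Subspace.finrank_add_finrank_dualAnnihilator_eq]

end Adjoint

section ScalarExtension

variable {K L V : Type*} [Field K] [Field L] [Algebra K L] [AddCommGroup V] [Module K V]
  [Module L V] [IsScalarTower K L V] {θ : L}

theorem smul_mem_of_adjoin_eq_top (hθ : Algebra.adjoin K {θ} = ⊤) {U : Submodule K V}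
    (hU : ∀ x ∈ U, θ • x ∈ U) (c : L) {x : V} (hx : x ∈ U) : c • x ∈ U := by
  have hc : c ∈ Algebra.adjoin K {θ} := hθ ▸ Algebra.mem_top
  induction hc using Algebra.adjoin_induction generalizing x with
  | mem _ h => rw [Set.mem_singleton_iff.1 h]; exact hU x hx
  | algebraMap a => rw [algebraMap_smul]; exact U.smul_mem a hx
  | add _ _ _ _ h₁ h₂ => rw [add_smul]; exact U.add_mem (h₁ hx) (h₂ hx)
  | mul _ _ _ _ h₁ h₂ => rw [mul_smul]; exact h₁ (h₂ hx)

theorem map_smul_of_adjoin_eq_top (hθ : Algebra.adjoin K {θ} = ⊤) (f : V →ₗ[K] V)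
    (hf : ∀ v, f (θ • v) = θ • f v) (c : L) (v : V) : f (c • v) = c • f v := by
  have hc : c ∈ Algebra.adjoin K {θ} := hθ ▸ Algebra.mem_top
  induction hc using Algebra.adjoin_induction generalizing v with
  | mem _ h => rw [Set.mem_singleton_iff.1 h]; exact hf v
  | algebraMap a => rw [algebraMap_smul, algebraMap_smul, map_smul]
  | add _ _ _ _ h₁ h₂ => rw [add_smul, map_add, h₁, h₂, add_smul]
  | mul _ _ _ _ h₁ h₂ => rw [mul_smul, h₁, h₂, mul_smul]

theorem eqEuler_restrictScalars (r : ℕ) (hθ : Algebra.adjoin K {θ} = ⊤)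
    {H : Subgroup (V ≃ₗ[L] V)} {H' : Subgroup (V ≃ₗ[K] V)}
    {P : Set (Submodule L V)} {P' : Set (Submodule K V)}
    (hH : ∀ φ : V ≃ₗ[L] V, φ ∈ H ↔ φ.restrictScalars K ∈ H')
    (hH' : ∀ φ ∈ H', ∀ v, φ (θ • v) = θ • φ v)
    (hP : ∀ U : Submodule L V, U ∈ P ↔ U.restrictScalars K ∈ P')
    (hP' : ∀ U ∈ P', ∀ x ∈ U, θ • x ∈ U) : eqEuler r H P = eqEuler r H' P' := by
  let e : H →* H' :=
    { toFun := fun φ => ⟨φ.1.restrictScalars K, (hH φ).1 φ.2⟩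
      map_one' := rfl
      map_mul' := fun _ _ => rfl }
  have he : Function.Bijective e := by
    refine ⟨fun φ ψ h => Subtype.ext (LinearEquiv.ext fun v =>
      LinearEquiv.congr_fun (congrArg Subtype.val h) v), fun ⟨φ, hφ⟩ => ?_⟩
    let ψ : V ≃ₗ[L] V :=
      { φ with map_smul' := map_smul_of_adjoin_eq_top hθ (φ : V →ₗ[K] V) (hH' φ hφ) }
    exact ⟨⟨ψ, (hH ψ).2 hφ⟩, rfl⟩
  refine eqEuler_congr r (MulEquiv.ofBijective e he) (Submodule.restrictScalarsEmbedding K L V)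
    ?_ fun φ U _ => ?_
  · ext U
    refine ⟨fun ⟨U', hU', h⟩ => h ▸ (hP U').1 hU', fun hU => ?_⟩
    let U' : Submodule L V :=
      { U with smul_mem' := fun c _ => smul_mem_of_adjoin_eq_top hθ (hP' U hU) c }
    exact ⟨U', (hP U').2 hU, rfl⟩
  · exact (Submodule.restrictScalarsEmbedding K L V).injective.eq_iff.symm

end ScalarExtension

section TraceForm

variable {K L V : Type*} [Field K] [Field L] [Algebra K L] [AddCommGroup V] [Module K V]
  [Module L V] {σ : K →+* K} {τ : L →+* L} {B : V →ₗ[K] V →ₛₗ[σ] K}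
  {H : V →ₗ[L] V →ₛₗ[τ] L}

theorem trace_mul_apply (hH : ∀ u v, Algebra.trace K L (H u v) = B u v) (c : L) (u v : V) :
    Algebra.trace K L (c * H u v) = B (c • u) v := by
  rw [← hH, map_smul, LinearMap.smul_apply, smul_eq_mul]

theorem apply_smul_of_adjoin_eq_top [IsScalarTower K L V] {θ : L}
    (hθ : Algebra.adjoin K {θ} = ⊤) (hσ : Function.Involutive σ)
    (hτ : ∀ c, τ (algebraMap K L c) = algebraMap K L (σ c))
    (hBθ : ∀ u v, B (θ • u) v = B u (τ θ • v)) (c : L) (u v : V) :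
    B (c • u) v = B u (τ c • v) := by
  have hc : c ∈ Algebra.adjoin K {θ} := hθ ▸ Algebra.mem_top
  induction hc using Algebra.adjoin_induction generalizing u v with
  | mem _ h => rw [Set.mem_singleton_iff.1 h, hBθ]
  | algebraMap a =>
    rw [hτ, algebraMap_smul, algebraMap_smul, map_smul, LinearMap.map_smulₛₗ, hσ]
    rfl
  | add _ _ _ _ h₁ h₂ => rw [add_smul, map_add, LinearMap.add_apply, h₁, h₂, map_add, add_smul,
      map_add]
  | mul _ _ _ _ h₁ h₂ => rw [map_mul, mul_smul (τ _), mul_comm, mul_smul, h₂, h₁]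

variable [FiniteDimensional K L] [Algebra.IsSeparable K L]

theorem trace_mul_injective {x y : L}
    (h : ∀ c, Algebra.trace K L (c * x) = Algebra.trace K L (c * y)) : x = y := by
  rw [← sub_eq_zero]
  refine (traceForm_nondegenerate K L).1 _ fun c => ?_
  rw [Algebra.traceForm_apply, mul_comm, mul_sub, map_sub, h, sub_self]

theorem exists_trace_mul_eq (f : L →ₗ[K] K) : ∃ x, ∀ c, Algebra.trace K L (c * x) = f c :=
  ⟨(LinearMap.BilinForm.toDual _ (traceForm_nondegenerate K L)).symm f, fun c => by
    rw [mul_comm, ← Algebra.traceForm_apply, LinearMap.BilinForm.apply_toDual_symm_apply]⟩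

variable [IsScalarTower K L V]

theorem IsHermitian.exists_trace_eq (hB : IsHermitian B) (hτ : Function.Involutive τ)
    (htr : ∀ x, Algebra.trace K L (τ x) = σ (Algebra.trace K L x))
    (hadj : ∀ (c : L) u v, B (c • u) v = B u (τ c • v)) :
    ∃ H : V →ₗ[L] V →ₛₗ[τ] L, IsHermitian H ∧ ∀ u v, Algebra.trace K L (H u v) = B u v := by
  choose H hH using fun u v => exists_trace_mul_eq
    (B.flip v ∘ₗ (LinearMap.toSpanSingleton L V u).restrictScalars K)
  replace hH : ∀ u v c, Algebra.trace K L (c * H u v) = B (c • u) v := hH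
  have hsymm : ∀ u v, τ (H u v) = H v u := fun u v => trace_mul_injective (K := K) fun c => by
    rw [hH, ← congrArg (· * τ (H u v)) (hτ c), ← map_mul, htr, hH, hB, hadj]
  have hadd : ∀ u u' v, H (u + u') v = H u v + H u' v := fun u u' v =>
    trace_mul_injective (K := K) fun c => by
      rw [mul_add, map_add, hH, hH, hH, smul_add, map_add, LinearMap.add_apply]
  have hsmul : ∀ (c : L) u v, H (c • u) v = c * H u v := fun c u v =>
    trace_mul_injective (K := K) fun d => by rw [hH, ← mul_assoc, hH, mul_smul]
  refine ⟨LinearMap.mk₂'ₛₗ (RingHom.id L) τ H hadd hsmul (fun u v v' => ?_) fun c u v => ?_,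
    hsymm, fun u v => ?_⟩
  · rw [← hsymm, hadd, map_add, hsymm, hsymm]
  · rw [← hsymm, hsmul, map_mul, hsymm, smul_eq_mul]
  · rw [LinearMap.mk₂'ₛₗ_apply, ← one_mul (H u v), hH, one_smul]

theorem mem_isometryGroup_iff_restrictScalars (hH : ∀ u v, Algebra.trace K L (H u v) = B u v)
    (φ : V ≃ₗ[L] V) : φ ∈ isometryGroup H ↔ φ.restrictScalars K ∈ isometryGroup B := by
  refine ⟨fun h u v => ?_, fun h u v => trace_mul_injective (K := K) fun c => ?_⟩
  · rw [← hH, ← hH]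
    exact congrArg _ (h u v)
  · rw [trace_mul_apply hH, trace_mul_apply hH, ← map_smul]
    exact h (c • u) v

theorem isIsotropic_iff_restrictScalars (hH : ∀ u v, Algebra.trace K L (H u v) = B u v)
    (U : Submodule L V) : IsIsotropic H U ↔ IsIsotropic B (U.restrictScalars K) := by
  refine ⟨fun h u hu v hv => ?_, fun h u hu v hv => trace_mul_injective (K := K) fun c => ?_⟩
  · rw [← hH, h u hu v hv, map_zero]
  · rw [trace_mul_apply hH, mul_zero, map_zero]
    exact h _ (U.smul_mem c hu) v hv

theorem isoEuler_eq_neg_eqEuler (r : ℕ) {θ : L} (hθ : Algebra.adjoin K {θ} = ⊤)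
    {g : Module.End K V} (hg : ∀ v, θ • v = g v)
    (hH : ∀ u v, Algebra.trace K L (H u v) = B u v) :
    isoEuler r B g = -eqEuler r (isometryGroup H) (isotropicSubspaces H) := by
  refine congrArg Neg.neg (eqEuler_restrictScalars r hθ (fun φ => ?_) (fun φ hφ v => ?_)
    (fun U => ?_) fun U hU x hx => ?_).symm
  · refine (mem_isometryGroup_iff_restrictScalars hH φ).trans (and_iff_left fun v => ?_).symm
    rw [← hg, ← hg]
    exact φ.map_smul θ v
  · rw [hg, hg, hφ.2]
  · refine and_comm.trans (and_congr ?_ (Submodule.restrictScalars_eq_bot_iff ..).symm.not)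
    refine (isIsotropic_iff_restrictScalars hH U).trans (and_iff_left fun x hx => ?_).symm
    rw [← hg]
    exact U.smul_mem θ hx
  · rw [hg]
    exact hU.1.2 x hx

end TraceForm

section GaloisFieldModule

variable {K V : Type*} [Field K] [AddCommGroup V] [Module K V] {ρ : K[X]}

theorem exists_module_of_aeval_eq_zero {L : Type*} [Field L] [Algebra K L]
    (e : AdjoinRoot ρ ≃ₐ[K] L) {g : Module.End K V} (hg : aeval g ρ = 0) :
    ∃ (_ : Module L V) (_ : IsScalarTower K L V), ∀ v, e (AdjoinRoot.root ρ) • v = g v := by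
  let φ : AdjoinRoot ρ →ₐ[K] Module.End K V :=
    Ideal.Quotient.liftₐ _ (aeval g) fun P hP => by
      obtain ⟨Q, rfl⟩ := Ideal.mem_span_singleton.1 hP
      rw [map_mul, hg, zero_mul]
  let ψ : L →ₐ[K] Module.End K V := φ.comp e.symm
  let _ : Module L V := Module.compHom V (ψ : L →+* Module.End K V)
  refine ⟨inferInstance, IsScalarTower.of_algebraMap_smul fun c v => ?_, fun v => ?_⟩
  · exact (LinearMap.congr_fun (ψ.commutes c) v).trans (Module.algebraMap_end_apply ..)
  · change φ (e.symm (e (AdjoinRoot.root ρ))) v = g v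
    rw [e.symm_apply_apply]
    exact LinearMap.congr_fun (aeval_X g) v

variable [Finite K] {p N : ℕ} [Fact p.Prime] [CharP K p]

theorem exists_algebra_galoisField (hρ : Irreducible ρ)
    (hN : p ^ N = Nat.card K ^ ρ.natDegree) :
    ∃ _ : Algebra K (GaloisField p N), Nonempty (AdjoinRoot ρ ≃ₐ[K] GaloisField p N) := by
  have : Fact (Irreducible ρ) := ⟨hρ⟩
  have : FiniteDimensional K (AdjoinRoot ρ) := (AdjoinRoot.powerBasis hρ.ne_zero).finite
  have : Finite (AdjoinRoot ρ) := Module.finite_of_finite K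
  have : CharP (AdjoinRoot ρ) p :=
    charP_of_injective_algebraMap (algebraMap K (AdjoinRoot ρ)).injective p
  have hN0 : N ≠ 0 := by
    rintro rfl
    exact (Nat.one_lt_pow hρ.natDegree_pos.ne' Finite.one_lt_card).ne hN
  have hcard : Nat.card (AdjoinRoot ρ) = Nat.card (GaloisField p N) := by
    rw [Module.natCard_eq_pow_finrank (K := K) (V := AdjoinRoot ρ), GaloisField.card p N hN0, hN,
      (AdjoinRoot.powerBasis hρ.ne_zero).finrank, AdjoinRoot.powerBasis_dim]
  have := Fintype.ofFinite (AdjoinRoot ρ)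
  have := Fintype.ofFinite (GaloisField p N)
  let e : AdjoinRoot ρ ≃+* GaloisField p N := FiniteField.ringEquivOfCardEq (by
    rw [← Nat.card_eq_fintype_card, ← Nat.card_eq_fintype_card, hcard])
  let _ : Algebra K (GaloisField p N) :=
    ((e : AdjoinRoot ρ →+* GaloisField p N).comp (algebraMap K (AdjoinRoot ρ))).toAlgebra
  exact ⟨inferInstance, ⟨AlgEquiv.ofRingEquiv (f := e) fun _ => rfl⟩⟩

theorem exists_galoisField_module (hρ : Irreducible ρ)
    (hN : p ^ N = Nat.card K ^ ρ.natDegree) {g : Module.End K V} (hg : aeval g ρ = 0) :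
    ∃ (_ : Algebra K (GaloisField p N)) (_ : Module (GaloisField p N) V)
      (_ : IsScalarTower K (GaloisField p N) V) (θ : GaloisField p N),
      aeval θ ρ = 0 ∧ Algebra.adjoin K {θ} = ⊤ ∧
      Module.finrank K (GaloisField p N) = ρ.natDegree ∧ ∀ v : V, θ • v = g v := by
  obtain ⟨_, ⟨e⟩⟩ := exists_algebra_galoisField hρ hN
  obtain ⟨_, _, hθ⟩ := exists_module_of_aeval_eq_zero e hg
  refine ⟨inferInstance, inferInstance, inferInstance, e (AdjoinRoot.root ρ), ?_, ?_, ?_, hθ⟩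
  · rw [aeval_algHom_apply, AdjoinRoot.aeval_eq, AdjoinRoot.mk_self, map_zero]
  · have h := AlgHom.map_adjoin_singleton (e : AdjoinRoot ρ →ₐ[K] GaloisField p N)
      (AdjoinRoot.root ρ)
    rw [AdjoinRoot.adjoinRoot_eq_top, Algebra.map_top] at h
    exact h.symm.trans ((AlgHom.range_eq_top _).2 e.surjective)
  · rw [← e.toLinearEquiv.finrank_eq, (AdjoinRoot.powerBasis hρ.ne_zero).finrank,
      AdjoinRoot.powerBasis_dim]

end GaloisFieldModule

section SelfDualRoot

variable {K L : Type*} [Field K] [Field L] [Algebra K L] {p k : ℕ} [Fact p.Prime] [CharP K p]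
  [CharP L p] {ρ : K[X]} {θ : L}

theorem aeval_inv_pow_eq_zero (hdual : dualPoly (iterateFrobenius K p k) ρ = ρ) (hθ0 : θ ≠ 0)
    (hθ : aeval θ ρ = 0) : aeval (θ ^ p ^ k)⁻¹ ρ = 0 := by
  have hpow : eval₂ (algebraMap K L) (θ ^ p ^ k) (ρ.map (iterateFrobenius K p k)) = 0 := by
    have h := hom_eval₂ ρ (algebraMap K L) (iterateFrobenius L p k) θ
    rw [← aeval_def, hθ, map_zero, ← RingHom.iterateFrobenius_comm, ← eval₂_map] at h
    exact h.symm
  let _ : Invertible (θ ^ p ^ k) := invertibleOfNonzero (pow_ne_zero _ hθ0)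
  rw [← hdual, dualPoly, map_mul, aeval_def, aeval_def, ← invOf_eq_inv,
    (eval₂_reverse_eq_zero_iff _ _ _).2 hpow, mul_zero]

variable [Finite K]

theorem iterateFrobenius_algebraMap_of_odd (hK : Nat.card K = (p ^ k) ^ 2) {d : ℕ} (hd : Odd d)
    (c : K) : iterateFrobenius L p (k * d) (algebraMap K L c) =
      algebraMap K L (iterateFrobenius K p k c) := by
  obtain ⟨j, rfl⟩ := hd
  have := Fintype.ofFinite K
  rw [← RingHom.map_iterateFrobenius, iterateFrobenius_def, iterateFrobenius_def, pow_mul,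
    pow_succ, pow_mul, pow_mul (p ^ k), ← hK, Nat.card_eq_fintype_card, FiniteField.pow_card_pow]

variable [Finite L]

theorem exists_pow_eq_inv (hK : Nat.card K = (p ^ k) ^ 2) (hρ : Irreducible ρ)
    (hdual : dualPoly (iterateFrobenius K p k) ρ = ρ) (hθ0 : θ ≠ 0) (hθ : aeval θ ρ = 0) :
    ∃ j < Module.finrank K L, θ ^ (p ^ k) ^ (2 * j + 1) = θ⁻¹ := by
  have := Fintype.ofFinite K
  have hmin : aeval (θ ^ p ^ k)⁻¹ (minpoly K θ) = 0 := by
    rw [← minpoly.eq_of_irreducible hρ hθ, map_mul, aeval_inv_pow_eq_zero hdual hθ0 hθ, zero_mul]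
  obtain ⟨s, hs⟩ := minpoly.exists_algEquiv_of_root (Algebra.IsAlgebraic.isAlgebraic θ) hmin
  obtain ⟨⟨j, hj⟩, hjs⟩ := (FiniteField.bijective_frobeniusAlgHom_pow K L).2 (s : L →ₐ[K] L)
  refine ⟨j, hj, ?_⟩
  have h := (AlgHom.congr_fun hjs _).trans hs
  simp only [AlgHom.coe_pow, FiniteField.coe_frobeniusAlgHom, pow_iterate] at h
  rwa [← Nat.card_eq_fintype_card, hK, ← pow_mul, inv_pow, ← pow_mul, ← pow_succ',
    inv_eq_iff_eq_inv] at h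

/-- The root `θ` satisfies `θ ^ q ^ (2 * j + 1) = θ⁻¹` for some `j < d`, where `q = p ^ k` and `d`
is the degree, so `d` divides `2 * j + 1 < 2 * d`. -/
theorem odd_finrank_and_pow_eq_inv (hK : Nat.card K = (p ^ k) ^ 2) (hρ : Irreducible ρ)
    (hdual : dualPoly (iterateFrobenius K p k) ρ = ρ) (hθ0 : θ ≠ 0) (hθ : aeval θ ρ = 0)
    (hadj : Algebra.adjoin K {θ} = ⊤) :
    Odd (Module.finrank K L) ∧ θ ^ (p ^ k) ^ Module.finrank K L = θ⁻¹ := by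
  have := Fintype.ofFinite K
  obtain ⟨j, hj, h⟩ := exists_pow_eq_inv hK hρ hdual hθ0 hθ
  have hfix : FiniteField.frobeniusAlgHom K L ^ (2 * j + 1) = 1 := by
    refine AlgHom.ext_of_adjoin_eq_top hadj fun x hx => ?_
    rw [Set.mem_singleton_iff.1 hx, AlgHom.coe_pow, FiniteField.coe_frobeniusAlgHom, pow_iterate,
      ← Nat.card_eq_fintype_card, hK, AlgHom.one_apply, pow_right_comm, sq]
    change θ ^ (_ * _) = θ
    rw [pow_mul, h, inv_pow, h, inv_inv]
  have hdvd := orderOf_dvd_of_pow_eq_one hfix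
  rw [FiniteField.orderOf_frobeniusAlgHom] at hdvd
  have hd : Module.finrank K L = 2 * j + 1 := by
    obtain ⟨c, hc⟩ := hdvd
    obtain rfl | rfl | hc2 : c = 0 ∨ c = 1 ∨ 2 ≤ c := by omega
    · omega
    · rw [hc, mul_one]
    · nlinarith
  exact ⟨⟨j, hd⟩, hd ▸ h⟩

theorem trace_iterateFrobenius {a b : ℕ} (h : ∀ c : K, iterateFrobenius L p b (algebraMap K L c) =
    algebraMap K L (iterateFrobenius K p a c)) (x : L) :
    Algebra.trace K L (iterateFrobenius L p b x) =
      iterateFrobenius K p a (Algebra.trace K L x) := by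
  have htr := Algebra.trace_eq_of_equiv_equiv (iterateFrobeniusEquiv K p a)
    (iterateFrobeniusEquiv L p b) (RingHom.ext fun c => (h c).symm) x
  rw [htr]
  exact ((iterateFrobeniusEquiv K p a).apply_symm_apply _).symm

end SelfDualRoot

section SelfDual

theorem eqEuler_isotropicSubspaces_eq_unitaryGroup (r : ℕ) {L W : Type*} [Field L] [Finite L]
    [AddCommGroup W] [Module L W] [FiniteDimensional L W] {p e m : ℕ} [Fact p.Prime] [CharP L p]
    (he : 0 < e) (hL : Nat.card L = (p ^ e) ^ 2)
    {H : W →ₗ[L] W →ₛₗ[iterateFrobenius L p e] L} (hH : IsHermitian H) (hnd : H.SeparatingLeft)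
    (hm : Module.finrank L W = m) :
    eqEuler r (isometryGroup H) (isotropicSubspaces H) =
      eqEuler r (unitaryGroup L (p ^ e) m) (isotropicPoset L (p ^ e) m) := by
  obtain ⟨T, hT⟩ := hH.exists_isometry hnd (isHermitian_hermSesq m he hL)
    (separatingLeft_hermSesq m he hL) (Nat.one_lt_pow he.ne' (Fact.out : p.Prime).one_lt) hL
    (iterateFrobenius_def p e) (hm.trans (Module.finrank_fin_fun L).symm)
  refine eqEuler_congr_linearEquiv r T (fun φ => ?_) fun U => ?_
  · change (∀ u v, H (φ u) (φ v) = H u v) ↔ ∀ u v, hermSesq L p e m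
      (T (φ (T.symm u))) (T (φ (T.symm v))) = hermSesq L p e m u v
    simp [T.surjective.forall, hT]
  · refine and_congr (Submodule.map_eq_bot_iff (p := U) (e := T)).symm.not ?_
    change IsIsotropic H U ↔ IsIsotropic (hermSesq L p e m) _
    simp [IsIsotropic, T.surjective.forall, hT]

variable {K V : Type*} [Field K] [Finite K] {p k : ℕ} [Fact p.Prime] [CharP K p]
  [AddCommGroup V] [Module K V] [Finite V] {ρ : K[X]}
  {B : V →ₗ[K] V →ₛₗ[iterateFrobenius K p k] K} {g : Module.End K V}

theorem isoEuler_selfDual (r : ℕ) (hk : 0 < k) (hK : Nat.card K = (p ^ k) ^ 2)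
    (hB : IsHermitian B) (hnd : B.SeparatingLeft) (hg : ∀ u v, B (g u) (g v) = B u v)
    (hρ : Irreducible ρ) (hρ0 : ρ.coeff 0 ≠ 0)
    (hdual : dualPoly (iterateFrobenius K p k) ρ = ρ) (hgρ : aeval g ρ = 0) {m : ℕ}
    (hm : Module.finrank K V = m * ρ.natDegree) :
    isoEuler r B g = -chiGU p (k * ρ.natDegree) m r := by
  have hN : p ^ (2 * (k * ρ.natDegree)) = Nat.card K ^ ρ.natDegree := by
    rw [hK, ← pow_mul, ← pow_mul, mul_left_comm]
  obtain ⟨_, _, _, θ, hθ, hadj, hd, hθg⟩ := exists_galoisField_module hρ hN hgρ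
  have hL : Nat.card (GaloisField p (2 * (k * ρ.natDegree))) = (p ^ (k * ρ.natDegree)) ^ 2 := by
    rw [Module.natCard_eq_pow_finrank (K := K), hd, ← hN, mul_comm, pow_mul]
  have hθ0 : θ ≠ 0 := by
    rintro rfl
    rw [← coeff_zero_eq_aeval_zero', map_eq_zero] at hθ
    exact hρ0 hθ
  obtain ⟨hodd, hinv⟩ := odd_finrank_and_pow_eq_inv hK hρ hdual hθ0 hθ hadj
  rw [hd] at hodd hinv
  have hτ := iterateFrobenius_algebraMap_of_odd (L := GaloisField p (2 * (k * ρ.natDegree)))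
    hK hodd
  have hBθ : ∀ u v, B (θ • u) v =
      B u (iterateFrobenius (GaloisField p (2 * (k * ρ.natDegree))) p (k * ρ.natDegree) θ • v) :=
    fun u v => by
      rw [iterateFrobenius_def, pow_mul, hinv, ← hg u, ← hθg, ← hθg, smul_inv_smul₀ hθ0]
  obtain ⟨H, hH, hHB⟩ := hB.exists_trace_eq (iterateFrobenius_involutive hL)
    (trace_iterateFrobenius hτ)
    (apply_smul_of_adjoin_eq_top hadj (iterateFrobenius_involutive hK) hτ hBθ)
  have hHnd : H.SeparatingLeft := fun u hu => hnd u fun v => by rw [← hHB, hu, map_zero]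
  have : FiniteDimensional (GaloisField p (2 * (k * ρ.natDegree))) V := Module.Finite.of_finite
  have hdim : Module.finrank (GaloisField p (2 * (k * ρ.natDegree))) V = m := by
    have h := Module.finrank_mul_finrank K (GaloisField p (2 * (k * ρ.natDegree))) V
    rw [hm, hd, mul_comm m] at h
    exact Nat.eq_of_mul_eq_mul_left hρ.natDegree_pos h
  rw [isoEuler_eq_neg_eqEuler r hadj hθg hHB, eqEuler_isotropicSubspaces_eq_unitaryGroup r
    (Nat.mul_pos hk hρ.natDegree_pos) hL hH hHnd hdim]
  rfl

end SelfDual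

section Linear

/-- The nonzero proper subspaces that the endomorphism `g` maps into themselves. -/
def properInvariant {K V : Type*} [Field K] [AddCommGroup V] [Module K V] (g : Module.End K V) :
    Set (Submodule K V) :=
  {U | (∀ x ∈ U, g x ∈ U) ∧ U ≠ ⊥ ∧ U ≠ ⊤}

variable {K V : Type*} [Field K] [Finite K] {p N : ℕ} [Fact p.Prime] [CharP K p]
  [AddCommGroup V] [Module K V] [Finite V]

theorem eqEuler_commutingEquivs (r : ℕ) {s : K[X]} (hs : Irreducible s)
    (hN : p ^ N = Nat.card K ^ s.natDegree) {g : Module.End K V} (hg : aeval g s = 0) {m : ℕ}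
    (hm : Module.finrank K V = m * s.natDegree) :
    eqEuler r (commutingEquivs g) (properInvariant g) = chiGL p N m r := by
  obtain ⟨_, _, _, θ, -, hadj, hd, hθg⟩ := exists_galoisField_module hs hN hg
  have : FiniteDimensional (GaloisField p N) V := Module.Finite.of_finite
  have hdim : Module.finrank (GaloisField p N) V = m := by
    have h := Module.finrank_mul_finrank K (GaloisField p N) V
    rw [hm, hd, mul_comm m] at h
    exact Nat.eq_of_mul_eq_mul_left hs.natDegree_pos h
  let T : V ≃ₗ[GaloisField p N] (Fin m → GaloisField p N) :=
    LinearEquiv.ofFinrankEq _ _ (hdim.trans (Module.finrank_fin_fun _).symm)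
  have hrestr : eqEuler r (⊤ : Subgroup (V ≃ₗ[GaloisField p N] V))
      {U : Submodule (GaloisField p N) V | U ≠ ⊥ ∧ U ≠ ⊤} =
      eqEuler r (commutingEquivs g) (properInvariant g) := by
    refine eqEuler_restrictScalars r hadj (fun φ => (iff_of_true trivial fun v => ?_))
      (fun φ hφ v => ?_) (fun U => ?_) fun U hU x hx => ?_
    · rw [← hθg, ← hθg]
      exact φ.map_smul θ v
    · rw [hθg, hθg, hφ]
    · refine Iff.trans (and_congr (Submodule.restrictScalars_eq_bot_iff ..).symm.not
        (Submodule.restrictScalars_eq_top_iff ..).symm.not) (and_iff_right fun x hx => ?_).symm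
      rw [← hθg]
      exact U.smul_mem θ hx
    · rw [hθg]
      exact hU.1 x hx
  rw [← hrestr]
  exact eqEuler_congr_linearEquiv r T (fun _ => iff_of_true trivial trivial) fun U =>
    and_congr (Submodule.map_eq_bot_iff (p := U) (e := T)).symm.not
      (Submodule.map_eq_top_iff (p := U) (e := T)).symm.not

end Linear

section HyperbolicPair

variable {K V : Type*} [Field K] [AddCommGroup V] [Module K V] {σ : K →+* K}
  {B : V →ₗ[K] V →ₛₗ[σ] K} {W W' : Submodule K V}

theorem apply_eq_add_projectionOnto (hW : IsIsotropic B W) (hW' : IsIsotropic B W')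
    (hc : IsCompl W W') (x y : V) :
    B x y = B (W.projectionOnto W' hc x) y + B x (W.projectionOnto W' hc y) := by
  have hmem : ∀ v, v - (W.projectionOnto W' hc v : V) ∈ W' := fun v => by
    rw [← Submodule.projectionOnto_apply_eq_zero_iff hc, map_sub,
      Submodule.projectionOnto_apply_left, sub_self]
  have h := hW' _ (hmem x) _ (hmem y)
  rw [map_sub, map_sub, LinearMap.sub_apply, LinearMap.sub_apply,
    hW _ (Subtype.prop _) _ (Subtype.prop _)] at h
  linear_combination h

theorem eq_zero_of_isIsotropic_isCompl (hB : B.IsRefl) (hnd : B.SeparatingLeft)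
    (hW : IsIsotropic B W) (hW' : IsIsotropic B W') (hc : IsCompl W W') {x : V} (hx : x ∈ W')
    (h : ∀ w ∈ W, B w x = 0) : x = 0 :=
  hnd x fun y => hB _ _ <| by
    rw [apply_eq_add_projectionOnto hW hW' hc, h _ (Subtype.prop _),
      Submodule.projectionOnto_apply_of_mem_right hc hx, Submodule.coe_zero, map_zero, add_zero]

variable (B) in
/-- The subspace `A + (W' ⊓ Cᗮ)` attached to two subspaces `A` and `C` of `W`, where the ambient
space is the direct sum of `W` and `W'`. When these are totally isotropic, its totally isotropic
subspaces that split along the sum correspond to the intervals `[A, C]` of subspaces of `W`. -/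
def intervalSubspace (hc : IsCompl W W') (A C : Submodule K W) : Submodule K V :=
  A.comap (W.projectionOnto W' hc) ⊓ (C.map W.subtype).orthogonalBilin B

theorem mem_intervalSubspace {hc : IsCompl W W'} {A C : Submodule K W} {x : V} :
    x ∈ intervalSubspace B hc A C ↔ W.projectionOnto W' hc x ∈ A ∧ ∀ c ∈ C, B (c : V) x = 0 :=
  and_congr_right' ⟨fun h c hc => h _ ⟨c, hc, rfl⟩, by rintro h _ ⟨c, hc, rfl⟩; exact h c hc⟩

theorem isIsotropic_intervalSubspace (hB : B.IsRefl) (hW : IsIsotropic B W)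
    (hW' : IsIsotropic B W') (hc : IsCompl W W') {A C : Submodule K W} (hAC : A ≤ C) :
    IsIsotropic B (intervalSubspace B hc A C) := fun x hx y hy => by
  rw [mem_intervalSubspace] at hx hy
  rw [apply_eq_add_projectionOnto hW hW' hc, hy.2 _ (hAC hx.1), hB _ _ (hx.2 _ (hAC hy.1)),
    add_zero]

theorem intervalSubspace_bot_top (hB : B.IsRefl) (hnd : B.SeparatingLeft) (hW : IsIsotropic B W)
    (hW' : IsIsotropic B W') (hc : IsCompl W W') : intervalSubspace B hc ⊥ ⊤ = ⊥ := by
  refine (Submodule.eq_bot_iff _).2 fun x hx => ?_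
  rw [mem_intervalSubspace] at hx
  exact eq_zero_of_isIsotropic_isCompl hB hnd hW hW' hc
    ((Submodule.projectionOnto_apply_eq_zero_iff hc).1 hx.1) fun w hw => hx.2 ⟨w, hw⟩ trivial

theorem mapsTo_orthogonalBilin [FiniteDimensional K V] (hnd : B.SeparatingLeft)
    {φ : Module.End K V} (hφ : ∀ u v, B (φ u) (φ v) = B u v) {U : Submodule K V}
    (hU : ∀ x ∈ U, φ x ∈ U) : ∀ x ∈ U.orthogonalBilin B, φ x ∈ U.orthogonalBilin B := by
  intro x hx u hu
  have hsurj : Function.Surjective (φ.restrict hU) := LinearMap.injective_iff_surjective.1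
    fun a b h => Subtype.ext (injective_of_isometry hnd hφ (congrArg Subtype.val h))
  obtain ⟨⟨u', hu'⟩, h⟩ := hsurj ⟨u, hu⟩
  have h' : φ u' = u := congrArg Subtype.val h
  rw [← h']
  exact (hφ u' x).trans (hx u' hu')

theorem mapsTo_intervalSubspace [FiniteDimensional K V] (hnd : B.SeparatingLeft)
    {hc : IsCompl W W'} {φ : Module.End K V} {ψ : Module.End K W}
    (hφ : ∀ u v, B (φ u) (φ v) = B u v) (hφψ : ∀ w : W, φ w = ψ w)
    (hcomm : ∀ v, W.projectionOnto W' hc (φ v) = ψ (W.projectionOnto W' hc v))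
    {A C : Submodule K W} (hA : ∀ x ∈ A, ψ x ∈ A) (hC : ∀ x ∈ C, ψ x ∈ C) :
    ∀ x ∈ intervalSubspace B hc A C, φ x ∈ intervalSubspace B hc A C := by
  refine fun x hx => ⟨?_, mapsTo_orthogonalBilin hnd hφ ?_ x hx.2⟩
  · exact (congrArg (· ∈ A) (hcomm x)).mpr (hA _ hx.1)
  · rintro _ ⟨c, hcC, rfl⟩
    exact ⟨ψ c, hC c hcC, (hφψ c).symm⟩

variable [Finite K] [FiniteDimensional K V]

theorem orthogonalBilin_orthogonalBilin (hB : B.IsRefl) (hnd : B.SeparatingLeft)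
    (U : Submodule K V) : (U.orthogonalBilin B).orthogonalBilin B = U := by
  have hle : U ≤ (U.orthogonalBilin B).orthogonalBilin B := fun u hu v hv => hB _ _ (hv u hu)
  refine (Submodule.eq_of_le_of_finrank_eq hle ?_).symm
  have h := finrank_add_finrank_orthogonalBilin hB hnd U
  rw [← finrank_add_finrank_orthogonalBilin hB hnd (U.orthogonalBilin B), add_comm] at h
  exact Nat.add_left_cancel h

theorem intervalSubspace_le_iff (hB : B.IsRefl) (hnd : B.SeparatingLeft) (hW : IsIsotropic B W)
    {hc : IsCompl W W'} {A C A' C' : Submodule K W} :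
    intervalSubspace B hc A C ≤ intervalSubspace B hc A' C' ↔ A ≤ A' ∧ C' ≤ C := by
  refine ⟨fun h => ⟨fun a ha => ?_, fun c hcC => ?_⟩, fun ⟨hA, hC⟩ x hx => ?_⟩
  · have ha' : (a : V) ∈ intervalSubspace B hc A C := mem_intervalSubspace.2
      ⟨by rwa [Submodule.projectionOnto_apply_left], fun c _ => hW _ c.2 _ a.2⟩
    simpa only [Submodule.projectionOnto_apply_left] using (mem_intervalSubspace.1 (h ha')).1
  · suffices (c : V) ∈ ((C.map W.subtype).orthogonalBilin B).orthogonalBilin B by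
      rw [orthogonalBilin_orthogonalBilin hB hnd] at this
      obtain ⟨c', hc', h'⟩ := this
      exact Subtype.ext h' ▸ hc'
    intro v hv
    have hsub : ∀ w : W, B (w : V) (v - (W.projectionOnto W' hc v : V)) = B (w : V) v := fun w => by
      rw [map_sub, hW _ w.2 _ (Subtype.prop _), sub_zero]
    have hmem : v - (W.projectionOnto W' hc v : V) ∈ intervalSubspace B hc A C := by
      refine mem_intervalSubspace.2 ⟨?_, fun c' hc' => (hsub c').trans (hv _ ⟨c', hc', rfl⟩)⟩
      rw [map_sub, Submodule.projectionOnto_apply_left, sub_self]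
      exact A.zero_mem
    exact hB _ _ ((hsub c).symm.trans ((mem_intervalSubspace.1 (h hmem)).2 c hcC))
  · rw [mem_intervalSubspace] at hx ⊢
    exact ⟨hA hx.1, fun c hc => hx.2 c (hC hc)⟩

theorem intervalSubspace_comap_subtype (hB : B.IsRefl) (hnd : B.SeparatingLeft)
    (hW : IsIsotropic B W) (hW' : IsIsotropic B W') (hc : IsCompl W W') {U : Submodule K V}
    (hU : ∀ x ∈ U, (W.projectionOnto W' hc x : V) ∈ U) :
    intervalSubspace B hc (U.comap W.subtype) ((U.orthogonalBilin B).comap W.subtype) = U := by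
  have hpol := apply_eq_add_projectionOnto hW hW' hc
  ext x
  rw [mem_intervalSubspace]
  refine ⟨fun ⟨hx, hx'⟩ => ?_, fun hx => ⟨hU x hx, fun c hcU => hB _ _ (hcU x hx)⟩⟩
  rw [← orthogonalBilin_orthogonalBilin hB hnd U]
  intro v hv
  refine (hpol v x).trans ?_
  have hvx : B v (W.projectionOnto W' hc x : V) = 0 := hB _ _ (hv _ hx)
  rw [hvx, add_zero]
  refine hx' _ fun u hu => ?_
  have h := hpol u v
  rw [show B u v = 0 from hv u hu, show B _ v = 0 from hv _ (hU u hu), zero_add] at h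
  exact h.symm

/-- The subspaces of `W` that every member of a family of endomorphisms maps into themselves. -/
abbrev StableSubmodule {ι : Type*} (ψ : ι → Module.End K W) : Type _ :=
  {A : Submodule K W // ∀ i, ∀ x ∈ A, ψ i x ∈ A}

instance {ι : Type*} (ψ : ι → Module.End K W) : BoundedOrder (StableSubmodule ψ) :=
  Subtype.boundedOrder (fun i x hx => by
    rw [Submodule.mem_bot] at hx ⊢
    rw [hx, map_zero]) fun _ _ _ => trivial

variable {ι : Type*} {φ : ι → Module.End K V} {ψ : ι → Module.End K W}

/-- The assignment of `intervalSubspace` to an interval of stable subspaces of `W`; it reverses the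
inclusion of intervals. -/
def intervalEmbedding (hB : B.IsRefl) (hnd : B.SeparatingLeft) (hW : IsIsotropic B W)
    (hc : IsCompl W W') : (NonemptyInterval (StableSubmodule ψ))ᵒᵈ ↪o Submodule K V :=
  OrderEmbedding.ofMapLEIff
    (fun I => intervalSubspace B hc (OrderDual.ofDual I).fst.1 (OrderDual.ofDual I).snd.1)
    fun _ _ => intervalSubspace_le_iff hB hnd hW

theorem image_intervalEmbedding (hB : B.IsRefl) (hnd : B.SeparatingLeft)
    (hW : IsIsotropic B W) (hW' : IsIsotropic B W') (hc : IsCompl W W')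
    (hφ : ∀ i u v, B (φ i u) (φ i v) = B u v) (hφψ : ∀ i (w : W), φ i w = ψ i w)
    (hcomm : ∀ i v, W.projectionOnto W' hc (φ i v) = ψ i (W.projectionOnto W' hc v))
    (hstab : ∀ U : Submodule K V, (∀ i, ∀ x ∈ U, φ i x ∈ U) →
      ∀ x ∈ U, (W.projectionOnto W' hc x : V) ∈ U) :
    intervalEmbedding (ψ := ψ) hB hnd hW hc '' {I | I ≠ ⊥} =
      {U | IsIsotropic B U ∧ (∀ i, ∀ x ∈ U, φ i x ∈ U) ∧ U ≠ ⊥} := by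
  ext U
  constructor
  · rintro ⟨I, hI, rfl⟩
    obtain ⟨⟨⟨A, C⟩, hAC⟩, rfl⟩ := OrderDual.toDual.surjective I
    refine ⟨isIsotropic_intervalSubspace hB hW hW' hc hAC, fun i =>
      mapsTo_intervalSubspace hnd (hφ i) (hφψ i) (hcomm i) (A.2 i) (C.2 i), fun h => hI ?_⟩
    rw [← intervalSubspace_bot_top hB hnd hW hW' hc] at h
    obtain ⟨hA, hC⟩ := (intervalSubspace_le_iff hB hnd hW).1 h.le
    exact congrArg OrderDual.toDual (NonemptyInterval.ext
      (Prod.ext (Subtype.ext (le_bot_iff.1 hA)) (Subtype.ext (top_le_iff.1 hC))))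
  · rintro ⟨hU, hUφ, hU0⟩
    have heq := intervalSubspace_comap_subtype hB hnd hW hW' hc (hstab U hUφ)
    refine ⟨OrderDual.toDual ⟨(⟨U.comap W.subtype, fun i x hx => ?_⟩,
      ⟨(U.orthogonalBilin B).comap W.subtype, fun i x hx => ?_⟩),
      fun x hx u hu => hU u hu _ hx⟩, fun h => hU0 ?_, heq⟩
    · exact (congrArg (· ∈ U) (hφψ i x)).mp (hUφ i _ hx)
    · exact (congrArg (· ∈ U.orthogonalBilin B) (hφψ i x)).mp
        (mapsTo_orthogonalBilin hnd (hφ i) (hUφ i) _ hx)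
    · exact heq.symm.trans ((congrArg (intervalEmbedding hB hnd hW hc) h).trans
        (intervalSubspace_bot_top hB hnd hW hW' hc))

theorem neg_redEuler_isotropic [Nontrivial W] (hB : B.IsRefl) (hnd : B.SeparatingLeft)
    (hW : IsIsotropic B W) (hW' : IsIsotropic B W') (hc : IsCompl W W')
    (hφ : ∀ i u v, B (φ i u) (φ i v) = B u v) (hφψ : ∀ i (w : W), φ i w = ψ i w)
    (hcomm : ∀ i v, W.projectionOnto W' hc (φ i v) = ψ i (W.projectionOnto W' hc v))
    (hstab : ∀ U : Submodule K V, (∀ i, ∀ x ∈ U, φ i x ∈ U) →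
      ∀ x ∈ U, (W.projectionOnto W' hc x : V) ∈ U) :
    -redEuler {U | IsIsotropic B U ∧ (∀ i, ∀ x ∈ U, φ i x ∈ U) ∧ U ≠ ⊥} =
      redEuler {A : Submodule K W | (∀ i, ∀ x ∈ A, ψ i x ∈ A) ∧ A ≠ ⊥ ∧ A ≠ ⊤} := by
  have : Finite W := Module.finite_of_finite K
  have : Nontrivial (StableSubmodule ψ) :=
    ⟨⊥, ⊤, fun h => bot_ne_top (α := Submodule K W) (congrArg Subtype.val h)⟩
  rw [← image_intervalEmbedding hB hnd hW hW' hc hφ hφψ hcomm hstab, redEuler_image,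
    neg_redEuler_interval, ← redEuler_image (OrderEmbedding.subtype _)]
  congr 1
  ext A
  constructor
  · rintro ⟨A, ⟨hA, hA'⟩, rfl⟩
    exact ⟨A.2, fun h => hA (Subtype.ext h), fun h => hA' (Subtype.ext h)⟩
  · rintro ⟨hA, h, h'⟩
    exact ⟨⟨A, hA⟩, ⟨fun e => h (congrArg Subtype.val e), fun e => h' (congrArg Subtype.val e)⟩,
      rfl⟩

end HyperbolicPair

section HyperbolicIsometries

variable {K V : Type*} [Field K] [AddCommGroup V] [Module K V] {σ : K →+* K}
  {B : V →ₗ[K] V →ₛₗ[σ] K} {W W' : Submodule K V}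

theorem fixedIn_invariantIsotropic_ne_bot [FiniteDimensional K V] {g : Module.End K V}
    (A : Subgroup (commutingIsometries B g)) :
    fixedIn A {U | U ∈ invariantIsotropic B g ∧ U ≠ ⊥} =
      {U | IsIsotropic B U ∧
        (∀ i : Option A, ∀ x ∈ U, i.elim g (fun a => a.1.1.toLinearMap) x ∈ U) ∧ U ≠ ⊥} := by
  ext U
  rw [Set.mem_ofPred_eq, Option.forall]
  exact ⟨fun ⟨⟨⟨hU, hUg⟩, h0⟩, hUA⟩ => ⟨hU, ⟨hUg, fun a => smul_eq_self_iff.1 (hUA a.1 a.2)⟩, h0⟩,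
    fun ⟨hU, ⟨hUg, hUA⟩, h0⟩ => ⟨⟨⟨hU, hUg⟩, h0⟩, fun a ha => smul_eq_self_iff.2 (hUA ⟨a, ha⟩)⟩⟩

theorem eq_of_isometry_of_eqOn (hB : B.IsRefl) (hnd : B.SeparatingLeft) (hW : IsIsotropic B W)
    (hW' : IsIsotropic B W') (hc : IsCompl W W') {f f' : Module.End K V}
    (hf : ∀ u v, B (f u) (f v) = B u v) (hf' : ∀ u v, B (f' u) (f' v) = B u v)
    (hff' : ∀ w ∈ W, f w = f' w)
    (hproj : ∀ v, W.projectionOnto W' hc (f v) = W.projectionOnto W' hc (f' v))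
    (hsurj : ∀ w ∈ W, ∃ w₀ ∈ W, f w₀ = w) : f = f' := by
  ext v
  rw [← sub_eq_zero]
  refine eq_zero_of_isIsotropic_isCompl hB hnd hW hW' hc
    ((Submodule.projectionOnto_apply_eq_zero_iff hc).1 (by rw [map_sub, hproj, sub_self]))
    fun w hw => ?_
  obtain ⟨w₀, hw₀, rfl⟩ := hsurj w hw
  rw [map_sub, hf, hff' w₀ hw₀, hf', sub_self]

theorem projectionOnto_apply_comm {hc : IsCompl W W'} {g φ : Module.End K V} {E : K[X]}
    (hE : ∀ v, aeval g E v = (W.projectionOnto W' hc v : V)) (hφ : ∀ v, φ (g v) = g (φ v))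
    (v : V) : (W.projectionOnto W' hc (φ v) : V) = φ (W.projectionOnto W' hc v) := by
  rw [← hE, ← hE, map_aeval_apply φ hφ]

theorem mapsTo_of_projectionOnto_apply_comm {hc : IsCompl W W'} {φ : Module.End K V}
    (hφ : ∀ v, (W.projectionOnto W' hc (φ v) : V) = φ (W.projectionOnto W' hc v)) :
    ∀ w ∈ W, φ w ∈ W := fun w hw => by
  have h := hφ w
  rw [Submodule.projectionOnto_apply_of_mem_left hc hw] at h
  exact h ▸ Subtype.prop _

variable [Finite K] [FiniteDimensional K V]

theorem exists_adjoint (hB : B.IsRefl) (hnd : B.SeparatingLeft) (N : Module.End K V) :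
    ∃ N' : Module.End K V, ∀ x y, B x (N' y) = B (N x) y := by
  have hflip := bijective_flip hB hnd
  choose N' hN' using fun y => hflip.surjective ((B.flip y).comp N)
  have hN'B : ∀ x y, B x (N' y) = B (N x) y := fun x y => LinearMap.congr_fun (hN' y) x
  refine ⟨{ toFun := N', map_add' := fun y z => ?_, map_smul' := fun c y => ?_ }, hN'B⟩ <;>
    refine hflip.injective (LinearMap.ext fun x => ?_)
  · simp only [LinearMap.flip_apply, LinearMap.add_apply, map_add, hN'B]
  · simp only [LinearMap.flip_apply, LinearMap.smul_apply, LinearMap.map_smulₛₗ,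
      RingHom.id_apply, hN'B]

/-- The extension is `ψ` on `W` and the inverse of its adjoint on `W'`. -/
theorem exists_isometry_extending (hB : IsHermitian B) (hnd : B.SeparatingLeft)
    (hW : IsIsotropic B W) (hW' : IsIsotropic B W') (hc : IsCompl W W') (ψ : W ≃ₗ[K] W) :
    ∃ φ ∈ isometryGroup B, (∀ w : W, φ w = ψ w) ∧
      ∀ v, W.projectionOnto W' hc (φ v) = ψ (W.projectionOnto W' hc v) := by
  set π := W.projectionOnto W' hc
  have hπ : ∀ w : W, π w = w := Submodule.projectionOnto_apply_left hc
  have hpol : ∀ x y, B x y = B (π x) y + B x (π y) := apply_eq_add_projectionOnto hW hW' hc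
  have hright : ∀ v, (∀ u, B u v = 0) → v = 0 := fun v h => hnd v fun u => hB.isRefl _ _ (h u)
  obtain ⟨M, hM⟩ := exists_adjoint hB.isRefl hnd (W.subtype ∘ₗ ψ.symm.toLinearMap ∘ₗ π)
  replace hM : ∀ x y, B x (M y) = B (ψ.symm (π x)) y := hM
  have hMW : ∀ w : W, M w = 0 := fun w => hright _ fun u => by
    rw [hM, hW _ (Subtype.prop _) _ w.2]
  have hπM : ∀ v, π (M v) = 0 := fun v => Subtype.ext <| hright _ fun u => by
    have h := hpol u (M v)
    rw [hM, hM, hπ] at h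
    exact left_eq_add.1 h
  have hMM : ∀ u v, B (M u) (M v) = 0 := fun u v => by
    rw [hpol, hπM, hπM, Submodule.coe_zero, map_zero, map_zero, LinearMap.zero_apply, add_zero]
  have hψM : ∀ u v, B (ψ (π u)) (M v) = B (π u) v := fun u v => by
    rw [hM, hπ, ψ.symm_apply_apply]
  let φ : Module.End K V := W.subtype ∘ₗ ψ.toLinearMap ∘ₗ π + M
  have hφ : ∀ v, φ v = ψ (π v) + M v := fun _ => rfl
  have hφB : ∀ u v, B (φ u) (φ v) = B u v := fun u v => by
    have hMψ : B (M u) (ψ (π v)) = B u (π v) := by rw [← hB, hψM, hB]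
    rw [hφ, hφ, map_add, map_add, LinearMap.add_apply, LinearMap.add_apply, hMM, hψM,
      hMψ, hW _ (Subtype.prop _) _ (Subtype.prop _), zero_add, add_zero,
      add_comm, ← hpol]
  refine ⟨LinearEquiv.ofInjectiveEndo φ (injective_of_isometry hnd hφB), hφB, fun w => ?_,
    fun v => ?_⟩
  · change φ w = _
    rw [hφ, hMW, hπ, add_zero]
  · change π (φ v) = _
    rw [hφ, map_add, hπM, hπ, add_zero]

variable {g : Module.End K V} {E : K[X]}

theorem exists_commutingIsometry_extending (hB : IsHermitian B) (hnd : B.SeparatingLeft)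
    (hW : IsIsotropic B W) (hW' : IsIsotropic B W') (hc : IsCompl W W')
    (hg : ∀ u v, B (g u) (g v) = B u v) (hgW : ∀ w ∈ W, g w ∈ W)
    (hE : ∀ v, aeval g E v = (W.projectionOnto W' hc v : V)) {ψ : W ≃ₗ[K] W}
    (hψ : ψ ∈ commutingEquivs (g.restrict hgW)) :
    ∃ φ ∈ commutingIsometries B g, ∀ w : W, φ w = ψ w := by
  obtain ⟨φ, hφ, hφψ, hπφ⟩ := exists_isometry_extending hB hnd hW hW' hc ψ
  have hπg : ∀ v, W.projectionOnto W' hc (g v) = g.restrict hgW (W.projectionOnto W' hc v) :=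
    fun v => Subtype.ext (projectionOnto_apply_comm hE (fun _ => rfl) v)
  have hgsurj : Function.Surjective (g.restrict hgW) := LinearMap.injective_iff_surjective.1
    fun a b h => Subtype.ext (injective_of_isometry hnd hg (congrArg Subtype.val h))
  have hφg : ∀ w : W, φ (g w) = g (φ w) := fun w => by
    rw [hφψ]
    exact (hφψ (g.restrict hgW w)).trans (congrArg Subtype.val (hψ w))
  have key : φ.toLinearMap ∘ₗ g = g ∘ₗ φ.toLinearMap := by
    refine eq_of_isometry_of_eqOn hB.isRefl hnd hW hW' hc (fun u v => (hφ _ _).trans (hg u v))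
      (fun u v => (hg _ _).trans (hφ u v)) (fun w hw => hφg ⟨w, hw⟩) (fun v => ?_) fun w hw => ?_
    · exact (hπφ _).trans ((congrArg ψ (hπg v)).trans ((hψ _).trans
        ((congrArg _ (hπφ v).symm).trans (hπg _).symm)))
    · obtain ⟨w₀, hw₀⟩ := hgsurj (ψ.symm ⟨w, hw⟩)
      refine ⟨w₀, w₀.2, (hφψ (g.restrict hgW w₀)).trans ?_⟩
      rw [hw₀, ψ.apply_symm_apply]
  exact ⟨φ, ⟨hφ, LinearMap.congr_fun key⟩, hφψ⟩

theorem exists_mulEquiv_commutingEquivs (hB : IsHermitian B) (hnd : B.SeparatingLeft)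
    (hW : IsIsotropic B W) (hW' : IsIsotropic B W') (hc : IsCompl W W')
    (hg : ∀ u v, B (g u) (g v) = B u v) (hgW : ∀ w ∈ W, g w ∈ W)
    (hE : ∀ v, aeval g E v = (W.projectionOnto W' hc v : V)) :
    ∃ e : commutingIsometries B g ≃* commutingEquivs (g.restrict hgW),
      ∀ φ (w : W), ((e φ).1 w : V) = φ.1 w := by
  have hcomm : ∀ φ : commutingIsometries B g, ∀ v,
      (W.projectionOnto W' hc (φ.1 v) : V) = φ.1 (W.projectionOnto W' hc v) := fun φ =>
    projectionOnto_apply_comm (φ := φ.1.toLinearMap) hE φ.2.2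
  have hmap : ∀ φ : commutingIsometries B g, W.map (φ.1 : V →ₗ[K] V) = W := fun φ =>
    smul_eq_self_iff.2 (mapsTo_of_projectionOnto_apply_comm (φ := φ.1.toLinearMap) (hcomm φ))
  let R : commutingIsometries B g →* commutingEquivs (g.restrict hgW) :=
    MonoidHom.mk' (fun φ => ⟨φ.1.ofSubmodules W W (hmap φ), fun v => Subtype.ext (φ.2.2 v)⟩)
      fun _ _ => rfl
  have hR : ∀ φ (w : W), ((R φ).1 w : V) = φ.1 w := fun _ _ => rfl
  refine ⟨MulEquiv.ofBijective R ⟨(injective_iff_map_eq_one R).2 fun φ hφ => ?_, ?_⟩, hR⟩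
  · have hfix : ∀ w : W, φ.1 w = w := fun w => by rw [← hR, hφ]; rfl
    refine Subtype.ext (LinearEquiv.toLinearMap_injective ?_)
    exact eq_of_isometry_of_eqOn hB.isRefl hnd hW hW' hc φ.2.1 (fun _ _ => rfl)
      (fun w hw => hfix ⟨w, hw⟩) (fun v => Subtype.ext ((hcomm φ v).trans (hfix _)))
      fun w hw => ⟨w, hw, hfix ⟨w, hw⟩⟩
  · rintro ⟨ψ, hψ⟩
    obtain ⟨φ, hφ, h⟩ := exists_commutingIsometry_extending hB hnd hW hW' hc hg hgW hE hψ
    exact ⟨⟨φ, hφ⟩, Subtype.ext (LinearEquiv.ext fun w => Subtype.ext (h w))⟩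

theorem isoEuler_hyperbolic [Nontrivial W] (r : ℕ) (hB : IsHermitian B) (hnd : B.SeparatingLeft)
    (hW : IsIsotropic B W) (hW' : IsIsotropic B W') (hc : IsCompl W W')
    (hg : ∀ u v, B (g u) (g v) = B u v) (hgW : ∀ w ∈ W, g w ∈ W)
    (hE : ∀ v, aeval g E v = (W.projectionOnto W' hc v : V)) :
    isoEuler r B g = eqEuler r (commutingEquivs (g.restrict hgW))
      (properInvariant (g.restrict hgW)) := by
  obtain ⟨e, he⟩ := exists_mulEquiv_commutingEquivs hB hnd hW hW' hc hg hgW hE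
  suffices h : ∀ A, redEuler (fixedIn A {U | U ∈ invariantIsotropic B g ∧ U ≠ ⊥}) =
      -1 * redEuler (fixedIn (A.map e.toMonoidHom) (properInvariant (g.restrict hgW))) by
    rw [isoEuler, eqEuler_eq_mul r e (-1) h, Int.cast_neg, Int.cast_one, neg_one_mul, neg_neg]
  intro A
  let φ : Option A → Module.End K V := fun i => i.elim g fun a => a.1.1.toLinearMap
  let ψ : Option A → Module.End K W := fun i =>
    i.elim (g.restrict hgW) fun a => (e a.1).1.toLinearMap
  have hE' : ∀ i v, (W.projectionOnto W' hc (φ i v) : V) = φ i (W.projectionOnto W' hc v) :=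
    Option.rec (projectionOnto_apply_comm hE fun _ => rfl)
      fun a => projectionOnto_apply_comm hE a.1.2.2
  have hφψ : ∀ i (w : W), φ i w = ψ i w :=
    Option.rec (fun _ => rfl) fun a w => (he a.1 w).symm
  have hP' : fixedIn (A.map e.toMonoidHom) (properInvariant (g.restrict hgW)) =
      {U | (∀ i, ∀ x ∈ U, ψ i x ∈ U) ∧ U ≠ ⊥ ∧ U ≠ ⊤} := by
    ext U
    rw [Set.mem_ofPred_eq, Option.forall]
    constructor
    · exact fun ⟨⟨hUg, h0⟩, hUA⟩ =>
        ⟨⟨hUg, fun a => smul_eq_self_iff.1 (hUA _ (Subgroup.mem_map_of_mem _ a.2))⟩, h0⟩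
    · rintro ⟨⟨hUg, hUA⟩, h0⟩
      refine ⟨⟨hUg, h0⟩, ?_⟩
      rintro _ ⟨a, ha, rfl⟩
      exact smul_eq_self_iff.2 (hUA ⟨a, ha⟩)
  rw [fixedIn_invariantIsotropic_ne_bot, hP', neg_one_mul, ← neg_eq_iff_eq_neg]
  exact neg_redEuler_isotropic hB.isRefl hnd hW hW' hc (Option.rec hg fun a => a.1.2.1) hφψ
    (fun i v => Subtype.ext ((hE' i v).trans (hφψ i _)))
    fun U hU x hx => hE x ▸ aeval_apply_smul_mem_of_le_comap hx E g (hU none)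

end HyperbolicIsometries

section DualPair

variable {K V : Type*} [Field K] [AddCommGroup V] [Module K V]

theorem aeval_apply_eq_projectionOnto {g : Module.End K V} {s s' a b : K[X]}
    (hab : a * s + b * s' = 1) (h0 : aeval g (s * s') = 0)
    (hc : IsCompl (LinearMap.ker (aeval g s)) (LinearMap.ker (aeval g s'))) (v : V) :
    aeval g (b * s') v = (Submodule.projectionOnto _ _ hc v : V) := by
  have hs : aeval g (b * s') v ∈ LinearMap.ker (aeval g s) := by
    rw [LinearMap.mem_ker, ← Module.End.mul_apply, ← map_mul, mul_left_comm, map_mul, h0, mul_zero,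
      LinearMap.zero_apply]
  have hs' : aeval g (a * s) v ∈ LinearMap.ker (aeval g s') := by
    rw [LinearMap.mem_ker, ← Module.End.mul_apply, ← map_mul, mul_left_comm, mul_comm s', map_mul,
      h0, mul_zero, LinearMap.zero_apply]
  have hv : aeval g (a * s) v + aeval g (b * s') v = v := by
    rw [← LinearMap.add_apply, ← map_add, hab, map_one, Module.End.one_apply]
  conv_rhs => rw [← hv, map_add, Submodule.projectionOnto_apply_of_mem_right hc hs', zero_add,
    Submodule.projectionOnto_apply_of_mem_left hc hs]

theorem isCoprime_of_monic_of_irreducible_of_ne {s t : K[X]} (hsm : s.Monic) (htm : t.Monic)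
    (hs : Irreducible s) (ht : Irreducible t) (hst : s ≠ t) : IsCoprime s t :=
  hs.coprime_iff_not_dvd.2 fun hd =>
    hst (eq_of_monic_of_associated hsm htm (hs.associated_of_dvd ht hd))

variable [Finite K] [FiniteDimensional K V] {p k : ℕ} [Fact p.Prime] [CharP K p]
  {B : V →ₗ[K] V →ₛₗ[iterateFrobenius K p k] K} {g : Module.End K V} {s s' : K[X]}

theorem isoEuler_pair (r : ℕ) (hK : Nat.card K = (p ^ k) ^ 2) (hB : IsHermitian B)
    (hnd : B.SeparatingLeft) (hg : ∀ u v, B (g u) (g v) = B u v) (hsm : s.Monic)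
    (hs : Irreducible s) (hs0 : s.coeff 0 ≠ 0) (hs' : s' = dualPoly (iterateFrobenius K p k) s)
    (hcop : IsCoprime s s') (h0 : aeval g (s * s') = 0) {m : ℕ} (hm0 : 0 < m)
    (hm : Module.finrank K (LinearMap.ker (aeval g s)) = m * s.natDegree) :
    isoEuler r B g = chiGL p (2 * (k * s.natDegree)) m r := by
  have hσ := iterateFrobenius_involutive (p := p) (k := k) hK
  have hs'0 : s'.coeff 0 ≠ 0 := hs' ▸ coeff_zero_dualPoly_ne_zero hsm hs0
  have hs's : dualPoly (iterateFrobenius K p k) s' = s := hs' ▸ dualPoly_dualPoly hσ hsm hs0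
  have hc := isCompl_ker_aeval hcop h0
  have hW : IsIsotropic B (LinearMap.ker (aeval g s)) := fun x hx y hy =>
    orthogonal_ker_aeval hσ hg hs0 (hs' ▸ hcop.symm) hx hy
  have hW' : IsIsotropic B (LinearMap.ker (aeval g s')) := fun x hx y hy =>
    orthogonal_ker_aeval hσ hg hs'0 (hs's.symm ▸ hcop) hx hy
  have : Finite V := Module.finite_of_finite K
  have : Nontrivial (LinearMap.ker (aeval g s)) :=
    Module.nontrivial_of_finrank_pos (R := K) (hm ▸ Nat.mul_pos hm0 hs.natDegree_pos)
  obtain ⟨a, b, hab⟩ := id hcop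
  rw [isoEuler_hyperbolic r hB hnd hW hW' hc hg (mapsTo_ker_aeval g s)
    (aeval_apply_eq_projectionOnto hab h0 hc)]
  exact eqEuler_commutingEquivs r hs (by rw [hK]; ring) (aeval_restrict_ker g s) hm

end DualPair

section Factorization

variable {K V : Type*} [Field K] [AddCommGroup V] [Module K V]

theorem finrank_ker_aeval_restrict {g : Module.End K V} {s t : K[X]} (hst : s ∣ t) :
    Module.finrank K (LinearMap.ker (aeval (g.restrict (mapsTo_ker_aeval g t)) s)) =
      Module.finrank K (LinearMap.ker (aeval g s)) := by
  have hle : LinearMap.ker (aeval g s) ≤ LinearMap.ker (aeval g t) := by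
    obtain ⟨c, rfl⟩ := hst
    rw [mul_comm, map_mul]
    exact LinearMap.ker_le_ker_comp _ _
  rw [← (Submodule.comapSubtypeEquivOfLe hle).finrank_eq]
  refine congrArg (fun U : Submodule K (LinearMap.ker (aeval g t)) => Module.finrank K U)
    (Submodule.ext fun x => ?_)
  rw [Submodule.mem_comap, LinearMap.mem_ker, LinearMap.mem_ker, ← Submodule.coe_eq_zero]
  exact Eq.congr_left (map_aeval_apply (Submodule.subtype _) (fun _ => rfl) s x)

theorem separatingLeft_domRestrict₁₂ {σ : K →+* K} {B : V →ₗ[K] V →ₛₗ[σ] K}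
    (hnd : B.SeparatingLeft) {W W' : Submodule K V} (hc : IsCompl W W')
    (horth : ∀ x ∈ W, ∀ y ∈ W', B x y = 0) : (B.domRestrict₁₂ W W).SeparatingLeft := by
  refine fun x hx => Subtype.ext (hnd x fun v => ?_)
  obtain ⟨w, hw, w', hw', rfl⟩ := Submodule.mem_sup.1 (hc.sup_eq_top ▸ Submodule.mem_top (x := v))
  rw [map_add, horth x x.2 w' hw', add_zero]
  exact hx ⟨w, hw⟩

theorem aeval_prod_eq_zero [FiniteDimensional K V] {ι : Type*} [Fintype ι] {g : Module.End K V}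
    {μ : K[X]} (hμ : Squarefree μ) (hμg : aeval g μ = 0) {t : ι → K[X]} {e : ι → ℕ}
    (ht : g.charpoly = ∏ i, t i ^ e i) : aeval g (∏ i, t i) = 0 := by
  have hdvd : minpoly K g ∣ (∏ i, t i) ^ ∑ i, e i := by
    refine (LinearMap.minpoly_dvd_charpoly g).trans ?_
    rw [ht, ← Finset.prod_pow]
    exact Finset.prod_dvd_prod_of_dvd _ _ fun i hi =>
      pow_dvd_pow _ (Finset.single_le_sum (fun _ _ => Nat.zero_le _) hi)
  have hsq : Squarefree (minpoly K g) := hμ.squarefree_of_dvd (minpoly.dvd K g hμg)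
  exact minpoly.dvd_iff.1 (hsq.isRadical _ _ hdvd)

variable {p k I J : ℕ} [Fact p.Prime] [CharP K p] {f : K[X]} {ρ : Fin I → K[X]} {a : Fin I → ℕ}
  {s s' : Fin J → K[X]} {b : Fin J → ℕ}

namespace IsDualFactorization

/-- The self-dual factors `ρ i` and `s j * s' j`. -/
def factor (ρ : Fin I → K[X]) (s s' : Fin J → K[X]) : Fin I ⊕ Fin J → K[X] :=
  Sum.elim ρ fun j => s j * s' j

theorem dualPoly_self (hf : IsDualFactorization (p ^ k) f ρ a s s' b) (i : Fin I) :
    dualPoly (iterateFrobenius K p k) (ρ i) = ρ i :=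
  ((isDual_iff (hf.monic_self i) (hf.coeff_zero_self i)).1 (hf.dual_self i)).symm

theorem eq_dualPoly (hf : IsDualFactorization (p ^ k) f ρ a s s' b) (j : Fin J) :
    s' j = dualPoly (iterateFrobenius K p k) (s j) :=
  (isDual_iff (hf.monic_pair j) (hf.coeff_zero_pair j)).1 (hf.dual_pair j)

theorem monic_dual (hf : IsDualFactorization (p ^ k) f ρ a s s' b) (j : Fin J) : (s' j).Monic :=
  hf.eq_dualPoly j ▸ dualPoly_monic (hf.coeff_zero_pair j)

theorem coeff_zero_dual (hf : IsDualFactorization (p ^ k) f ρ a s s' b) (j : Fin J) :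
    (s' j).coeff 0 ≠ 0 :=
  hf.eq_dualPoly j ▸ coeff_zero_dualPoly_ne_zero (hf.monic_pair j) (hf.coeff_zero_pair j)

theorem coeff_zero_factor (hf : IsDualFactorization (p ^ k) f ρ a s s' b) (i : Fin I ⊕ Fin J) :
    (factor ρ s s' i).coeff 0 ≠ 0 := by
  rcases i with i | j
  · exact hf.coeff_zero_self i
  · exact (mul_coeff_zero _ _).trans_ne (mul_ne_zero (hf.coeff_zero_pair j) (hf.coeff_zero_dual j))

theorem eq_prod_factor {q : ℕ} (hf : IsDualFactorization q f ρ a s s' b) :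
    f = ∏ i, factor ρ s s' i ^ Sum.elim a b i := by
  rw [Fintype.prod_sum_type]
  exact hf.eq_prod

theorem natDegree_eq (hf : IsDualFactorization (p ^ k) f ρ a s s' b) :
    f.natDegree = (∑ i, a i * (ρ i).natDegree) + ∑ j, 2 * (b j * (s j).natDegree) := by
  have hpair : ∀ j, (s j * s' j).Monic := fun j => (hf.monic_pair j).mul (hf.monic_dual j)
  rw [hf.eq_prod, (monic_prod_of_monic _ _ fun i _ => (hf.monic_self i).pow _).natDegree_mul
      (monic_prod_of_monic _ _ fun j _ => (hpair j).pow _),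
    natDegree_prod_of_monic _ _ fun i _ => (hf.monic_self i).pow _,
    natDegree_prod_of_monic _ _ fun j _ => (hpair j).pow _]
  congr 1
  · exact Finset.sum_congr rfl fun i _ => natDegree_pow _ _
  · refine Finset.sum_congr rfl fun j _ => ?_
    rw [natDegree_pow, (hf.monic_pair j).natDegree_mul (hf.monic_dual j), hf.eq_dualPoly,
      natDegree_dualPoly (hf.coeff_zero_pair j)]
    ring

section Involutive

variable (hσ : Function.Involutive (iterateFrobenius K p k))
include hσ

theorem irreducible_dual (hf : IsDualFactorization (p ^ k) f ρ a s s' b) (j : Fin J) :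
    Irreducible (s' j) :=
  hf.eq_dualPoly j ▸
    dualPoly_irreducible hσ (hf.monic_pair j) (hf.coeff_zero_pair j) (hf.irreducible_pair j)

theorem dualPoly_dual (hf : IsDualFactorization (p ^ k) f ρ a s s' b) (j : Fin J) :
    dualPoly (iterateFrobenius K p k) (s' j) = s j :=
  hf.eq_dualPoly j ▸ dualPoly_dualPoly hσ (hf.monic_pair j) (hf.coeff_zero_pair j)

theorem dualPoly_factor (hf : IsDualFactorization (p ^ k) f ρ a s s' b) (i : Fin I ⊕ Fin J) :
    dualPoly (iterateFrobenius K p k) (factor ρ s s' i) = factor ρ s s' i := by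
  rcases i with i | j
  · exact hf.dualPoly_self i
  · change dualPoly _ (s j * s' j) = s j * s' j
    rw [dualPoly_mul, hf.dualPoly_dual hσ, ← hf.eq_dualPoly, mul_comm]

theorem isCoprime_pair (hf : IsDualFactorization (p ^ k) f ρ a s s' b) (j : Fin J) :
    IsCoprime (s j) (s' j) :=
  isCoprime_of_monic_of_irreducible_of_ne (hf.monic_pair j) (hf.monic_dual j)
    (hf.irreducible_pair j) (hf.irreducible_dual hσ j) (hf.ne_pair j)

theorem isCoprime_self_pair (hf : IsDualFactorization (p ^ k) f ρ a s s' b) (i : Fin I)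
    (j : Fin J) : IsCoprime (ρ i) (s j * s' j) := by
  have hs : ρ i ≠ s j := fun e => hf.ne_pair j (by rw [hf.eq_dualPoly, ← e, hf.dualPoly_self])
  have hs' : ρ i ≠ s' j := fun e => hs (by rw [← hf.dualPoly_dual hσ, ← e, hf.dualPoly_self])
  exact (isCoprime_of_monic_of_irreducible_of_ne (hf.monic_self i) (hf.monic_pair j)
    (hf.irreducible_self i) (hf.irreducible_pair j) hs).mul_right
    (isCoprime_of_monic_of_irreducible_of_ne (hf.monic_self i) (hf.monic_dual j)
      (hf.irreducible_self i) (hf.irreducible_dual hσ j) hs')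

theorem isCoprime_pair_pair (hf : IsDualFactorization (p ^ k) f ρ a s s' b) {j j' : Fin J}
    (hjj' : j ≠ j') : IsCoprime (s j * s' j) (s j' * s' j') := by
  have hs' : s' j ≠ s' j' := fun e => (hf.distinct_pair j j' hjj').1
    (by rw [← hf.dualPoly_dual hσ, e, hf.dualPoly_dual hσ])
  refine IsCoprime.mul_left (IsCoprime.mul_right ?_ ?_) (IsCoprime.mul_right ?_ ?_)
  · exact isCoprime_of_monic_of_irreducible_of_ne (hf.monic_pair j) (hf.monic_pair j')
      (hf.irreducible_pair j) (hf.irreducible_pair j') (hf.distinct_pair j j' hjj').1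
  · exact isCoprime_of_monic_of_irreducible_of_ne (hf.monic_pair j) (hf.monic_dual j')
      (hf.irreducible_pair j) (hf.irreducible_dual hσ j') (hf.distinct_pair j j' hjj').2
  · exact isCoprime_of_monic_of_irreducible_of_ne (hf.monic_dual j) (hf.monic_pair j')
      (hf.irreducible_dual hσ j) (hf.irreducible_pair j') (hf.distinct_pair j' j hjj'.symm).2.symm
  · exact isCoprime_of_monic_of_irreducible_of_ne (hf.monic_dual j) (hf.monic_dual j')
      (hf.irreducible_dual hσ j) (hf.irreducible_dual hσ j') hs'

theorem pairwise_isCoprime (hf : IsDualFactorization (p ^ k) f ρ a s s' b) :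
    Pairwise (Function.onFun IsCoprime (factor ρ s s')) := by
  rintro (i | j) (i' | j') hne
  · exact isCoprime_of_monic_of_irreducible_of_ne (hf.monic_self i) (hf.monic_self i')
      (hf.irreducible_self i) (hf.irreducible_self i') (hf.injective_self.ne fun e => hne (e ▸ rfl))
  · exact hf.isCoprime_self_pair hσ i j'
  · exact (hf.isCoprime_self_pair hσ i' j).symm
  · exact hf.isCoprime_pair_pair hσ fun e => hne (e ▸ rfl)

theorem isCoprime_prod_erase (hf : IsDualFactorization (p ^ k) f ρ a s s' b)
    (i : Fin I ⊕ Fin J) (e : Fin I ⊕ Fin J → ℕ) :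
    IsCoprime (factor ρ s s' i) (∏ j ∈ Finset.univ.erase i, factor ρ s s' j ^ e j) :=
  IsCoprime.prod_right fun _ hj =>
    (hf.pairwise_isCoprime hσ (Finset.ne_of_mem_erase hj).symm).pow_right

end Involutive

variable [FiniteDimensional K V] {g : Module.End K V} {μ : K[X]}

theorem finrank_ker_self (hσ : Function.Involutive (iterateFrobenius K p k))
    (hf : IsDualFactorization (p ^ k) g.charpoly ρ a s s' b) (hμ : Squarefree μ)
    (hμg : aeval g μ = 0) (i : Fin I) :
    Module.finrank K (LinearMap.ker (aeval g (ρ i))) = a i * (ρ i).natDegree := by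
  obtain ⟨Q, hQ, h0⟩ := exists_isCoprime_aeval_mul_eq_zero hμ hμg (hf.irreducible_self i)
  exact finrank_ker_aeval (hf.monic_self i) hQ h0
    (hf.eq_prod_factor.trans (Finset.mul_prod_erase _ _ (Finset.mem_univ (Sum.inl i))).symm)
    (hf.isCoprime_prod_erase hσ (Sum.inl i) _)

theorem finrank_ker_pair (hσ : Function.Involutive (iterateFrobenius K p k))
    (hf : IsDualFactorization (p ^ k) g.charpoly ρ a s s' b) (hμ : Squarefree μ)
    (hμg : aeval g μ = 0) (j : Fin J) :
    Module.finrank K (LinearMap.ker (aeval g (s j))) = b j * (s j).natDegree := by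
  obtain ⟨Q, hQ, h0⟩ := exists_isCoprime_aeval_mul_eq_zero hμ hμg (hf.irreducible_pair j)
  have hcharpoly : g.charpoly = (s j * s' j) ^ b j * _ :=
    hf.eq_prod_factor.trans (Finset.mul_prod_erase _ _ (Finset.mem_univ (Sum.inr j))).symm
  rw [mul_pow, mul_assoc] at hcharpoly
  exact finrank_ker_aeval (hf.monic_pair j) hQ h0 hcharpoly
    ((hf.isCoprime_pair hσ j).pow_right.mul_right
      (hf.isCoprime_prod_erase hσ (Sum.inr j) _).of_mul_left_left)

theorem isoEuler_eq [Finite K] {B : V →ₗ[K] V →ₛₗ[iterateFrobenius K p k] K} (r : ℕ) (hk : 0 < k)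
    (hK : Nat.card K = (p ^ k) ^ 2) (hB : IsHermitian B) (hnd : B.SeparatingLeft)
    (hg : ∀ u v, B (g u) (g v) = B u v) (hμ : Squarefree μ) (hμg : aeval g μ = 0)
    (hf : IsDualFactorization (p ^ k) g.charpoly ρ a s s' b) :
    isoEuler r B g = (∏ i, -chiGU p (k * (ρ i).natDegree) (a i) r) *
      ∏ j, chiGL p (2 * (k * (s j).natDegree)) (b j) r := by
  have hσ := iterateFrobenius_involutive (p := p) (k := k) hK
  have : Finite V := Module.finite_of_finite K
  have hcop := hf.pairwise_isCoprime hσ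
  have h0 := aeval_prod_eq_zero hμ hμg hf.eq_prod_factor
  have horth : ∀ i Q, IsCoprime (factor ρ s s' i) Q →
      ∀ x ∈ LinearMap.ker (aeval g (factor ρ s s' i)), ∀ y ∈ LinearMap.ker (aeval g Q),
        B x y = 0 := fun i Q hQ x hx y hy =>
    orthogonal_ker_aeval hσ hg (hf.coeff_zero_factor i) ((hf.dualPoly_factor hσ i).symm ▸ hQ) hx hy
  have hndW : ∀ i, (B.domRestrict₁₂ (LinearMap.ker (aeval g (factor ρ s s' i)))
      (LinearMap.ker (aeval g (factor ρ s s' i)))).SeparatingLeft := fun i => by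
    have hQ := hf.isCoprime_prod_erase hσ i 1
    simp only [Pi.one_apply, pow_one] at hQ
    refine separatingLeft_domRestrict₁₂ hnd (isCompl_ker_aeval hQ ?_) (horth i _ hQ)
    rwa [Finset.mul_prod_erase _ _ (Finset.mem_univ i)]
  rw [isoEuler_eq_prod r hcop h0 fun i j hij => horth i _ (hcop hij), Fintype.prod_sum_type]
  congr 1
  · refine Finset.prod_congr rfl fun i _ => ?_
    exact isoEuler_selfDual r hk hK (hB.domRestrict₁₂ _) (hndW (Sum.inl i))
      (fun u v => hg u v) (hf.irreducible_self i) (hf.coeff_zero_self i) (hf.dualPoly_self i)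
      (aeval_restrict_ker g _) (hf.finrank_ker_self hσ hμ hμg i)
  · refine Finset.prod_congr rfl fun j _ => ?_
    exact isoEuler_pair r hK (hB.domRestrict₁₂ _) (hndW (Sum.inr j)) (fun u v => hg u v)
      (hf.monic_pair j) (hf.irreducible_pair j) (hf.coeff_zero_pair j) (hf.eq_dualPoly j)
      (hf.isCoprime_pair hσ j) (aeval_restrict_ker g _) (hf.pos_pair j)
      ((finrank_ker_aeval_restrict (dvd_mul_right _ _)).trans (hf.finrank_ker_pair hσ hμ hμg j))

end IsDualFactorization

end Factorization

section SelfDual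

open scoped Matrix

variable {K V : Type*} [Field K] [AddCommGroup V] [Module K V] {σ : K →+* K}

theorem dualPoly_matrix_charpoly {ι : Type*} [Fintype ι] [DecidableEq ι] {G : Matrix ι ι K}
    (hG : G.det ≠ 0) : dualPoly σ G.charpoly = (G.map σ)⁻¹.charpoly := by
  have hdet : (G.map σ).det = σ G.det := (σ.map_det G).symm
  have hunit : IsUnit (G.map σ) := by
    rw [Matrix.isUnit_iff_isUnit_det, hdet, isUnit_iff_ne_zero]
    exact (_root_.map_ne_zero σ).2 hG
  have hcoeff : G.charpoly.coeff 0 = (-1) ^ Fintype.card ι * G.det := by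
    rw [G.det_eq_sign_charpoly_coeff, ← mul_assoc, ← mul_pow, neg_one_mul, neg_neg, one_pow,
      one_mul]
  rw [Matrix.charpoly_inv _ hunit, hdet, Ring.inverse_eq_inv', ← Matrix.reverse_charpoly,
    Matrix.charpoly_map, dualPoly, hcoeff]
  simp [← inv_pow, inv_neg, mul_comm]

variable {ι : Type*} [Fintype ι] [DecidableEq ι] (b : Module.Basis ι K V)
  {B : V →ₗ[K] V →ₛₗ[σ] K}

theorem det_toMatrix₂_ne_zero (hnd : B.SeparatingLeft) : (LinearMap.toMatrix₂ b b B).det ≠ 0 := by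
  intro h
  obtain ⟨v, hv, hvB⟩ := Matrix.exists_vecMul_eq_zero_iff.2 h
  refine hv (b.equivFun.symm.map_eq_zero_iff.1 (hnd _ fun w => ?_))
  have hdot := dotProduct_toMatrix₂_mulVec b b B v (b.equivFun w)
  rw [b.equivFun.symm_apply_apply, RingHom.coe_id, Function.id_comp, Matrix.dotProduct_mulVec, hvB,
    zero_dotProduct] at hdot
  exact hdot.symm

theorem transpose_mul_toMatrix₂_mul_map {g : Module.End K V}
    (hg : ∀ u v, B (g u) (g v) = B u v) :
    (LinearMap.toMatrix b b g)ᵀ * LinearMap.toMatrix₂ b b B * (LinearMap.toMatrix b b g).map σ =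
      LinearMap.toMatrix₂ b b B := by
  ext i j
  rw [LinearMap.toMatrix₂_apply, ← hg, apply_eq_dotProduct_toMatrix₂_mulVec b b B (g (b i)),
    Matrix.mul_assoc]
  simp only [Matrix.mul_apply, dotProduct, Matrix.mulVec, Matrix.transpose_apply, Matrix.map_apply,
    LinearMap.toMatrix_apply, Function.comp_apply, RingHom.id_apply]

theorem dualPoly_charpoly_of_isometry [FiniteDimensional K V] (hnd : B.SeparatingLeft)
    {g : Module.End K V} (hg : ∀ u v, B (g u) (g v) = B u v) :
    dualPoly σ g.charpoly = g.charpoly := by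
  let b := Module.finBasis K V
  set G := LinearMap.toMatrix b b g
  set J := LinearMap.toMatrix₂ b b B
  have hGJ : Gᵀ * J * G.map σ = J := transpose_mul_toMatrix₂_mul_map b hg
  have hJ : IsUnit J.det := isUnit_iff_ne_zero.2 (det_toMatrix₂_ne_zero b hnd)
  have hG : G.det ≠ 0 := fun h => det_toMatrix₂_ne_zero b hnd <| by
    rw [show LinearMap.toMatrix₂ b b B = J from rfl, ← hGJ, Matrix.det_mul, Matrix.det_mul,
      Matrix.det_transpose, h, zero_mul, zero_mul]
  have hinv : (G.map σ)⁻¹ = J⁻¹ * Gᵀ * J := Matrix.inv_eq_left_inv <| by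
    rw [Matrix.mul_assoc, Matrix.mul_assoc, ← Matrix.mul_assoc Gᵀ, hGJ, Matrix.nonsing_inv_mul _ hJ]
  rw [← LinearMap.charpoly_toMatrix g b, dualPoly_matrix_charpoly hG, hinv,
    ← Matrix.charpoly_transpose G]
  exact Matrix.charpoly_units_conj' (Matrix.nonsingInvUnit J hJ) Gᵀ

theorem coeff_zero_charpoly_ne_zero [FiniteDimensional K V] {g : Module.End K V}
    (hg : Function.Injective g) : g.charpoly.coeff 0 ≠ 0 := by
  intro h0
  have hdet := LinearMap.det_eq_sign_charpoly_coeff g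
  rw [h0, mul_zero] at hdet
  exact (LinearMap.bot_lt_ker_of_det_eq_zero hdet).ne' (LinearMap.ker_eq_bot.2 hg)

end SelfDual

section Existence

theorem exists_prod_eq_prod_fixed_mul_prod_pairs {α M : Type*} [DecidableEq α] [CommMonoid M]
    {S : Finset α} {D : α → α} (hDS : ∀ t ∈ S, D t ∈ S) (hDD : ∀ t ∈ S, D (D t) = t) (F : α → M) :
    ∃ T ⊆ S, (∀ t ∈ T, D t ∉ T) ∧
      ∏ t ∈ S, F t = (∏ t ∈ S with D t = t, F t) * ∏ t ∈ T, F t * F (D t) := by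
  obtain ⟨_, -⟩ := exists_wellFoundedLT α
  have hswap : ∏ t ∈ S with D t < t, F t = ∏ t ∈ S with t < D t, F (D t) := by
    refine Finset.prod_nbij' D D ?_ ?_ ?_ ?_ ?_ <;> simp +contextual [hDS, hDD]
  refine ⟨S.filter fun t => t < D t, Finset.filter_subset _ _, ?_, ?_⟩
  · intro t ht hDt
    rw [Finset.mem_filter] at ht hDt
    exact lt_asymm ht.2 (hDt.2.trans_eq (hDD t ht.1))
  · rw [Finset.prod_mul_distrib, ← hswap,
      ← Finset.prod_filter_mul_prod_filter_not S (fun t => D t = t) F]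
    congr 1
    rw [← Finset.prod_filter_mul_prod_filter_not (S.filter _) (fun t => t < D t),
      Finset.filter_filter, Finset.filter_filter]
    congr 2 <;> ext t <;> grind

variable {K : Type*} [Field K] {σ : K →+* K} {f : K[X]}

open UniqueFactorizationMonoid

section DecidableEq

variable [DecidableEq K]

theorem irreducible_and_monic_and_coeff_zero_ne_zero (h0 : f.coeff 0 ≠ 0) {t : K[X]}
    (ht : t ∈ normalizedFactors f) : Irreducible t ∧ t.Monic ∧ t.coeff 0 ≠ 0 := by
  have hirr := irreducible_of_normalized_factor t ht
  refine ⟨hirr, normalize_normalized_factor t ht ▸ monic_normalize hirr.ne_zero, fun ht0 => h0 ?_⟩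
  obtain ⟨c, rfl⟩ := dvd_of_mem_normalizedFactors ht
  rw [mul_coeff_zero, ht0, zero_mul]

theorem map_dualPoly_normalizedFactors (hσ : Function.Involutive σ) (hm : f.Monic)
    (h0 : f.coeff 0 ≠ 0) (hf : dualPoly σ f = f) :
    (normalizedFactors f).map (dualPoly σ) = normalizedFactors f := by
  have hdual : ∀ t ∈ (normalizedFactors f).map (dualPoly σ), Irreducible t ∧ t.Monic :=
    Multiset.forall_mem_map_iff.2 fun t ht =>
      have ⟨hirr, htm, ht0⟩ := irreducible_and_monic_and_coeff_zero_ne_zero h0 ht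
      ⟨dualPoly_irreducible hσ htm ht0 hirr, dualPoly_monic ht0⟩
  have hprod : ((normalizedFactors f).map (dualPoly σ)).prod = f := by
    rw [← dualPoly_multiset_prod, prod_normalizedFactors_eq hm.ne_zero, hm.normalize_eq_self, hf]
  have h := normalizedFactors_prod_eq _ fun t ht => (hdual t ht).1
  rw [hprod, Multiset.map_congr rfl fun t ht => (hdual t ht).2.normalize_eq_self,
    Multiset.map_id'] at h
  exact h.symm

theorem count_dualPoly_normalizedFactors (hσ : Function.Involutive σ) (hm : f.Monic)
    (h0 : f.coeff 0 ≠ 0) (hf : dualPoly σ f = f) {t : K[X]} (ht : t ∈ normalizedFactors f) :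
    (normalizedFactors f).count (dualPoly σ t) = (normalizedFactors f).count t := by
  have hdd : ∀ u ∈ normalizedFactors f, dualPoly σ (dualPoly σ u) = u := fun u hu =>
    have ⟨_, hum, hu0⟩ := irreducible_and_monic_and_coeff_zero_ne_zero h0 hu
    dualPoly_dualPoly hσ hum hu0
  nth_rw 1 [← map_dualPoly_normalizedFactors hσ hm h0 hf]
  exact Multiset.count_map_eq_count _ _
    (fun u hu v hv huv => by rw [← hdd u hu, huv, hdd v hv]) t ht

end DecidableEq

variable {p k : ℕ} [Fact p.Prime] [CharP K p]

theorem exists_isDualFactorization_prod {S T : Finset K[X]} {m : K[X] → ℕ}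
    (hST : ∀ t, t ∈ S ∨ t ∈ T → Irreducible t ∧ t.Monic ∧ t.coeff 0 ≠ 0 ∧ 0 < m t)
    (hS : ∀ t ∈ S, dualPoly (iterateFrobenius K p k) t = t)
    (hT : ∀ t ∈ T, dualPoly (iterateFrobenius K p k) t ∉ T) :
    ∃ (I J : ℕ) (ρ : Fin I → K[X]) (a : Fin I → ℕ) (s s' : Fin J → K[X]) (b : Fin J → ℕ),
      IsDualFactorization (p ^ k) ((∏ t ∈ S, t ^ m t) *
        ∏ t ∈ T, (t * dualPoly (iterateFrobenius K p k) t) ^ m t) ρ a s s' b := by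
  let eS := S.equivFin.symm
  let eT := T.equivFin.symm
  have hS' := fun i => hST _ (Or.inl (eS i).2)
  have hT' := fun j => hST _ (Or.inr (eT j).2)
  refine ⟨S.card, T.card, fun i => eS i, fun i => m (eS i), fun j => eT j,
    fun j => dualPoly _ (eT j).1, fun j => m (eT j),
    { monic_self := fun i => (hS' i).2.1
      irreducible_self := fun i => (hS' i).1
      coeff_zero_self := fun i => (hS' i).2.2.1
      dual_self := fun i => (isDual_iff (hS' i).2.1 (hS' i).2.2.1).2 (hS _ (eS i).2).symm
      injective_self := Subtype.val_injective.comp eS.injective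
      pos_self := fun i => (hS' i).2.2.2
      monic_pair := fun j => (hT' j).2.1
      irreducible_pair := fun j => (hT' j).1
      coeff_zero_pair := fun j => (hT' j).2.2.1
      dual_pair := fun j => (isDual_iff (hT' j).2.1 (hT' j).2.2.1).2 rfl
      ne_pair := fun j e => hT _ (eT j).2 (e ▸ (eT j).2)
      distinct_pair := fun j j' hjj' => ⟨fun e => hjj' (eT.injective (Subtype.ext e)),
        fun e => hT _ (eT j').2 (e ▸ (eT j).2)⟩
      pos_pair := fun j => (hT' j).2.2.2
      eq_prod := ?_ }⟩
  rw [eS.prod_comp fun t : S => t.1 ^ m t, S.prod_coe_sort fun t => t ^ m t,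
    eT.prod_comp fun t : T => (t.1 * dualPoly _ t.1) ^ m t,
    T.prod_coe_sort fun t => (t * dualPoly _ t) ^ m t]

theorem exists_isDualFactorization (hσ : Function.Involutive (iterateFrobenius K p k))
    (hm : f.Monic) (h0 : f.coeff 0 ≠ 0) (hf : dualPoly (iterateFrobenius K p k) f = f) :
    ∃ (I J : ℕ) (ρ : Fin I → K[X]) (a : Fin I → ℕ) (s s' : Fin J → K[X]) (b : Fin J → ℕ),
      IsDualFactorization (p ^ k) f ρ a s s' b := by
  classical
  set D := dualPoly (iterateFrobenius K p k)
  set M := normalizedFactors f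
  have hM : ∀ t ∈ M.toFinset, Irreducible t ∧ t.Monic ∧ t.coeff 0 ≠ 0 := fun t ht =>
    irreducible_and_monic_and_coeff_zero_ne_zero h0 (Multiset.mem_toFinset.1 ht)
  have hpos : ∀ t ∈ M.toFinset, 0 < M.count t := fun t ht =>
    Multiset.count_pos.2 (Multiset.mem_toFinset.1 ht)
  have hcount : ∀ t ∈ M.toFinset, M.count (D t) = M.count t := fun t ht =>
    count_dualPoly_normalizedFactors hσ hm h0 hf (Multiset.mem_toFinset.1 ht)
  have hDM : ∀ t ∈ M.toFinset, D t ∈ M.toFinset := fun t ht =>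
    Multiset.mem_toFinset.2 <| Multiset.count_pos.1 <| (hcount t ht).symm ▸ hpos t ht
  have hDD : ∀ t ∈ M.toFinset, D (D t) = t := fun t ht =>
    dualPoly_dualPoly hσ (hM t ht).2.1 (hM t ht).2.2
  obtain ⟨T, hTM, hDT, hprod⟩ :=
    exists_prod_eq_prod_fixed_mul_prod_pairs hDM hDD fun t => t ^ M.count t
  have hfprod : f = (∏ t ∈ M.toFinset with D t = t, t ^ M.count t) *
      ∏ t ∈ T, (t * D t) ^ M.count t := by
    rw [Finset.prod_congr rfl fun t ht => (mul_pow t (D t) _).trans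
        (congrArg (fun e => t ^ M.count t * D t ^ e) (hcount t (hTM ht)).symm), ← hprod,
      ← Finset.prod_multiset_count, prod_normalizedFactors_eq hm.ne_zero, hm.normalize_eq_self]
  rw [hfprod]
  refine exists_isDualFactorization_prod (fun t ht => ?_)
    (fun t ht => (Finset.mem_filter.1 ht).2) hDT
  have htM := ht.elim (Finset.mem_of_mem_filter t) (hTM ·)
  exact ⟨(hM t htM).1, (hM t htM).2.1, (hM t htM).2.2, hpos t htM⟩

end Existence

section Centralizer

variable {K V : Type*} [Field K] [AddCommGroup V] [Module K V]

theorem neg_eqEuler_centralizer [FiniteDimensional K V] {σ : K →+* K} (B : V →ₗ[K] V →ₛₗ[σ] K)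
    (r : ℕ) (g : V ≃ₗ[K] V) :
    -eqEuler r (isometryGroup B ⊓ Subgroup.centralizer {g})
      {U : Submodule K V | U ∈ isotropicSubspaces B ∧ g • U = U} =
      isoEuler r B (g : V →ₗ[K] V) := by
  have hgroup : isometryGroup B ⊓ Subgroup.centralizer {g} =
      commutingIsometries B (g : V →ₗ[K] V) := by
    refine congrArg _ (Subgroup.ext fun φ => ?_)
    rw [Subgroup.mem_centralizer_singleton_iff]
    exact LinearEquiv.ext_iff
  have hposet : {U : Submodule K V | U ∈ isotropicSubspaces B ∧ g • U = U} =
      {U | U ∈ invariantIsotropic B (g : V →ₗ[K] V) ∧ U ≠ ⊥} := by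
    ext U
    simp only [Set.mem_ofPred_eq, smul_eq_self_iff, isotropicSubspaces, invariantIsotropic]
    tauto
  rw [hgroup, hposet, isoEuler]

theorem exists_squarefree_aeval_eq_zero {p : ℕ} [Fact p.Prime] [CharP K p] {g : V ≃ₗ[K] V}
    (hg : p.Coprime (orderOf g)) :
    ∃ μ : K[X], Squarefree μ ∧ aeval (g : Module.End K V) μ = 0 := by
  refine ⟨X ^ orderOf g - 1, (X_pow_sub_one_separable_iff.2 ?_).squarefree, ?_⟩
  · rw [Ne, CharP.cast_eq_zero_iff K p]
    exact (Nat.Prime.coprime_iff_not_dvd Fact.out).1 hg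
  · rw [map_sub, map_pow, aeval_X, map_one, sub_eq_zero]
    have h := congrArg (LinearEquiv.automorphismGroup.toLinearMapMonoidHom) (pow_orderOf_eq_one g)
    rwa [map_pow, map_one] at h

end Centralizer

theorem card_galoisField (p k : ℕ) [Fact p.Prime] (hk : 0 < k) :
    Nat.card (GaloisField p (2 * k)) = (p ^ k) ^ 2 := by
  rw [GaloisField.card p _ (by omega), ← pow_mul, mul_comm]

end UnitaryEuler

end

open UnitaryEuler Pointwise in
theorem lemma4p3_general {K V : Type*} [Field K] [Finite K] [AddCommGroup V] [Module K V]
    [FiniteDimensional K V] {p k : ℕ} [Fact p.Prime] [CharP K p] (hk : 0 < k)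
    (hK : Nat.card K = (p ^ k) ^ 2) {B : V →ₗ[K] V →ₛₗ[iterateFrobenius K p k] K}
    (hB : IsHermitian B) (hnd : B.SeparatingLeft) (r : ℕ) :
    (∀ rep : ConjClasses (isometryGroup B) → isometryGroup B, (∀ c, ConjClasses.mk (rep c) = c) →
      eqEuler (r + 1) (isometryGroup B) (isotropicSubspaces B) =
        ∑ᶠ (c : ConjClasses (isometryGroup B)) (_ : Nat.Coprime (p ^ k) (orderOf (rep c))),
          eqEuler r (isometryGroup B ⊓ Subgroup.centralizer {(rep c).1})
            {U | U ∈ isotropicSubspaces B ∧ (rep c).1 • U = U}) ∧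
    ∀ g : isometryGroup B,
      (∃ (I J : ℕ) (ρ : Fin I → Polynomial K) (a : Fin I → ℕ) (s s' : Fin J → Polynomial K)
          (b : Fin J → ℕ),
        IsDualFactorization (p ^ k) (LinearMap.charpoly g.1.toLinearMap) ρ a s s' b) ∧
      ∀ (I J : ℕ) (ρ : Fin I → Polynomial K) (a : Fin I → ℕ) (s s' : Fin J → Polynomial K)
          (b : Fin J → ℕ),
        IsDualFactorization (p ^ k) (LinearMap.charpoly g.1.toLinearMap) ρ a s s' b →
          (∑ i, a i * (ρ i).natDegree) + (∑ j, 2 * (b j * (s j).natDegree)) =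
            Module.finrank K V ∧
          (Nat.Coprime (p ^ k) (orderOf g) →
            -eqEuler r (isometryGroup B ⊓ Subgroup.centralizer {g.1})
                {U : Submodule K V | U ∈ isotropicSubspaces B ∧ g.1 • U = U} =
              (∏ i, -chiGU p (k * (ρ i).natDegree) (a i) r) *
                ∏ j, chiGL p (2 * (k * (s j).natDegree)) (b j) r) := by
  have : Finite V := Module.finite_of_finite K
  refine ⟨eqEuler_isotropicSubspaces_succ hB.isRefl hk.ne' r, fun g => ⟨?_, ?_⟩⟩
  · exact exists_isDualFactorization (iterateFrobenius_involutive hK) (LinearMap.charpoly_monic _)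
      (coeff_zero_charpoly_ne_zero g.1.injective) (dualPoly_charpoly_of_isometry hnd g.2)
  · intro I J ρ a s s' b hf
    refine ⟨hf.natDegree_eq.symm.trans (LinearMap.charpoly_natDegree _), fun hg => ?_⟩
    rw [← Subgroup.orderOf_coe] at hg
    obtain ⟨μ, hμ, hμg⟩ :=
      exists_squarefree_aeval_eq_zero (hg.coprime_dvd_left (dvd_pow_self p hk.ne'))
    rw [neg_eqEuler_centralizer, hf.isoEuler_eq r hk hK hB hnd g.2 hμ hμg]

open UnitaryEuler in
theorem lemma4p3 (p : ℕ) [Fact p.Prime] (k : ℕ) (hk : 0 < k) (n : ℕ) (hn : 1 < n)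
    (r : ℕ) (hr : 1 ≤ r) :
    -- the sum over the `q`-regular classes, `q = p ^ k`, for any choice of representatives
    (∀ rep : ConjClasses (GU p k n) → GU p k n, (∀ c, ConjClasses.mk (rep c) = c) →
      chiGU p k n (r + 1) =
        ∑ᶠ (c : ConjClasses (GU p k n)) (_ : Nat.Coprime (p ^ k) (orderOf (rep c))),
          chiCentralizer p k n r (rep c)) ∧
    -- the contribution of a `q`-regular class
    ∀ g : GU p k n, Nat.Coprime (p ^ k) (orderOf g) →
      (∃ (I J : ℕ) (ρ : Fin I → Polynomial (GaloisField p (2 * k))) (a : Fin I → ℕ)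
          (s s' : Fin J → Polynomial (GaloisField p (2 * k))) (b : Fin J → ℕ),
        IsDualFactorization (p ^ k) (LinearMap.charpoly g.1.toLinearMap) ρ a s s' b) ∧
      ∀ (I J : ℕ) (ρ : Fin I → Polynomial (GaloisField p (2 * k))) (a : Fin I → ℕ)
          (s s' : Fin J → Polynomial (GaloisField p (2 * k))) (b : Fin J → ℕ),
        IsDualFactorization (p ^ k) (LinearMap.charpoly g.1.toLinearMap) ρ a s s' b →
          (∑ i, a i * (ρ i).natDegree) + (∑ j, 2 * (b j * (s j).natDegree)) = n ∧
          -chiCentralizer p k n r g =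
            (∏ i, -chiGU p (k * (ρ i).natDegree) (a i) r) *
              ∏ j, chiGL p (2 * (k * (s j).natDegree)) (b j) r := by
  have hK := card_galoisField p k hk
  have ⟨hsum, hreg⟩ := lemma4p3_general hk hK (isHermitian_hermSesq n hk hK)
    (separatingLeft_hermSesq n hk hK) r
  exact ⟨hsum, fun g hg => ⟨(hreg g).1, fun I J ρ a s s' b hf =>
    ((hreg g).2 I J ρ a s s' b hf).imp (·.trans (Module.finrank_fin_fun _)) (· hg)⟩⟩
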